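/- Let $\Omega\subset\mathbb R^d$ be a connected compact set with smooth boundary (near each boundary point, $\Omega=\{\rho\le 0\}$ for a smooth $\rho$ with non-vanishing differential), and let $\lambda$ be Lebesgue measure. Derivatives are taken in the distributional sense on the interior of $\Omega$, and $L^2(\Omega)$, $H^1(\Omega)$ are taken with respect to $\lambda$. Let $\mathcal P_2(\Omega)$ be the set of probability measures $\mu$ on $\Omega$ with $\mu\ll\lambda$ whose density, again denoted $\mu(\cdot)$, lies in $H^1(\Omega)$ and is nonzero $\lambda$-almost everywhere on $\Omega$. The Stein class $\mathcal S(\mu)$ is the set of $\phi\in H^1(\Omega)^d$ with $\oint_{\partial\Omega}\mu(x)\,\phi(x)\cdot\vec n(x)\,\mathrm dS(x)=0$, where $\vec n$ is the outward unit normal and boundary values are traces; a scalar function $h$ is said to be in $\mathcal S(\mu)$ if $h\,e_i\in\mathcal S(\mu)$ for every vector $e_i$ of the standard basis. Let $\mu,\pi\in\mathcal P_2(\Omega)$. Assume that $\log\pi$ is weakly differentiable on the interior of $\Omega$ (it is locally integrable and its distributional gradient is a locally integrable function) and that $\mu(\cdot)\nabla\log\pi\in L^2(\Omega)$. For a weakly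 differentiable vector field $\phi$ let $\mathcal A_\pi\phi=\nabla\log\pi\cdot\phi+\nabla\cdot\phi$. Let $k:\Omega\times\Omega\to\mathbb R$ be continuous, symmetric and integrally positive definite (that is, $\int_\Omega\int_\Omega g(x)k(x,y)g(y)\,\mathrm dx\,\mathrm dy>0$ for every nonzero $g\in L^2(\Omega)$), such that $k(\cdot,x)\in\mathcal S(\mu)\cap\mathcal S(\pi)$ for every $x\in\Omega$ and $\partial_{x_i}\partial_{y_j}k\in L^2(\Omega\times\Omega)$ for all $i,j$. Let $\mathcal H_0$ be the reproducing kernel Hilbert space of real functions on $\Omega$ with kernel $k$, and let $\mathcal H=\mathcal H_0^d$ with $\langle f,g\rangle_{\mathcal H}=\sum_{i=1}^d\langle f_i,g_i\rangle_{\mathcal H_0}$. Then every $f\in\mathcal H$ is weakly differentiable with $\mathcal A_\pi f\in L^1(\mu)$, the kernelized Stein discrepancy $$\mathfrak K(\mu|\pi)=\max\{\mathbb E_{x\sim\mu}[\mathcal A_\pi f(x)] : f\in\mathcal H,\ \|f\|_{\mathcal H}\le 1\}$$ exists (the maximum is attained), and $$\mu=\pi\iff\mathfrak K(\mu|\pi)=0.$$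 -/

import Mathlib

open MeasureTheory Filter Topology
open scoped ContDiff ENNReal

namespace SteinKSD

/-- The ambient Euclidean space `ℝ^d`. -/
abbrev Eucl (d : ℕ) : Type := EuclideanSpace ℝ (Fin d)

noncomputable section

/-! ### The domain and its boundary -/

/-- `Ω` is a connected compact subset of `ℝ^d` with smooth boundary: near each of its boundary
points it is the sublevel set `{ρ ≤ 0}` of a smooth function with non-vanishing differential. -/
structure IsSmoothCompactDomain {d : ℕ} (Ω : Set (Eucl d)) : Prop where
  isCompact : IsCompact Ω
  isConnected : IsConnected Ω
  smooth_boundary : ∀ x ∈ frontier Ω, ∃ (V : Set (Eucl d)) (ρ : Eucl d → ℝ),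
    IsOpen V ∧ x ∈ V ∧ ContDiff ℝ ∞ ρ ∧ fderiv ℝ ρ x ≠ 0 ∧ ∀ y ∈ V, (y ∈ Ω ↔ ρ y ≤ 0)

/-- `v` is the outward unit normal of `Ω` at the boundary point `x`: directions in the open half
space `⟪v, w⟫ < 0` enter `Ω`, those in the opposite open half space leave it. There is at most
one such `v`, and at a boundary point of a smooth domain it is `∇ρ / ‖∇ρ‖`. -/
def IsOutwardUnitNormal {d : ℕ} (Ω : Set (Eucl d)) (x v : Eucl d) : Prop :=
  ‖v‖ = 1 ∧
  (∀ w : Eucl d, inner ℝ v w < 0 → ∀ᶠ t : ℝ in 𝓝[>] 0, x + t • w ∈ Ω) ∧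
  (∀ w : Eucl d, 0 < inner ℝ v w → ∀ᶠ t : ℝ in 𝓝[>] 0, x + t • w ∉ Ω)

open Classical in
/-- The outward unit normal field (with the value `0` where there is no normal). -/
def outwardNormal {d : ℕ} (Ω : Set (Eucl d)) (x : Eucl d) : Eucl d :=
  if h : ∃ v, IsOutwardUnitNormal Ω x v then h.choose else 0

/-- The surface measure of `∂Ω`: the `(d-1)`-dimensional Hausdorff measure restricted to the
topological boundary (Mathlib's Hausdorff measure differs from the surface area by a positive
constant factor that depends on `d` only). -/
def surfaceMeasure {d : ℕ} (Ω : Set (Eucl d)) : Measure (Eucl d) :=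
  (Measure.hausdorffMeasure ((d : ℝ) - 1)).restrict (frontier Ω)

/-! ### Weak gradients and Sobolev functions -/

/-- `G` is a weak (distributional) gradient of `u` on `Ω`; test functions are smooth with compact
support in the interior of `Ω`. -/
def IsWeakGrad {d : ℕ} (Ω : Set (Eucl d)) (u : Eucl d → ℝ) (G : Eucl d → Eucl d) : Prop :=
  LocallyIntegrableOn u (interior Ω) ∧ LocallyIntegrableOn G (interior Ω) ∧
  ∀ φ : Eucl d → ℝ, ContDiff ℝ ∞ φ → HasCompactSupport φ → tsupport φ ⊆ interior Ω →
    ∀ v : Eucl d, ∫ x in Ω, u x * fderiv ℝ φ x v = - ∫ x in Ω, φ x * inner ℝ (G x) v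

/-- `u` is weakly differentiable on `Ω`: it is locally integrable and its distributional gradient
is a locally integrable function. -/
def WeaklyDifferentiable {d : ℕ} (Ω : Set (Eucl d)) (u : Eucl d → ℝ) : Prop :=
  ∃ G, IsWeakGrad Ω u G

open Classical in
/-- The weak gradient of a weakly differentiable function (unique up to null sets). -/
def weakGrad {d : ℕ} (Ω : Set (Eucl d)) (u : Eucl d → ℝ) : Eucl d → Eucl d :=
  if h : WeaklyDifferentiable Ω u then h.choose else 0

/-- The Sobolev space `H¹(Ω) = W^{1,2}(Ω)`. -/
def MemH1 {d : ℕ} (Ω : Set (Eucl d)) (u : Eucl d → ℝ) : Prop :=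
  MemLp u 2 (volume.restrict Ω) ∧ WeaklyDifferentiable Ω u ∧
    MemLp (weakGrad Ω u) 2 (volume.restrict Ω)

/-- `t` is the boundary trace of `u ∈ H¹(Ω)`: functions that are smooth up to the boundary
converge to `u` in `H¹(Ω)` while their boundary values converge to `t` in `L²(∂Ω)`. -/
def IsTrace {d : ℕ} (Ω : Set (Eucl d)) (u t : Eucl d → ℝ) : Prop :=
  MemLp t 2 (surfaceMeasure Ω) ∧
  ∃ w : ℕ → Eucl d → ℝ, (∀ n, ContDiff ℝ ∞ (w n)) ∧
    Tendsto (fun n => eLpNorm (fun x => w n x - u x) 2 (volume.restrict Ω)) atTop (𝓝 0) ∧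
    Tendsto (fun n => eLpNorm (fun x => gradient (w n) x - weakGrad Ω u x) 2
      (volume.restrict Ω)) atTop (𝓝 0) ∧
    Tendsto (fun n => eLpNorm (fun x => w n x - t x) 2 (surfaceMeasure Ω)) atTop (𝓝 0)

/-! ### The class `P₂(Ω)` and the Stein class -/

/-- The density of `μ` with respect to Lebesgue measure. -/
def density {d : ℕ} (μ : Measure (Eucl d)) (x : Eucl d) : ℝ := (μ.rnDeriv volume x).toReal

/-- `μ ∈ P₂(Ω)`: a probability measure on `Ω` with a Lebesgue density that belongs to `H¹(Ω)` and
does not vanish on `Ω` (almost everywhere, a density being defined only up to null sets). -/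
structure MemP2 {d : ℕ} (Ω : Set (Eucl d)) (μ : Measure (Eucl d)) : Prop where
  isProbabilityMeasure : IsProbabilityMeasure μ
  measure_compl : μ Ωᶜ = 0
  absolutelyContinuous : μ ≪ volume
  memH1_density : MemH1 Ω (density μ)
  density_ne_zero : ∀ᵐ x ∂(volume.restrict Ω), density μ x ≠ 0

/-- The Stein class `S(μ)`: vector fields `φ ∈ H¹(Ω)^d` with `∮_{∂Ω} μ(x) φ(x) · n(x) dS(x) = 0`,
the boundary values being taken in the sense of traces. -/
def MemSteinClass {d : ℕ} (Ω : Set (Eucl d)) (μ : Measure (Eucl d)) (φ : Eucl d → Eucl d) : Prop :=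
  (∀ i, MemH1 Ω (fun x => φ x i)) ∧
  ∃ (tμ : Eucl d → ℝ) (tφ : Eucl d → Eucl d),
    IsTrace Ω (density μ) tμ ∧ (∀ i, IsTrace Ω (fun x => φ x i) (fun x => tφ x i)) ∧
    ∫ x, tμ x * inner ℝ (tφ x) (outwardNormal Ω x) ∂(surfaceMeasure Ω) = 0

/-! ### The Stein operator -/

/-- The weak gradient `∇ log π`. -/
def score {d : ℕ} (Ω : Set (Eucl d)) (π : Measure (Eucl d)) : Eucl d → Eucl d :=
  weakGrad Ω (fun x => Real.log (density π x))

/-- The score `∇ log π` exists as a function, in the distributional sense, and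
`μ(·) ∇ log π ∈ L²(Ω)`. -/
def HasSquareIntegrableScore {d : ℕ} (Ω : Set (Eucl d)) (μ π : Measure (Eucl d)) : Prop :=
  WeaklyDifferentiable Ω (fun x => Real.log (density π x)) ∧
  MemLp (fun x => density μ x • score Ω π x) 2 (volume.restrict Ω)

/-- The Stein operator `A_π φ = ∇ log π · φ + ∇ · φ`, with weak derivatives. -/
def steinOp {d : ℕ} (Ω : Set (Eucl d)) (π : Measure (Eucl d)) (φ : Eucl d → Eucl d)
    (x : Eucl d) : ℝ :=
  inner ℝ (score Ω π x) (φ x) + ∑ i, weakGrad Ω (fun y => φ y i) x i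

/-! ### Kernels, the product RKHS and the discrepancy -/

/-- `k` is integrally positive definite on `Ω`: `∬ g(x) k(x,y) g(y) dx dy > 0` for every nonzero
`g ∈ L²(Ω)`. -/
def IntegrallyPosDef {d : ℕ} (Ω : Set (Eucl d)) (k : Eucl d → Eucl d → ℝ) : Prop :=
  ∀ g : Eucl d → ℝ, MemLp g 2 (volume.restrict Ω) → ¬ (g =ᵐ[volume.restrict Ω] 0) →
    0 < ∫ x in Ω, ∫ y in Ω, g x * k x y * g y

/-- `m` is the weak mixed derivative `∂_{x_i} ∂_{y_j} k(x, y)` on `Ω × Ω`. -/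
def IsWeakMixedDeriv {d : ℕ} (Ω : Set (Eucl d)) (k : Eucl d → Eucl d → ℝ) (i j : Fin d)
    (m : Eucl d × Eucl d → ℝ) : Prop :=
  ∀ ψ : Eucl d × Eucl d → ℝ, ContDiff ℝ ∞ ψ → HasCompactSupport ψ →
    tsupport ψ ⊆ interior Ω ×ˢ interior Ω →
    ∫ p, k p.1 p.2 *
        fderiv ℝ (fun q => fderiv ℝ ψ q (0, EuclideanSpace.single j (1 : ℝ))) p
          (EuclideanSpace.single i (1 : ℝ), 0)
        ∂((volume.restrict Ω).prod (volume.restrict Ω)) =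
      ∫ p, m p * ψ p ∂((volume.restrict Ω).prod (volume.restrict Ω))

/-- The kernels that generate the product RKHS for the pair `(μ, π)`. The scalar function
`k(·, x)` is in a Stein class when all the vector fields `k(·, x) e_i` are. -/
structure IsSteinKernel {d : ℕ} (Ω : Set (Eucl d)) (μ π : Measure (Eucl d))
    (k : Eucl d → Eucl d → ℝ) : Prop where
  continuousOn : ContinuousOn (Function.uncurry k) (Ω ×ˢ Ω)
  symm : ∀ x ∈ Ω, ∀ y ∈ Ω, k x y = k y x
  integrallyPosDef : IntegrallyPosDef Ω k
  memSteinClass_left : ∀ x ∈ Ω, ∀ i,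
    MemSteinClass Ω μ (fun y => k y x • EuclideanSpace.single i (1 : ℝ))
  memSteinClass_right : ∀ x ∈ Ω, ∀ i,
    MemSteinClass Ω π (fun y => k y x • EuclideanSpace.single i (1 : ℝ))
  mixedDeriv : ∀ i j, ∃ m : Eucl d × Eucl d → ℝ,
    MemLp m 2 ((volume.restrict Ω).prod (volume.restrict Ω)) ∧ IsWeakMixedDeriv Ω k i j m

/-- The product space `H = H₀ × ⋯ × H₀` (`d` factors), with `⟪f, g⟫ = ∑ i, ⟪f i, g i⟫`. -/
abbrev ProductRKHS (d : ℕ) (H₀ : Type*) : Type _ := PiLp 2 (fun _ : Fin d => H₀)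

section RKHSfields

variable {d : ℕ} {Ω : Set (Eucl d)} {H₀ : Type*} [NormedAddCommGroup H₀] [InnerProductSpace ℝ H₀]
  [RKHS ℝ H₀ Ω ℝ]

/-- The vector field on `Ω` given by an element of the product RKHS (extended by `0` to `ℝ^d`). -/
def toField (f : ProductRKHS d H₀) : Eucl d → Eucl d :=
  fun x => WithLp.toLp 2 (fun i => Function.extend Subtype.val (f i : Ω → ℝ) 0 x)

variable (Ω H₀) in
/-- The values `E_{x ∼ μ}[A_π f(x)]` for `f` in the closed unit ball of the product RKHS. -/
def steinValues (μ π : Measure (Eucl d)) : Set ℝ :=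
  {r | ∃ f : ProductRKHS d H₀, ‖f‖ ≤ 1 ∧ r = ∫ x, steinOp Ω π (toField f) x ∂μ}

variable (Ω H₀) in
/-- The kernelized Stein discrepancy `𝔎(μ | π)`. -/
def ksd (μ π : Measure (Eucl d)) : ℝ := sSup (steinValues Ω H₀ μ π)

end RKHSfields

end

end SteinKSD

/-! On $\mathcal H$ the map $f\mapsto\mathbb E_\mu[\mathcal A_\pi f]$ is a bounded linear
functional. The zeroth-order term is controlled by $|f(x)|\le B\|f\|$ together with
$\mu\nabla\log\pi\in L^2(\Omega)\subset L^1(\Omega)$, the divergence term by $\|\partial_i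
f_i\|_{L^2}\le C_i\|f_i\|$. Riesz gives $a\in\mathcal H$ with $\mathbb E_\mu[\mathcal A_\pi
f]=\langle a,f\rangle$, so the discrepancy is $\|a\|$, attained at $a/\|a\|$
(`isGreatest_steinValues`). It vanishes iff $a_i(x)=\langle a_i,k(\cdot,x)\rangle=0$ for all $i$ and
$x$.

Since $k(\cdot,x)$ is in the Stein class of $\mu$, integration by parts gives
$a_i(x)=\int(\mu\,\partial_i\log\pi-\partial_i\mu)(y)\,k(y,x)\,dy$ (`integral_steinIntegrand_eq`).
If $\mu=\pi$ the first factor is zero. If all these integrals vanish, integral positive definiteness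
forces $\nabla\mu=\mu\nabla\log\pi$; then $\log(\mu/\pi)$ has zero weak gradient on the connected
interior of $\Omega$, so $\mu=c\,\pi$, and $c=1$ by total mass.

Three analytic facts carry this. (1) Functions in $\mathcal H_0$ have $L^2$ derivatives: for a test
function $\varphi$ put $S=\int\partial_i\varphi(x)\,k(\cdot,x)\,dx\in\mathcal H_0$; then
$\|S\|^2=\iint k\,\partial_i\varphi\,\partial_i\varphi=\iint
m\,\varphi\,\varphi\le\|m\|\,\|\varphi\|^2$ for the mixed derivative $m$, and $\int
f\,\partial_i\varphi=\langle f,S\rangle$ is therefore bounded in $\|\varphi\|_{L^2}$. (2) The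
divergence theorem: near a boundary point $\Omega$ lies below a Lipschitz graph over its tangent
plane, with area distortion as close to 1 as desired. This yields the theorem locally with relative
error $\eta$; a partition of unity adds the errors of nonnegative pieces to $\eta\int w\,dS$, and
$\eta\to0$. Boundary traces then follow by $L^2$ limits. (3) A weak chain rule for $C^1$ functions
with bounded derivative. The logarithm is not one, so it is reached through `arctan` and through
$\tfrac12\log(s^2+\delta^2)$. -/

namespace SteinKSD

noncomputable section

/-! ### Cut-off functions and mollification -/

section Mollification

open ContinuousLinearMap
open scoped Convolution Manifold

variable {d : ℕ}

/-- A compact subset of an open set has a smooth cut-off function supported in the open set. -/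
theorem exists_smooth_cutoff {K U : Set (Eucl d)} (hK : IsCompact K) (hU : IsOpen U) (h : K ⊆ U) :
    ∃ χ : Eucl d → ℝ, ContDiff ℝ ∞ χ ∧ HasCompactSupport χ ∧ tsupport χ ⊆ U ∧
      (∀ᶠ x in 𝓝ˢ K, χ x = 1) ∧ ∀ x, χ x ∈ Set.Icc (0 : ℝ) 1 := by
  obtain ⟨K', hK', hKK', hK'U⟩ := exists_compact_between hK hU h
  obtain ⟨f, hf1, hf0, hf⟩ := exists_contMDiffMap_one_nhds_of_subset_interior (n := ⊤)
    𝓘(ℝ, Eucl d) hK.isClosed hKK'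
  have hs : tsupport f ⊆ K' :=
    closure_minimal (fun x hx => by by_contra hx'; exact hx (hf0 x hx')) hK'.isClosed
  exact ⟨f, f.contMDiff.contDiff, hK'.of_isClosed_subset (isClosed_tsupport _) hs,
    hs.trans hK'U, hf1, hf⟩

/-- Convolution with a normalized bump function. -/
def mollify (ρ : ContDiffBump (0 : Eucl d)) (v : Eucl d → ℝ) : Eucl d → ℝ :=
  ρ.normed volume ⋆[lsmul ℝ ℝ, volume] v

/-- The bump functions used for mollification. -/
def stdBump (n : ℕ) : ContDiffBump (0 : Eucl d) where
  rIn := 1 / ((n : ℝ) + 1)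
  rOut := 2 / ((n : ℝ) + 1)
  rIn_pos := by positivity
  rIn_lt_rOut := by gcongr; norm_num

theorem tendsto_stdBump_rOut :
    Tendsto (fun n => (stdBump n : ContDiffBump (0 : Eucl d)).rOut) atTop (𝓝 0) := by
  have := (tendsto_one_div_add_atTop_nhds_zero_nat (𝕜 := ℝ)).const_mul 2
  simpa [stdBump, div_eq_mul_inv] using this

/-- Puts the smooth, compactly supported factor on the right, where the differentiation results for
convolutions expect it. -/
theorem mollify_eq_convolution (ρ : ContDiffBump (0 : Eucl d)) (v : Eucl d → ℝ) :
    mollify ρ v = v ⋆[mul ℝ ℝ, volume] ρ.normed volume := by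
  ext x
  rw [mollify, convolution_lsmul_swap, convolution_mul]
  simp [mul_comm]

theorem mollify_apply (ρ : ContDiffBump (0 : Eucl d)) (v : Eucl d → ℝ) (x : Eucl d) :
    mollify ρ v x = ∫ t, v t * ρ.normed volume (x - t) := by
  rw [mollify_eq_convolution, convolution_mul]

theorem contDiff_mollify (ρ : ContDiffBump (0 : Eucl d)) {v : Eucl d → ℝ}
    (hv : LocallyIntegrable v volume) : ContDiff ℝ ∞ (mollify ρ v) := by
  rw [mollify_eq_convolution]
  exact ρ.hasCompactSupport_normed.contDiff_convolution_right _ hv ρ.contDiff_normed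

theorem fderiv_mollify_apply (ρ : ContDiffBump (0 : Eucl d)) {v : Eucl d → ℝ}
    (hv : LocallyIntegrable v volume) (x a : Eucl d) :
    fderiv ℝ (mollify ρ v) x a = ∫ t, v t * fderiv ℝ (ρ.normed volume) (x - t) a := by
  rw [mollify_eq_convolution, (ρ.hasCompactSupport_normed.hasFDerivAt_convolution_right _ hv
    ρ.contDiff_normed x).fderiv, convolution_precompR_apply _ hv
    (ρ.hasCompactSupport_normed.fderiv ℝ)
    ((ρ.contDiff_normed (n := 1)).continuous_fderiv one_ne_zero), convolution_mul]

theorem ae_tendsto_mollify {v : Eucl d → ℝ} (hv : LocallyIntegrable v volume) :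
    ∀ᵐ x, Tendsto (fun n => mollify (stdBump n) v x) atTop (𝓝 (v x)) :=
  ContDiffBump.ae_convolution_tendsto_right_of_locallyIntegrable (K := 2) tendsto_stdBump_rOut
    (.of_forall fun n => by simp [stdBump, div_eq_mul_inv]) hv

theorem integrable_mollify (ρ : ContDiffBump (0 : Eucl d)) {v : Eucl d → ℝ}
    (hv : Integrable v volume) : Integrable (mollify ρ v) volume :=
  ρ.integrable_normed.integrable_convolution _ hv

theorem integral_mollify (ρ : ContDiffBump (0 : Eucl d)) {v : Eucl d → ℝ}
    (hv : Integrable v volume) : ∫ x, mollify ρ v x = ∫ x, v x := by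
  rw [mollify, integral_convolution _ ρ.integrable_normed hv]
  simp [ρ.integral_normed]

theorem abs_mollify_le (ρ : ContDiffBump (0 : Eucl d)) (v : Eucl d → ℝ) (x : Eucl d) :
    |mollify ρ v x| ≤ mollify ρ (fun y => |v y|) x := by
  rw [mollify_apply, mollify_apply]
  refine (abs_integral_le_integral_abs).trans_eq (integral_congr_ae (.of_forall fun t => ?_))
  simp [abs_mul, abs_of_nonneg (ρ.nonneg_normed _)]

/-- Mollifications of an integrable function converge to it in `L¹`. -/
theorem tendsto_integral_abs_mollify_sub {v : Eucl d → ℝ} (hv : Integrable v volume) :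
    Tendsto (fun n => ∫ x, |mollify (stdBump n) v x - v x|) atTop (𝓝 0) := by
  have hi := fun n => integrable_mollify (stdBump n) hv
  have hia := fun n => integrable_mollify (stdBump n) hv.abs
  have hd : ∀ n, Integrable (fun x => |mollify (stdBump n) v x - v x|) volume :=
    fun n => ((hi n).sub hv).abs
  have hs : ∀ n, Integrable (fun x => mollify (stdBump n) (fun y => |v y|) x + |v x|) volume :=
    fun n => (hia n).add hv.abs
  -- Fatou's lemma will be applied to $|v|_n+|v|-|v_n-v|\ge0$, where the subscript denotes
  -- mollification. Its a.e. limit is $2|v|$, and its integral is $2A-\int|v_n-v|$ because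
  -- mollification preserves integrals.
  have hsd : ∀ n, Integrable (fun x => mollify (stdBump n) (fun y => |v y|) x + |v x|
      - |mollify (stdBump n) v x - v x|) volume := fun n => (hs n).sub (hd n)
  set A : ℝ := ∫ x, |v x| with hA
  have hInt : ∀ n, ∫ x, (mollify (stdBump n) (fun y => |v y|) x + |v x|
      - |mollify (stdBump n) v x - v x|) = 2 * A - ∫ x, |mollify (stdBump n) v x - v x| := by
    intro n
    rw [integral_sub (hs n) (hd n), integral_add (hia n) hv.abs,
      integral_mollify _ hv.abs]
    ring
  have hnn : ∀ n x, 0 ≤ mollify (stdBump n) (fun y => |v y|) x + |v x|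
      - |mollify (stdBump n) v x - v x| := fun n x => by
    have := abs_mollify_le (stdBump n) v x
    have := abs_sub (mollify (stdBump n) v x) (v x)
    linarith
  have hlim : ∀ᵐ x, Tendsto (fun n => ENNReal.ofReal (mollify (stdBump n) (fun y => |v y|) x
      + |v x| - |mollify (stdBump n) v x - v x|)) atTop (𝓝 (ENNReal.ofReal (2 * |v x|))) := by
    filter_upwards [ae_tendsto_mollify hv.locallyIntegrable,
      ae_tendsto_mollify hv.abs.locallyIntegrable] with x h1 h2
    refine (ENNReal.continuous_ofReal.tendsto _).comp ?_
    have := (h2.add_const |v x|).sub ((h1.sub_const (v x)).abs)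
    convert this using 2
    simp; ring
  have hfatou : ENNReal.ofReal (2 * A) ≤
      liminf (fun n => ENNReal.ofReal (2 * A - ∫ x, |mollify (stdBump n) v x - v x|)) atTop := by
    have h1 : ENNReal.ofReal (2 * A) = ∫⁻ x, ENNReal.ofReal (2 * |v x|) := by
      rw [hA, ← integral_const_mul, ofReal_integral_eq_lintegral_ofReal (hv.abs.const_mul 2)
        (.of_forall fun x => by positivity)]
    have h2 : ∀ n, ENNReal.ofReal (2 * A - ∫ x, |mollify (stdBump n) v x - v x|) =
        ∫⁻ x, ENNReal.ofReal (mollify (stdBump n) (fun y => |v y|) x + |v x|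
      - |mollify (stdBump n) v x - v x|) := fun n => by
      rw [← hInt, ofReal_integral_eq_lintegral_ofReal (hsd n) (.of_forall (hnn n))]
    simp_rw [h2]
    rw [h1]
    calc _ = ∫⁻ x, liminf (fun n => ENNReal.ofReal (mollify (stdBump n) (fun y => |v y|) x
      + |v x| - |mollify (stdBump n) v x - v x|)) atTop := by
          refine lintegral_congr_ae ?_
          filter_upwards [hlim] with x hx using hx.liminf_eq.symm
      _ ≤ _ := lintegral_liminf_le' fun n =>
          (hsd n).aestronglyMeasurable.aemeasurable.ennreal_ofReal
  have hnn' : ∀ n, 0 ≤ ∫ x, |mollify (stdBump n) v x - v x| := fun n =>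
    integral_nonneg fun x => abs_nonneg _
  have hA0 : 0 ≤ A := integral_nonneg fun x => abs_nonneg _
  rw [tendsto_order]
  refine ⟨fun a ha => .of_forall fun n => ha.trans_le (hnn' n), fun a ha => ?_⟩
  -- The strict comparison in `ENNReal` below needs $2A>0$; for $A=0$ nonnegativity of the integral
  -- already gives $\int|v_n-v|\le0$.
  by_cases hA0' : A = 0
  · refine .of_forall fun n => ?_
    have : 0 ≤ 2 * A - ∫ x, |mollify (stdBump n) v x - v x| := by
      rw [← hInt]; exact integral_nonneg (hnn n)
    rw [hA0'] at this
    linarith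
  have hA1 : 0 < A := lt_of_le_of_ne hA0 (Ne.symm hA0')
  have hlt : ENNReal.ofReal (2 * A - a) < liminf (fun n =>
      ENNReal.ofReal (2 * A - ∫ x, |mollify (stdBump n) v x - v x|)) atTop :=
    lt_of_lt_of_le ((ENNReal.ofReal_lt_ofReal_iff (by linarith)).2 (by linarith)) hfatou
  filter_upwards [eventually_lt_of_lt_liminf hlt] with n hn
  by_contra! h
  exact hn.not_ge (ENNReal.ofReal_le_ofReal (by linarith))

end Mollification

/-! ### Weak directional derivatives on an open set -/

section WeakDeriv

variable {d : ℕ} {U : Set (Eucl d)} {u v g h : Eucl d → ℝ} {a : Eucl d}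

/-- `g` is the weak derivative of `u` in the direction `a` on the open set `U`. -/
structure HasWeakDeriv (U : Set (Eucl d)) (u : Eucl d → ℝ) (a : Eucl d) (g : Eucl d → ℝ) :
    Prop where
  locallyIntegrableOn : LocallyIntegrableOn u U
  locallyIntegrableOn_deriv : LocallyIntegrableOn g U
  integral_eq : ∀ φ : Eucl d → ℝ, ContDiff ℝ ∞ φ → HasCompactSupport φ → tsupport φ ⊆ U →
    ∫ x, u x * fderiv ℝ φ x a = - ∫ x, φ x * g x

theorem integrable_mul_of_locallyIntegrableOn {ψ : Eucl d → ℝ} (hu : LocallyIntegrableOn u U)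
    (hψ : Continuous ψ) (hc : HasCompactSupport ψ) (hs : tsupport ψ ⊆ U) :
    Integrable (fun x => u x * ψ x) volume := by
  have h1 : IntegrableOn u (tsupport ψ) := hu.integrableOn_compact_subset hs hc.isCompact
  refine (integrableOn_iff_integrable_of_support_subset (s := tsupport ψ) ?_).1
    (h1.mul_continuousOn hψ.continuousOn hc.isCompact)
  intro x hx
  refine subset_tsupport _ fun h0 => hx ?_
  simp [h0]

theorem continuous_fderiv_apply_of_contDiff {φ : Eucl d → ℝ} (hφ : ContDiff ℝ ∞ φ) (a : Eucl d) :
    Continuous fun x => fderiv ℝ φ x a :=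
  (hφ.continuous_fderiv (by simp)).clm_apply continuous_const

theorem HasWeakDeriv.integrable_mul_fderiv (hu : LocallyIntegrableOn u U) {φ : Eucl d → ℝ}
    (hφ : ContDiff ℝ ∞ φ) (hc : HasCompactSupport φ) (hs : tsupport φ ⊆ U) :
    Integrable (fun x => u x * fderiv ℝ φ x a) volume :=
  integrable_mul_of_locallyIntegrableOn hu (continuous_fderiv_apply_of_contDiff hφ a)
    (hc.fderiv_apply ℝ a) ((tsupport_fderiv_apply_subset ℝ a).trans hs)

/-- The fundamental lemma of the calculus of variations applied to $g-h$. -/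
theorem HasWeakDeriv.unique (hU : IsOpen U) (h₁ : HasWeakDeriv U u a g)
    (h₂ : HasWeakDeriv U u a h) : g =ᵐ[volume.restrict U] h := by
  have := hU.ae_eq_zero_of_integral_contDiff_smul_eq_zero (μ := volume) (f := fun x => g x - h x)
    (h₁.locallyIntegrableOn_deriv.sub h₂.locallyIntegrableOn_deriv) (fun φ hφ hc hs => by
      simp only [smul_eq_mul, mul_sub]
      rw [integral_sub, sub_eq_zero]
      · rw [← neg_inj, ← h₁.integral_eq φ hφ hc hs, ← h₂.integral_eq φ hφ hc hs]
      · simpa only [mul_comm] using integrable_mul_of_locallyIntegrableOn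
          h₁.locallyIntegrableOn_deriv hφ.continuous hc hs
      · simpa only [mul_comm] using integrable_mul_of_locallyIntegrableOn
          h₂.locallyIntegrableOn_deriv hφ.continuous hc hs)
  rw [EventuallyEq, ae_restrict_iff' hU.measurableSet]
  filter_upwards [this] with x hx hxU using sub_eq_zero.1 (hx hxU)

theorem locallyIntegrableOn_congr_ae {E : Type*} [NormedAddCommGroup E] {f₁ f₂ : Eucl d → E}
    (hU : IsOpen U) (hf : LocallyIntegrableOn f₁ U) (h : f₁ =ᵐ[volume.restrict U] f₂) :
    LocallyIntegrableOn f₂ U := by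
  rw [locallyIntegrableOn_iff hU.isLocallyClosed] at hf ⊢
  exact fun k hkU hk => (hf k hkU hk).congr_fun_ae (ae_restrict_of_ae_restrict_of_subset hkU h)

theorem HasWeakDeriv.congr_ae (hU : IsOpen U) (h₁ : HasWeakDeriv U u a g)
    (huv : u =ᵐ[volume.restrict U] v) (hgh : g =ᵐ[volume.restrict U] h) :
    HasWeakDeriv U v a h := by
  refine ⟨locallyIntegrableOn_congr_ae hU h₁.1 huv, locallyIntegrableOn_congr_ae hU h₁.2 hgh,
    fun φ hφ hc hs => ?_⟩
  rw [EventuallyEq, ae_restrict_iff' hU.measurableSet] at huv hgh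
  have e₁ : ∫ x, φ x * g x = ∫ x, φ x * h x := integral_congr_ae <| by
    filter_upwards [hgh] with x hx
    by_cases hxU : x ∈ U
    · simp [hx hxU]
    · simp [image_eq_zero_of_notMem_tsupport fun h' => hxU (hs h')]
  rw [← e₁, ← h₁.integral_eq φ hφ hc hs]
  refine integral_congr_ae ?_
  · filter_upwards [huv] with x hx
    by_cases hxU : x ∈ U
    · simp [hx hxU]
    · have : fderiv ℝ φ x a = 0 := image_eq_zero_of_notMem_tsupport
        (f := fun x => fderiv ℝ φ x a) fun h' => hxU (hs (tsupport_fderiv_apply_subset ℝ a h'))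
      simp [this]

theorem HasWeakDeriv.add (h₁ : HasWeakDeriv U u a g) (h₂ : HasWeakDeriv U v a h) :
    HasWeakDeriv U (fun x => u x + v x) a (fun x => g x + h x) := by
  refine ⟨h₁.1.add h₂.1, h₁.2.add h₂.2, fun φ hφ hc hs => ?_⟩
  simp only [add_mul, mul_add]
  rw [integral_add (integrable_mul_fderiv h₁.1 hφ hc hs) (integrable_mul_fderiv h₂.1 hφ hc hs),
    integral_add, h₁.integral_eq φ hφ hc hs, h₂.integral_eq φ hφ hc hs]
  · ring
  · simpa only [mul_comm] using integrable_mul_of_locallyIntegrableOn h₁.2 hφ.continuous hc hs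
  · simpa only [mul_comm] using integrable_mul_of_locallyIntegrableOn h₂.2 hφ.continuous hc hs

theorem HasWeakDeriv.const_mul (c : ℝ) (h₁ : HasWeakDeriv U u a g) :
    HasWeakDeriv U (fun x => c * u x) a (fun x => c * g x) := by
  refine ⟨h₁.1.smul c, h₁.2.smul c, fun φ hφ hc hs => ?_⟩
  simp only [mul_assoc, mul_left_comm _ c, integral_const_mul, h₁.integral_eq φ hφ hc hs, mul_neg]

theorem HasWeakDeriv.sub (h₁ : HasWeakDeriv U u a g) (h₂ : HasWeakDeriv U v a h) :
    HasWeakDeriv U (fun x => u x - v x) a (fun x => g x - h x) := by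
  simpa [sub_eq_add_neg] using h₁.add (h₂.const_mul (-1))

end WeakDeriv

/-! ### Cut-offs, chain rule, limits and constancy for weak derivatives -/

section ChainRule

variable {d : ℕ} {U V : Set (Eucl d)} {u v g h : Eucl d → ℝ} {a : Eucl d}

theorem HasWeakDeriv.mono (hu : HasWeakDeriv U u a g) (hVU : V ⊆ U) : HasWeakDeriv V u a g :=
  ⟨hu.1.mono_set hVU, hu.2.mono_set hVU, fun φ hφ hc hs => hu.3 φ hφ hc (hs.trans hVU)⟩

theorem fderiv_mul_apply' {χ ψ : Eucl d → ℝ} (hχ : ContDiff ℝ ∞ χ) (hψ : ContDiff ℝ ∞ ψ)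
    (x a : Eucl d) : fderiv ℝ (fun y => χ y * ψ y) x a =
      χ x * fderiv ℝ ψ x a + ψ x * fderiv ℝ χ x a := by
  rw [fderiv_fun_mul (hχ.differentiable (by simp)).differentiableAt
    (hψ.differentiable (by simp)).differentiableAt]
  simp

/-- A weak derivative on `U`, multiplied by a cut-off function, extends to the whole space. -/
theorem HasWeakDeriv.cutoff {χ : Eucl d → ℝ} (hu : HasWeakDeriv U u a g) (hχ : ContDiff ℝ ∞ χ)
    (hc : HasCompactSupport χ) (hs : tsupport χ ⊆ U) :
    Integrable (fun x => u x * χ x) volume ∧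
    Integrable (fun x => g x * χ x + u x * fderiv ℝ χ x a) volume ∧
    HasWeakDeriv Set.univ (fun x => u x * χ x) a (fun x => g x * χ x + u x * fderiv ℝ χ x a) := by
  have h1 := integrable_mul_of_locallyIntegrableOn hu.1 hχ.continuous hc hs
  have h2 := integrable_mul_of_locallyIntegrableOn hu.2 hχ.continuous hc hs
  have h3 := integrable_mul_fderiv (a := a) hu.1 hχ hc hs
  refine ⟨h1, h2.add h3, h1.locallyIntegrable.locallyIntegrableOn _,
    (h2.add h3).locallyIntegrable.locallyIntegrableOn _, fun φ hφ hφc _ => ?_⟩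
  have hs' : tsupport (fun x => χ x * φ x) ⊆ U := (tsupport_mul_subset_left).trans hs
  have hc' : HasCompactSupport (fun x => χ x * φ x) := hc.mul_right
  -- The product $\chi\varphi$ is an admissible test function on $U$ for arbitrary $\varphi$; the
  -- product rule produces the extra term $u\,\partial_a\chi$.
  have key := hu.3 (fun x => χ x * φ x) (hχ.mul hφ) hc' hs'
  have i1 : Integrable (fun x => u x * χ x * fderiv ℝ φ x a) volume :=
    integrable_mul_fderiv (U := Set.univ) (h1.locallyIntegrable.locallyIntegrableOn _) hφ hφc
      (Set.subset_univ _)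
  have i2 : Integrable (fun x => u x * fderiv ℝ χ x a * φ x) volume :=
    integrable_mul_of_locallyIntegrableOn (U := Set.univ)
      (h3.locallyIntegrable.locallyIntegrableOn _) hφ.continuous hφc (Set.subset_univ _)
  have i3 : Integrable (fun x => g x * χ x * φ x) volume :=
    integrable_mul_of_locallyIntegrableOn (U := Set.univ)
      (h2.locallyIntegrable.locallyIntegrableOn _) hφ.continuous hφc (Set.subset_univ _)
  have e1 : ∫ x, u x * fderiv ℝ (fun y => χ y * φ y) x a =
      (∫ x, u x * χ x * fderiv ℝ φ x a) + ∫ x, u x * fderiv ℝ χ x a * φ x := by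
    rw [← integral_add i1 i2]
    refine integral_congr_ae (.of_forall fun x => ?_)
    simp only [fderiv_mul_apply' hχ hφ]
    ring
  have e2 : ∫ x, φ x * (g x * χ x + u x * fderiv ℝ χ x a) =
      (∫ x, g x * χ x * φ x) + ∫ x, u x * fderiv ℝ χ x a * φ x := by
    rw [← integral_add i3 i2]
    exact integral_congr_ae (.of_forall fun x => by ring)
  have e3 : ∫ x, χ x * φ x * g x = ∫ x, g x * χ x * φ x :=
    integral_congr_ae (.of_forall fun x => by ring)
  rw [e1, e3] at key
  rw [e2]
  linarith

/-- The derivative of a mollification is the mollification of the weak derivative. -/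
theorem HasWeakDeriv.fderiv_mollify (hv : LocallyIntegrable v volume) (hw : HasWeakDeriv U v a g)
    (ρ : ContDiffBump (0 : Eucl d)) {x : Eucl d} (hx : Metric.closedBall x ρ.rOut ⊆ U) :
    fderiv ℝ (mollify ρ v) x a = mollify ρ g x := by
  -- The test function is $t\mapsto\rho(x-t)$, supported in the given ball. The sign from the
  -- reflection in $t$ cancels the one in the definition of the weak derivative.
  have hφ : ContDiff ℝ ∞ fun t => ρ.normed volume (x - t) :=
    ρ.contDiff_normed.comp (contDiff_const.sub contDiff_id)
  have hs : tsupport (fun t => ρ.normed volume (x - t)) ⊆ Metric.closedBall x ρ.rOut := by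
    refine closure_minimal (fun t ht => ?_) Metric.isClosed_closedBall
    have : x - t ∈ Function.support (ρ.normed volume) := ht
    rw [ρ.support_normed_eq, mem_ball_zero_iff] at this
    rw [Metric.mem_closedBall, dist_comm, dist_eq_norm]
    exact this.le
  have hc : HasCompactSupport fun t => ρ.normed volume (x - t) :=
    (isCompact_closedBall x ρ.rOut).of_isClosed_subset (isClosed_tsupport _) hs
  have key := hw.3 _ hφ hc (hs.trans hx)
  have hd : ∀ t, fderiv ℝ (fun t => ρ.normed volume (x - t)) t a =
      - fderiv ℝ (ρ.normed volume) (x - t) a := fun t => by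
    have h1 : HasFDerivAt (fun t => x - t) (-ContinuousLinearMap.id ℝ (Eucl d)) t := by
      simpa using (hasFDerivAt_id t).const_sub x
    have h2 : DifferentiableAt ℝ (ρ.normed volume) (x - t) :=
      ((ρ.contDiff_normed (n := 1)).differentiable one_ne_zero).differentiableAt
    have h3 : HasFDerivAt (fun t => ρ.normed volume (x - t)) _ t := h2.hasFDerivAt.comp t h1
    rw [h3.fderiv]
    simp
  simp only [hd, mul_neg, integral_neg, neg_inj] at key
  rw [fderiv_mollify_apply ρ hv, key, mollify_apply]
  simp [mul_comm]

/-- Chain rule for weak derivatives and outer functions of class `C¹` with bounded derivative. -/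
theorem HasWeakDeriv.comp (hU : IsOpen U) (hu : HasWeakDeriv U u a g) {F F' : ℝ → ℝ} {C : ℝ}
    (hF : ∀ s, HasDerivAt F (F' s) s) (hF' : Continuous F') (hC : ∀ s, |F' s| ≤ C) :
    HasWeakDeriv U (fun x => F (u x)) a (fun x => F' (u x) * g x) := by
  have hFc : Continuous F := continuous_iff_continuousAt.2 fun s => (hF s).continuousAt
  have hLip : ∀ s t, |F s - F t| ≤ C * |s - t| := fun s t => by
    have := Convex.norm_image_sub_le_of_norm_hasDerivWithin_le (f := F) (f' := F') (s := Set.univ)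
      (x := t) (y := s) (C := C)
      (fun r _ => (hF r).hasDerivWithinAt) (fun r _ => hC r) convex_univ trivial trivial
    simpa using this
  have hC0 : 0 ≤ C := (abs_nonneg _).trans (hC 0)
  refine ⟨?_, ?_, fun φ hφ hc hs => ?_⟩
  · have h1 := hu.1
    rw [locallyIntegrableOn_iff hU.isLocallyClosed] at h1 ⊢
    intro k hkU hk
    have hi := h1 k hkU hk
    have : IntegrableOn (fun x => |F 0| + C * |u x|) k :=
      (integrableOn_const (hk.measure_lt_top.ne)).add (hi.abs.const_mul C)
    refine this.mono' (hFc.comp_aestronglyMeasurable hi.aestronglyMeasurable)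
      (.of_forall fun x => ?_)
    have := hLip (u x) 0
    rw [sub_zero] at this
    have h' := abs_sub_abs_le_abs_sub (F (u x)) (F 0)
    rw [Real.norm_eq_abs]
    linarith
  · have h1 := hu.1
    have h2 := hu.2
    rw [locallyIntegrableOn_iff hU.isLocallyClosed] at h1 h2 ⊢
    intro k hkU hk
    have hi := h1 k hkU hk
    have hi' := h2 k hkU hk
    refine (hi'.abs.const_mul C).mono' ((hF'.comp_aestronglyMeasurable
      hi.aestronglyMeasurable).mul hi'.aestronglyMeasurable) (.of_forall fun x => ?_)
    rw [Real.norm_eq_abs, abs_mul]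
    gcongr
    exact hC _
  -- A cut-off equal to 1 near the support of $\varphi$ replaces $u$ by an integrable function $w$
  -- on the whole space without changing the identity, so mollification needs no distance to the
  -- boundary.
  obtain ⟨χ, hχ, hχc, hχs, hχ1, -⟩ := exists_smooth_cutoff hc.isCompact hU hs
  obtain ⟨iv, iH, hw⟩ := hu.cutoff hχ hχc hχs
  set w : Eucl d → ℝ := fun x => u x * χ x with hwdef
  set H : Eucl d → ℝ := fun x => g x * χ x + u x * fderiv ℝ χ x a with hHdef
  have hwu : ∀ x ∈ tsupport φ, w x = u x ∧ H x = g x := fun x hx => by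
    have h1 : χ =ᶠ[𝓝 x] fun _ => 1 := (eventually_nhdsSet_iff_forall.1 hχ1) x hx
    have h2 : fderiv ℝ χ x = 0 := by
      rw [h1.fderiv_eq]
      simp
    simp [hwdef, hHdef, h1.self_of_nhds, h2]
  set wn : ℕ → Eucl d → ℝ := fun n => mollify (stdBump n) w
  set Hn : ℕ → Eucl d → ℝ := fun n => mollify (stdBump n) H
  have hwn : ∀ n, ContDiff ℝ ∞ (wn n) := fun n => contDiff_mollify _ iv.locallyIntegrable
  have hHn : ∀ n x, fderiv ℝ (wn n) x a = Hn n x := fun n x =>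
    hw.fderiv_mollify iv.locallyIntegrable _ (Set.subset_univ _)
  have hHnc : ∀ n, Continuous (Hn n) := fun n =>
    (contDiff_mollify _ iH.locallyIntegrable).continuous
  have hφ'c := continuous_fderiv_apply_of_contDiff hφ a
  obtain ⟨M, hM⟩ := hφ.continuous.bounded_above_of_compact_support hc
  obtain ⟨M', hM'⟩ := hφ'c.bounded_above_of_compact_support (hc.fderiv_apply ℝ a)
  have hM0 : 0 ≤ M := (norm_nonneg _).trans (hM 0)
  have hM0' : 0 ≤ M' := (norm_nonneg _).trans (hM' 0)
  have hibp : ∀ n, ∫ x, F (wn n x) * fderiv ℝ φ x a = - ∫ x, φ x * (F' (wn n x) * Hn n x) := by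
    intro n
    have hdiff : ∀ x, HasFDerivAt (fun y => F (wn n y)) (F' (wn n x) • fderiv ℝ (wn n) x) x :=
      fun x => (hF _).comp_hasFDerivAt x
        ((hwn n).differentiable (by simp)).differentiableAt.hasFDerivAt
    have hd' : ∀ x, fderiv ℝ (fun y => F (wn n y)) x a = F' (wn n x) * Hn n x := fun x => by
      rw [(hdiff x).fderiv, ← hHn]
      rfl
    rw [integral_mul_fderiv_eq_neg_fderiv_mul_of_integrable]
    · simp only [hd', mul_comm (φ _)]
    · simp only [hd']
      exact (((hF'.comp (hwn n).continuous).mul (hHnc n)).mul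
        hφ.continuous).integrable_of_hasCompactSupport hc.mul_left
    · exact ((hFc.comp (hwn n).continuous).mul hφ'c).integrable_of_hasCompactSupport
        (hc.fderiv_apply ℝ a).mul_left
    · exact ((hFc.comp (hwn n).continuous).mul hφ.continuous).integrable_of_hasCompactSupport
        hc.mul_left
    · exact fun x _ => (hdiff x).differentiableAt
    · exact fun x _ => (hφ.differentiable (by simp)).differentiableAt
  have iFw : Integrable (fun x => F (w x) * fderiv ℝ φ x a) volume := by
    have i0 : Integrable (fun x => |F 0| * |fderiv ℝ φ x a| + C * M' * |w x|) volume :=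
      ((hφ'c.integrable_of_hasCompactSupport (hc.fderiv_apply ℝ a)).abs.const_mul _).add
        (iv.abs.const_mul _)
    refine i0.mono' ((hFc.comp_aestronglyMeasurable iv.aestronglyMeasurable).mul
      hφ'c.aestronglyMeasurable) (.of_forall fun x => ?_)
    have h1 := hLip (w x) 0
    rw [sub_zero] at h1
    have h2 := abs_sub_abs_le_abs_sub (F (w x)) (F 0)
    have h3 : |fderiv ℝ φ x a| ≤ M' := hM' x
    rw [Real.norm_eq_abs, abs_mul]
    calc |F (w x)| * |fderiv ℝ φ x a| ≤ (|F 0| + C * |w x|) * |fderiv ℝ φ x a| := by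
          gcongr; linarith
      _ = |F 0| * |fderiv ℝ φ x a| + C * |w x| * |fderiv ℝ φ x a| := by ring
      _ ≤ |F 0| * |fderiv ℝ φ x a| + C * |w x| * M' := by gcongr
      _ = _ := by ring
  -- The left side passes to the limit because $F$ is $C$-Lipschitz and $w_n\to w$ in $L^1$.
  have lim1 : Tendsto (fun n => ∫ x, F (wn n x) * fderiv ℝ φ x a) atTop
      (𝓝 (∫ x, F (w x) * fderiv ℝ φ x a)) := by
    rw [tendsto_iff_norm_sub_tendsto_zero]
    have hb := (tendsto_integral_abs_mollify_sub iv).const_mul (C * M')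
    rw [mul_zero] at hb
    refine squeeze_zero (fun _ => norm_nonneg _) (fun n => ?_) hb
    have i0 : Integrable (fun x => F (wn n x) * fderiv ℝ φ x a) volume :=
      ((hFc.comp (hwn n).continuous).mul hφ'c).integrable_of_hasCompactSupport
        (hc.fderiv_apply ℝ a).mul_left
    rw [← integral_sub i0 iFw, ← integral_const_mul]
    refine norm_integral_le_of_norm_le (((integrable_mollify _ iv).sub iv).abs.const_mul _)
      (.of_forall fun x => ?_)
    have h3 : |fderiv ℝ φ x a| ≤ M' := hM' x
    rw [← sub_mul, Real.norm_eq_abs, abs_mul]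
    calc _ ≤ (C * |wn n x - w x|) * M' := by gcongr; exact hLip _ _
      _ = _ := by ring
  have iFH : Integrable (fun x => φ x * (F' (w x) * H x)) volume := by
    refine (iH.abs.const_mul (M * C)).mono' (hφ.continuous.aestronglyMeasurable.mul
      ((hF'.comp_aestronglyMeasurable iv.aestronglyMeasurable).mul iH.aestronglyMeasurable))
      (.of_forall fun x => ?_)
    have h3 : |φ x| ≤ M := hM x
    rw [Real.norm_eq_abs, abs_mul, abs_mul, mul_assoc]
    gcongr
    exact hC _
  have iFH' : ∀ n, Integrable (fun x => φ x * (F' (wn n x) * H x)) volume := fun n => by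
    refine (iH.abs.const_mul (M * C)).mono' (hφ.continuous.aestronglyMeasurable.mul
      ((hF'.comp (hwn n).continuous).aestronglyMeasurable.mul iH.aestronglyMeasurable))
      (.of_forall fun x => ?_)
    have h3 : |φ x| ≤ M := hM x
    rw [Real.norm_eq_abs, abs_mul, abs_mul, mul_assoc]
    gcongr
    exact hC _
  -- The right side takes two moves: replace $H_n$ by $H$ using $L^1$ convergence and $|F'|\le C$,
  -- then let $F'(w_n)\to F'(w)$ a.e. by dominated convergence in `lim3`.
  have lim2 : Tendsto (fun n => (∫ x, φ x * (F' (wn n x) * Hn n x)) -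
      ∫ x, φ x * (F' (wn n x) * H x))
      atTop (𝓝 0) := by
    have hb := (tendsto_integral_abs_mollify_sub iH).const_mul (M * C)
    rw [mul_zero] at hb
    refine squeeze_zero_norm (fun n => ?_) hb
    have i0 : Integrable (fun x => φ x * (F' (wn n x) * Hn n x)) volume :=
      (hφ.continuous.mul ((hF'.comp (hwn n).continuous).mul
        (hHnc n))).integrable_of_hasCompactSupport hc.mul_right
    rw [← integral_sub i0 (iFH' n), ← integral_const_mul]
    refine norm_integral_le_of_norm_le (((integrable_mollify _ iH).sub iH).abs.const_mul _)
      (.of_forall fun x => ?_)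
    have h3 : |φ x| ≤ M := hM x
    rw [← mul_sub, ← mul_sub, Real.norm_eq_abs, abs_mul, abs_mul, ← mul_assoc]
    gcongr
    exact hC _
  have lim3 : Tendsto (fun n => ∫ x, φ x * (F' (wn n x) * H x)) atTop
      (𝓝 (∫ x, φ x * (F' (w x) * H x))) := by
    refine tendsto_integral_of_dominated_convergence (fun x => M * C * |H x|)
      (fun n => (iFH' n).aestronglyMeasurable) (iH.abs.const_mul _)
      (fun n => .of_forall fun x => ?_) ?_
    · have h3 : |φ x| ≤ M := hM x
      rw [Real.norm_eq_abs, abs_mul, abs_mul, mul_assoc]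
      gcongr
      exact hC _
    · filter_upwards [ae_tendsto_mollify iv.locallyIntegrable] with x hx
      exact (((hF'.tendsto _).comp hx).mul_const _).const_mul _
  have lim4 : Tendsto (fun n => ∫ x, F (wn n x) * fderiv ℝ φ x a) atTop
      (𝓝 (- ∫ x, φ x * (F' (w x) * H x))) := by
    simp only [hibp]
    simpa using (lim2.add lim3).neg
  have key := tendsto_nhds_unique lim1 lim4
  have e1 : ∫ x, F (u x) * fderiv ℝ φ x a = ∫ x, F (w x) * fderiv ℝ φ x a := by
    refine integral_congr_ae (.of_forall fun x => ?_)
    by_cases hx : x ∈ tsupport φ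
    · simp only [(hwu x hx).1]
    · have : fderiv ℝ φ x a = 0 := image_eq_zero_of_notMem_tsupport
        (f := fun x => fderiv ℝ φ x a) fun h' => hx (tsupport_fderiv_apply_subset ℝ a h')
      simp [this]
  have e2 : ∫ x, φ x * (F' (u x) * g x) = ∫ x, φ x * (F' (w x) * H x) := by
    refine integral_congr_ae (.of_forall fun x => ?_)
    by_cases hx : x ∈ tsupport φ
    · simp only [(hwu x hx).1, (hwu x hx).2]
    · simp [image_eq_zero_of_notMem_tsupport hx]
  rw [e1, e2, key]

/-- Weak derivatives pass to dominated limits. -/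
theorem HasWeakDeriv.of_tendsto (hU : IsOpen U) {un gn : ℕ → Eucl d → ℝ} {b G : Eucl d → ℝ}
    (hn : ∀ n, HasWeakDeriv U (un n) a (gn n)) (hb : LocallyIntegrableOn b U)
    (hG : LocallyIntegrableOn G U) (hub : ∀ n x, |un n x| ≤ b x)
    (hgG : ∀ n, ∀ᵐ x ∂(volume.restrict U), |gn n x| ≤ G x)
    (hu : ∀ᵐ x ∂(volume.restrict U), Tendsto (fun n => un n x) atTop (𝓝 (u x)))
    (hg : ∀ᵐ x ∂(volume.restrict U), Tendsto (fun n => gn n x) atTop (𝓝 (g x))) :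
    HasWeakDeriv U u a g := by
  have hlocal : ∀ {f b : Eucl d → ℝ} {fn : ℕ → Eucl d → ℝ}, (∀ n, LocallyIntegrableOn (fn n) U) →
      LocallyIntegrableOn b U → (∀ n, ∀ᵐ x ∂(volume.restrict U), |fn n x| ≤ b x) →
      (∀ᵐ x ∂(volume.restrict U), Tendsto (fun n => fn n x) atTop (𝓝 (f x))) →
      LocallyIntegrableOn f U := by
    intro f b fn hfn hb hfb hf
    simp only [locallyIntegrableOn_iff hU.isLocallyClosed] at hfn hb ⊢
    intro k hkU hk
    refine (hb k hkU hk).mono' (aestronglyMeasurable_of_tendsto_ae atTop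
      (fun n => (hfn n k hkU hk).aestronglyMeasurable)
      (ae_restrict_of_ae_restrict_of_subset hkU hf)) ?_
    filter_upwards [ae_restrict_of_ae_restrict_of_subset hkU hf,
      ae_restrict_of_ae_restrict_of_subset hkU (ae_all_iff.2 hfb)] with x hx hx'
    exact le_of_tendsto hx.norm (.of_forall hx')
  have hlim : ∀ {f b ψ : Eucl d → ℝ} {fn : ℕ → Eucl d → ℝ}, (∀ n, LocallyIntegrableOn (fn n) U) →
      LocallyIntegrableOn b U → (∀ n, ∀ᵐ x ∂(volume.restrict U), |fn n x| ≤ b x) →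
      (∀ᵐ x ∂(volume.restrict U), Tendsto (fun n => fn n x) atTop (𝓝 (f x))) →
      Continuous ψ → HasCompactSupport ψ → tsupport ψ ⊆ U →
      Tendsto (fun n => ∫ x, fn n x * ψ x) atTop (𝓝 (∫ x, f x * ψ x)) := by
    intro f b ψ fn hfn hb hfb hf hψ hc hs
    have hz : ∀ x ∉ U, ψ x = 0 := fun x hx =>
      image_eq_zero_of_notMem_tsupport fun h' => hx (hs h')
    rw [ae_restrict_iff' hU.measurableSet] at hf
    refine tendsto_integral_of_dominated_convergence (fun x => |b x * ψ x|)
      (fun n => (integrable_mul_of_locallyIntegrableOn (hfn n) hψ hc hs).aestronglyMeasurable)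
      (integrable_mul_of_locallyIntegrableOn hb hψ hc hs).abs (fun n => ?_) ?_
    · have := hfb n
      rw [ae_restrict_iff' hU.measurableSet] at this
      filter_upwards [this] with x hx
      by_cases hxU : x ∈ U
      · rw [Real.norm_eq_abs, abs_mul, abs_mul]
        exact mul_le_mul_of_nonneg_right ((hx hxU).trans (le_abs_self _)) (abs_nonneg _)
      · simp [hz x hxU]
    · filter_upwards [hf] with x hx
      by_cases hxU : x ∈ U
      · exact (hx hxU).mul_const _
      · simp [hz x hxU]
  have hub' : ∀ n, ∀ᵐ x ∂(volume.restrict U), |un n x| ≤ b x := fun n => .of_forall (hub n)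
  refine ⟨hlocal (fun n => (hn n).1) hb hub' hu, hlocal (fun n => (hn n).2) hG hgG hg,
    fun φ hφ hc hs => ?_⟩
  have l1 := hlim (fun n => (hn n).1) hb hub' hu (continuous_fderiv_apply_of_contDiff hφ a)
    (hc.fderiv_apply ℝ a) ((tsupport_fderiv_apply_subset ℝ a).trans hs)
  have l2 := hlim (fun n => (hn n).2) hG hgG hg hφ.continuous hc hs
  refine tendsto_nhds_unique l1 ?_
  simp only [fun n => (hn n).3 φ hφ hc hs]
  simpa only [mul_comm] using l2.neg

/-- A function with vanishing weak derivatives on a neighbourhood of a closed ball is almost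
everywhere constant on the concentric ball of half the radius. -/
theorem exists_ae_eq_const_on_ball {x₀ : Eucl d} {r : ℝ} (hr : 0 < r)
    (hb : Metric.closedBall x₀ (2 * r) ⊆ U) (hu : ∀ a, HasWeakDeriv U u a 0) :
    ∃ c, ∀ᵐ x ∂(volume.restrict (Metric.ball x₀ r)), u x = c := by
  set v : Eucl d → ℝ := (Metric.ball x₀ (2 * r)).indicator u with hv
  have hvi : Integrable v volume := by
    rw [hv, integrable_indicator_iff Metric.isOpen_ball.measurableSet]
    exact ((hu 0).1.integrableOn_compact_subset hb (isCompact_closedBall _ _)).mono_set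
      Metric.ball_subset_closedBall
  -- Extending $u$ by zero outside the ball of radius $2r$ makes it globally integrable.
  -- Mollifications of radius below $r$ then have zero derivative on the ball of radius $r$, hence
  -- are constant there.
  have hvw : ∀ a, HasWeakDeriv (Metric.ball x₀ (2 * r)) v a 0 := fun a =>
    ((hu a).mono (Metric.ball_subset_closedBall.trans hb)).congr_ae Metric.isOpen_ball
      (by
        filter_upwards [ae_restrict_mem Metric.isOpen_ball.measurableSet] with x hx
        rw [hv, Set.indicator_of_mem hx]) (.refl _ _)
  have hconst : ∀ᶠ n in atTop, ∀ x ∈ Metric.ball x₀ r,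
      mollify (stdBump n) v x = mollify (stdBump n) v x₀ := by
    filter_upwards [tendsto_stdBump_rOut (d := d) |>.eventually (gt_mem_nhds hr)] with n hn x hx
    refine (Metric.isOpen_ball).is_const_of_fderiv_eq_zero (𝕜 := ℝ)
      (convex_ball x₀ r).isPreconnected
      ((contDiff_mollify _ hvi.locallyIntegrable).differentiable (by simp)).differentiableOn
      (fun y hy => ?_) hx (Metric.mem_ball_self hr)
    ext a
    rw [(hvw a).fderiv_mollify hvi.locallyIntegrable (stdBump n) (x := y)]
    · simp [mollify_apply]
    · intro z hz
      rw [Metric.mem_closedBall] at hz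
      rw [Metric.mem_ball] at hy ⊢
      linarith [dist_triangle z y x₀]
  have hlim : ∀ᵐ x ∂(volume.restrict (Metric.ball x₀ r)),
      Tendsto (fun n => mollify (stdBump n) v x₀) atTop (𝓝 (u x)) := by
    filter_upwards [ae_restrict_of_ae (ae_tendsto_mollify hvi.locallyIntegrable),
      ae_restrict_mem Metric.isOpen_ball.measurableSet] with x hx hxb
    have h1 : v x = u x := Set.indicator_of_mem (Metric.ball_subset_ball (by linarith) hxb) _
    rw [← h1]
    refine hx.congr' ?_
    filter_upwards [hconst] with n hn using hn x hxb
  -- Positive measure supplies one point $y$ where the constants converge; their limit $u(y)$ is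
  -- then the value of $u$ almost everywhere.
  have : (ae (volume.restrict (Metric.ball x₀ r))).NeBot := by
    rw [ae_neBot, Ne, Measure.restrict_eq_zero]
    exact (Metric.measure_ball_pos volume x₀ hr).ne'
  obtain ⟨y, hy⟩ := hlim.exists
  exact ⟨u y, hlim.mono fun x hx => tendsto_nhds_unique hx hy⟩

/-- A function on a connected open set with vanishing weak derivatives is almost everywhere
constant. -/
theorem exists_ae_eq_const_of_hasWeakDeriv_zero (hU : IsOpen U) (hUc : IsPreconnected U)
    (hu : ∀ a, HasWeakDeriv U u a 0) : ∃ c, ∀ᵐ x ∂(volume.restrict U), u x = c := by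
  rcases U.eq_empty_or_nonempty with rfl | ⟨x₁, hx₁⟩
  · exact ⟨0, by simp⟩
  have hloc : ∀ x ∈ U, ∃ r > 0, ∃ c : ℝ, ∀ᵐ y ∂(volume.restrict (Metric.ball x r)), u y = c := by
    intro x hx
    obtain ⟨r, hr, hrU⟩ := Metric.nhds_basis_closedBall.mem_iff.1 (hU.mem_nhds hx)
    obtain ⟨c, hc⟩ := exists_ae_eq_const_on_ball (x₀ := x) (r := r / 2) (by positivity)
      (by rwa [mul_div_cancel₀ r two_ne_zero]) hu
    exact ⟨r / 2, by positivity, c, hc⟩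
  choose! r hr c hc using hloc
  -- If the centre of one ball lies in another, the two overlap in positive measure, so their
  -- constants agree; preconnectedness propagates this local equality.
  have hP : ∀ y ∈ U, c x₁ = c y := by
    intro y hy
    refine hUc.induction₂ (fun x y => c x = c y) (fun x hx => ?_) (fun x y z _ _ _ => Eq.trans)
      (fun x y _ _ => Eq.symm) hx₁ hy
    filter_upwards [self_mem_nhdsWithin,
      mem_nhdsWithin_of_mem_nhds (Metric.ball_mem_nhds x (hr x hx))] with z hz hzx
    have hpos : volume (Metric.ball x (r x) ∩ Metric.ball z (r z)) ≠ 0 :=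
      ((Metric.isOpen_ball.inter Metric.isOpen_ball).measure_pos volume
        ⟨z, hzx, Metric.mem_ball_self (hr z hz)⟩).ne'
    have : (ae (volume.restrict (Metric.ball x (r x) ∩ Metric.ball z (r z)))).NeBot := by
      rwa [ae_neBot, Ne, Measure.restrict_eq_zero]
    obtain ⟨t, ht1, ht2⟩ := ((ae_restrict_of_ae_restrict_of_subset Set.inter_subset_left
      (hc x hx)).and (ae_restrict_of_ae_restrict_of_subset Set.inter_subset_right (hc z hz))).exists
    rw [← ht1, ← ht2]
  refine ⟨c x₁, ?_⟩
  rw [ae_restrict_iff' hU.measurableSet, ae_iff]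
  refine measure_null_of_locally_null _ fun x hx => ?_
  have hxU : x ∈ U := by
    by_contra h'
    exact hx fun h'' => absurd h'' h'
  refine ⟨_, inter_mem_nhdsWithin _ (Metric.ball_mem_nhds x (hr x hxU)), ?_⟩
  have h1 := hc x hxU
  rw [ae_restrict_iff' Metric.isOpen_ball.measurableSet, ae_iff] at h1
  refine measure_mono_null (fun y hy => ?_) h1
  refine fun hy' => hy.1 fun _ => ?_
  rw [hP x hxU, hy' hy.2]

end ChainRule

/-! ### Weak gradients -/

section WeakGrad

variable {d : ℕ} {Ω : Set (Eucl d)} {u v : Eucl d → ℝ} {G G' : Eucl d → Eucl d}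

theorem locallyIntegrableOn_inner_const {U : Set (Eucl d)} (hU : IsOpen U)
    (hG : LocallyIntegrableOn G U) (a : Eucl d) :
    LocallyIntegrableOn (fun x => inner ℝ (G x) a) U := by
  rw [locallyIntegrableOn_iff hU.isLocallyClosed] at hG ⊢
  exact fun k hkU hk => (hG k hkU hk).inner_const a

theorem setIntegral_eq_of_tsupport_subset {φ f : Eucl d → ℝ} (hs : tsupport φ ⊆ interior Ω)
    (hf : ∀ x ∉ tsupport φ, f x = 0) : ∫ x in Ω, f x = ∫ x, f x :=
  setIntegral_eq_integral_of_forall_compl_eq_zero fun x hx =>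
    hf x fun h => hx (interior_subset (hs h))

theorem IsWeakGrad.hasWeakDeriv (h : IsWeakGrad Ω u G) (a : Eucl d) :
    HasWeakDeriv (interior Ω) u a (fun x => inner ℝ (G x) a) := by
  refine ⟨h.1, locallyIntegrableOn_inner_const isOpen_interior h.2.1 a, fun φ hφ hc hs => ?_⟩
  have := h.2.2 φ hφ hc hs a
  rwa [setIntegral_eq_of_tsupport_subset hs fun x hx => ?_,
    setIntegral_eq_of_tsupport_subset hs fun x hx => ?_] at this
  · simp [image_eq_zero_of_notMem_tsupport hx]
  · have : fderiv ℝ φ x a = 0 := image_eq_zero_of_notMem_tsupport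
      (f := fun x => fderiv ℝ φ x a) fun h' => hx (tsupport_fderiv_apply_subset ℝ a h')
    simp [this]

/-- Coordinate directions suffice because $\partial_a\varphi$ is linear in $a$. This reduces every
gradient statement to scalar directional derivatives. -/
theorem isWeakGrad_of_hasWeakDeriv (hu : LocallyIntegrableOn u (interior Ω))
    (hG : LocallyIntegrableOn G (interior Ω))
    (h : ∀ i, HasWeakDeriv (interior Ω) u (EuclideanSpace.single i 1) (fun x => G x i)) :
    IsWeakGrad Ω u G := by
  refine ⟨hu, hG, fun φ hφ hc hs a => ?_⟩
  rw [setIntegral_eq_of_tsupport_subset hs fun x hx => ?_,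
    setIntegral_eq_of_tsupport_subset hs fun x hx => ?_]
  · have hdec : ∀ x, fderiv ℝ φ x a = ∑ i, a i * fderiv ℝ φ x (EuclideanSpace.single i 1) := by
      intro x
      conv_lhs => rw [← (EuclideanSpace.basisFun (Fin d) ℝ).sum_repr a]
      simp [map_sum]
    have hdec' : ∀ x, inner ℝ (G x) a = ∑ i, a i * G x i := fun x => by
      simp [PiLp.inner_apply]
    simp only [hdec, hdec', Finset.mul_sum]
    rw [integral_finsetSum, integral_finsetSum, ← Finset.sum_neg_distrib]
    · refine Finset.sum_congr rfl fun i _ => ?_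
      have := (h i).3 φ hφ hc hs
      simp only [mul_left_comm _ (a i), integral_const_mul, this, mul_neg]
    · intro i _
      have := (integrable_mul_of_locallyIntegrableOn (h i).2 hφ.continuous hc hs).const_mul (a i)
      refine this.congr (.of_forall fun x => ?_)
      simp only
      ring
    · intro i _
      have := (HasWeakDeriv.integrable_mul_fderiv (a := EuclideanSpace.single i 1) hu hφ hc
        hs).const_mul (a i)
      refine this.congr (.of_forall fun x => ?_)
      simp only
      ring
  · simp [image_eq_zero_of_notMem_tsupport hx]
  · have : fderiv ℝ φ x a = 0 := image_eq_zero_of_notMem_tsupport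
      (f := fun x => fderiv ℝ φ x a) fun h' => hx (tsupport_fderiv_apply_subset ℝ a h')
    simp [this]

theorem IsWeakGrad.hasWeakDeriv_single (h : IsWeakGrad Ω u G) (i : Fin d) :
    HasWeakDeriv (interior Ω) u (EuclideanSpace.single i 1) (fun x => G x i) := by
  simpa [EuclideanSpace.inner_single_right] using h.hasWeakDeriv (EuclideanSpace.single i 1)

theorem IsWeakGrad.unique (h : IsWeakGrad Ω u G) (h' : IsWeakGrad Ω u G') :
    G =ᵐ[volume.restrict (interior Ω)] G' := by
  have := ae_all_iff.2 fun i =>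
    (h.hasWeakDeriv_single i).unique isOpen_interior (h'.hasWeakDeriv_single i)
  filter_upwards [this] with x hx
  ext i
  exact hx i

theorem WeaklyDifferentiable.isWeakGrad (h : WeaklyDifferentiable Ω u) :
    IsWeakGrad Ω u (weakGrad Ω u) := by
  rw [weakGrad, dif_pos h]
  exact h.choose_spec

theorem IsWeakGrad.congr_ae (h : IsWeakGrad Ω u G) (huv : u =ᵐ[volume.restrict (interior Ω)] v) :
    IsWeakGrad Ω v G :=
  isWeakGrad_of_hasWeakDeriv (locallyIntegrableOn_congr_ae isOpen_interior h.1 huv) h.2.1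
    fun i => (h.hasWeakDeriv_single i).congr_ae isOpen_interior huv (.refl _ _)

theorem IsWeakGrad.add (h : IsWeakGrad Ω u G) (h' : IsWeakGrad Ω v G') :
    IsWeakGrad Ω (fun x => u x + v x) (fun x => G x + G' x) :=
  isWeakGrad_of_hasWeakDeriv (h.1.add h'.1) (h.2.1.add h'.2.1)
    fun i => (h.hasWeakDeriv_single i).add (h'.hasWeakDeriv_single i)

theorem IsWeakGrad.const_mul (h : IsWeakGrad Ω u G) (c : ℝ) :
    IsWeakGrad Ω (fun x => c * u x) (fun x => c • G x) :=
  isWeakGrad_of_hasWeakDeriv (h.1.smul c) (h.2.1.smul c)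
    fun i => (h.hasWeakDeriv_single i).const_mul c

end WeakGrad

/-! ### Geometry of smooth domains -/

section Geometry

variable {d : ℕ} {Ω : Set (Eucl d)}

/-- For distinct unit vectors $\langle v,v'\rangle<1$, so the direction $v'-v$ enters $\Omega$
according to $v$ and leaves it according to $v'$. -/
theorem IsOutwardUnitNormal.unique {x v v' : Eucl d} (h : IsOutwardUnitNormal Ω x v)
    (h' : IsOutwardUnitNormal Ω x v') : v = v' := by
  by_contra hne
  have h1 : inner ℝ v v' < (1 : ℝ) := by
    refine lt_of_le_of_ne ?_ fun he => hne ((inner_eq_one_iff_of_norm_eq_one h.1 h'.1).1 he)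
    simpa [h.1, h'.1] using real_inner_le_norm v v'
  have e1 : inner ℝ v v = (1 : ℝ) := by rw [real_inner_self_eq_norm_sq, h.1]; norm_num
  have e2 : inner ℝ v' v' = (1 : ℝ) := by rw [real_inner_self_eq_norm_sq, h'.1]; norm_num
  have a1 := h.2.1 (v' - v) (by rw [inner_sub_right, e1]; linarith)
  have a2 := h'.2.2 (v' - v) (by rw [inner_sub_right, e2, real_inner_comm]; linarith)
  obtain ⟨t, ht1, ht2⟩ := (a1.and a2).exists
  exact ht2 ht1

theorem IsOutwardUnitNormal.outwardNormal_eq {x v : Eucl d} (h : IsOutwardUnitNormal Ω x v) :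
    outwardNormal Ω x = v := by
  have h' : ∃ v, IsOutwardUnitNormal Ω x v := ⟨v, h⟩
  rw [outwardNormal, dif_pos h']
  exact h'.choose_spec.unique h

/-- If `Ω` is locally a sublevel set, the normalized gradient is the outward unit normal. -/
theorem isOutwardUnitNormal_of_sublevel {V : Set (Eucl d)} {ρ : Eucl d → ℝ} (hV : IsOpen V)
    (hρ : ContDiff ℝ ∞ ρ) (hVΩ : ∀ y ∈ V, (y ∈ Ω ↔ ρ y ≤ 0)) {x : Eucl d} (hxV : x ∈ V)
    (hx0 : ρ x = 0) (hd : gradient ρ x ≠ 0) :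
    IsOutwardUnitNormal Ω x (‖gradient ρ x‖⁻¹ • gradient ρ x) := by
  have hdiff : DifferentiableAt ℝ ρ x := (hρ.differentiable (by simp)).differentiableAt
  have hpos : 0 < ‖gradient ρ x‖ := norm_pos_iff.2 hd
  have hline : ∀ w : Eucl d, HasDerivAt (fun t : ℝ => ρ (x + t • w))
      (inner ℝ (gradient ρ x) w) 0 := by
    intro w
    have h1 : HasDerivAt (fun t : ℝ => x + t • w) w 0 := by
      simpa using ((hasDerivAt_id (0 : ℝ)).smul_const w).const_add x
    have h2 : HasFDerivAt ρ (fderiv ℝ ρ x) (x + (0 : ℝ) • w) := by simpa using hdiff.hasFDerivAt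
    have := h2.comp_hasDerivAt (0 : ℝ) h1
    rwa [show inner ℝ (gradient ρ x) w = fderiv ℝ ρ x w by simp [gradient]]
  have hmem : ∀ w : Eucl d, ∀ᶠ t : ℝ in 𝓝[>] 0, x + t • w ∈ V := by
    intro w
    have hc : ContinuousAt (fun t : ℝ => x + t • w) 0 := by fun_prop
    refine (hc.eventually_mem (hV.mem_nhds (by simpa using hxV))).filter_mono nhdsWithin_le_nhds
  -- As $\rho(x)=0$, the sign of $\rho(x+tw)$ for small $t>0$ is that of
  -- $\langle\nabla\rho(x),w\rangle$ whenever the latter is nonzero.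
  have hsl : ∀ w : Eucl d, Tendsto (fun t : ℝ => t⁻¹ * ρ (x + t • w)) (𝓝[>] 0)
      (𝓝 (inner ℝ (gradient ρ x) w)) := by
    intro w
    have := (hline w).tendsto_slope_zero_right
    simpa [hx0] using this
  refine ⟨by rw [norm_smul, norm_inv, norm_norm, inv_mul_cancel₀ hpos.ne'], fun w hw => ?_,
    fun w hw => ?_⟩
  · rw [inner_smul_left, mul_neg_iff] at hw
    have hw' : inner ℝ (gradient ρ x) w < 0 := by
      rcases hw with h | h
      · exact h.2
      · exact absurd h.1 (by simp)
    filter_upwards [hmem w, (hsl w).eventually (gt_mem_nhds hw'), self_mem_nhdsWithin]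
      with t ht1 ht2 ht3
    rw [hVΩ _ ht1]
    have ht3' : (0 : ℝ) < t⁻¹ := inv_pos.2 ht3
    by_contra! hcon
    exact absurd ht2 (not_lt.2 (by positivity))
  · rw [inner_smul_left, mul_pos_iff] at hw
    have hw' : 0 < inner ℝ (gradient ρ x) w := by
      rcases hw with h | h
      · exact h.2
      · exact absurd h.1 (by simp)
    filter_upwards [hmem w, (hsl w).eventually (lt_mem_nhds hw'), self_mem_nhdsWithin]
      with t ht1 ht2 ht3
    rw [hVΩ _ ht1, not_le]
    have ht3' : (0 : ℝ) < t⁻¹ := inv_pos.2 ht3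
    exact pos_of_mul_pos_right ht2 ht3'.le

theorem IsSmoothCompactDomain.frontier_subset (hΩ : IsSmoothCompactDomain Ω) : frontier Ω ⊆ Ω :=
  hΩ.isCompact.isClosed.frontier_subset

/-- Near a boundary point, the outward normal is the normalized gradient of a defining function. -/
theorem IsSmoothCompactDomain.exists_defining (hΩ : IsSmoothCompactDomain Ω) {x : Eucl d}
    (hx : x ∈ frontier Ω) : ∃ (V : Set (Eucl d)) (ρ : Eucl d → ℝ),
    IsOpen V ∧ x ∈ V ∧ ContDiff ℝ ∞ ρ ∧ (∀ y ∈ V, gradient ρ y ≠ 0) ∧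
    (∀ y ∈ V, (y ∈ Ω ↔ ρ y ≤ 0)) ∧ (∀ y ∈ V, ρ y < 0 → y ∈ interior Ω) ∧
    ∀ y ∈ V, y ∈ frontier Ω →
      ρ y = 0 ∧ IsOutwardUnitNormal Ω y (‖gradient ρ y‖⁻¹ • gradient ρ y) := by
  obtain ⟨V, ρ, hV, hxV, hρ, hd, hVΩ⟩ := hΩ.smooth_boundary x hx
  have hgc : Continuous (fun y => gradient ρ y) := by
    simp only [gradient]
    exact (LinearIsometryEquiv.continuous _).comp (hρ.continuous_fderiv (by simp))
  have hInt : ∀ y ∈ V, ρ y < 0 → y ∈ interior Ω := by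
    intro y hy hρy
    rw [mem_interior_iff_mem_nhds]
    filter_upwards [hV.mem_nhds hy, hρ.continuous.continuousAt.eventually (gt_mem_nhds hρy)]
      with z hz hz'
    exact (hVΩ z hz).2 (le_of_lt hz')
  have hdx : gradient ρ x ≠ 0 := by simpa [gradient] using hd
  refine ⟨V ∩ {y | gradient ρ y ≠ 0}, ρ, hV.inter (isOpen_ne_fun hgc continuous_const),
    ⟨hxV, hdx⟩, hρ, fun y hy => hy.2, fun y hy => hVΩ y hy.1, fun y hy => hInt y hy.1,
    fun y hy hyf => ?_⟩
  have h0 : ρ y = 0 := le_antisymm ((hVΩ y hy.1).1 (hΩ.frontier_subset hyf))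
    (not_lt.1 fun h => hyf.2 (hInt y hy.1 h))
  exact ⟨h0, isOutwardUnitNormal_of_sublevel hV hρ hVΩ hy.1 h0 hy.2⟩

theorem IsSmoothCompactDomain.norm_outwardNormal (hΩ : IsSmoothCompactDomain Ω) {x : Eucl d}
    (hx : x ∈ frontier Ω) : ‖outwardNormal Ω x‖ = 1 := by
  obtain ⟨V, ρ, -, hxV, -, -, -, -, h⟩ := hΩ.exists_defining hx
  rw [(h x hxV hx).2.outwardNormal_eq]
  exact (h x hxV hx).2.1

theorem IsSmoothCompactDomain.continuousOn_outwardNormal (hΩ : IsSmoothCompactDomain Ω) :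
    ContinuousOn (outwardNormal Ω) (frontier Ω) := by
  intro x hx
  obtain ⟨V, ρ, hV, hxV, hρ, hg, -, -, h⟩ := hΩ.exists_defining hx
  have hgc : Continuous (fun y => gradient ρ y) := by
    simp only [gradient]
    exact (LinearIsometryEquiv.continuous _).comp (hρ.continuous_fderiv (by simp))
  have hc : ContinuousAt (fun y => ‖gradient ρ y‖⁻¹ • gradient ρ y) x :=
    (hgc.continuousAt.norm.inv₀ (norm_ne_zero_iff.2 (hg x hxV))).smul hgc.continuousAt
  refine hc.continuousWithinAt.congr_of_eventuallyEq ?_ (h x hxV hx).2.outwardNormal_eq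
  filter_upwards [self_mem_nhdsWithin, mem_nhdsWithin_of_mem_nhds (hV.mem_nhds hxV)] with y hy hyV
  exact (h y hyV hy).2.outwardNormal_eq

/-- Cone property: near a boundary point, moving from a point of `Ω` in a direction close to
minus the outward normal leads into the interior of `Ω`. -/
theorem IsSmoothCompactDomain.exists_cone (hΩ : IsSmoothCompactDomain Ω) {x : Eucl d}
    (hx : x ∈ frontier Ω) {ε : ℝ} (hε : 0 < ε) : ∃ r > 0, ∀ y ∈ Metric.ball x r,
      ∀ y' ∈ Metric.ball x r, ε * ‖y - y'‖ < inner ℝ (outwardNormal Ω x) (y - y') →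
      y ∈ Ω → y' ∈ interior Ω := by
  obtain ⟨V, ρ, hV, hxV, hρ, hg, hVΩ, hInt, h⟩ := hΩ.exists_defining hx
  -- Strict differentiability controls the linearization error for all pairs near $x$ by
  -- $\varepsilon\|\nabla\rho(x)\|\,\|y-y'\|$. The cone condition beats this error, so
  -- $\rho(y')<\rho(y)\le0$.
  have hstrict : HasStrictFDerivAt ρ (fderiv ℝ ρ x) x :=
    hρ.contDiffAt.hasStrictFDerivAt (by simp)
  have hpos : 0 < ‖gradient ρ x‖ := norm_pos_iff.2 (hg x hxV)
  have hlittle := hstrict.isLittleO.def (mul_pos hε hpos)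
  rw [nhds_prod_eq] at hlittle
  obtain ⟨t, ht, htp⟩ := eventually_prod_self_iff'.1 hlittle
  obtain ⟨r, hr, hball⟩ := Metric.mem_nhds_iff.1 (inter_mem ht (hV.mem_nhds hxV))
  refine ⟨r, hr, fun y hy y' hy' hlt hyΩ => ?_⟩
  have h1 := htp y (hball hy).1 y' (hball hy').1
  refine hInt y' (hball hy').2 ?_
  have h2 := (hVΩ y (hball hy).2).1 hyΩ
  have h3 : fderiv ℝ ρ x (y - y') = inner ℝ (gradient ρ x) (y - y') := by simp [gradient]
  rw [(h x hxV hx).2.outwardNormal_eq, inner_smul_left] at hlt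
  have h4 : ε * ‖gradient ρ x‖ * ‖y - y'‖ < inner ℝ (gradient ρ x) (y - y') := by
    have := mul_lt_mul_of_pos_left hlt hpos
    simp only [map_inv₀, conj_trivial, mul_inv_cancel_left₀ hpos.ne'] at this
    linarith
  rw [← h3] at h4
  simp only at h1
  have h5 := (abs_le.1 (Real.norm_eq_abs _ ▸ h1)).1
  linarith

/-- The boundary of a smooth domain is a Lebesgue null set. -/
theorem IsSmoothCompactDomain.volume_frontier (hΩ : IsSmoothCompactDomain Ω) :
    volume (frontier Ω) = 0 := by
  refine measure_null_of_locally_null _ fun x hx => ?_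
  obtain ⟨r, hr, hcone⟩ := hΩ.exists_cone hx (ε := 1 / 2) (by norm_num)
  refine ⟨_, inter_mem_nhdsWithin _ (Metric.ball_mem_nhds x hr), ?_⟩
  set S := frontier Ω ∩ Metric.ball x r with hS
  have hn := hΩ.norm_outwardNormal hx
  set n := outwardNormal Ω x
  have hnn : inner ℝ n n = (1 : ℝ) := by rw [real_inner_self_eq_norm_sq, hn]; norm_num
  -- Two boundary points near $x$ cannot differ by a positive multiple of $n$: the cone property
  -- would put the lower one in the interior.
  have hkey : ∀ y ∈ S, ∀ y' ∈ S, ∀ t : ℝ, 0 < t → y - y' ≠ t • n := by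
    intro y hy y' hy' t ht he
    refine hy'.1.2 (hcone y hy.2 y' hy'.2 ?_ (hΩ.frontier_subset hy.1))
    rw [he, norm_smul, inner_smul_right, hnn, hn, Real.norm_eq_abs, abs_of_pos ht]
    linarith
  -- The translates of $S$ by $n/(k+1)$ are pairwise disjoint with bounded shifts; infinitely many
  -- such copies force measure zero.
  refine Measure.addHaar_eq_zero_of_disjoint_translates volume
    (fun k : ℕ => (1 / ((k : ℝ) + 1)) • n) ?_ ?_
    (isClosed_frontier.measurableSet.inter Metric.isOpen_ball.measurableSet)
  · refine (Metric.isBounded_closedBall (x := (0 : Eucl d)) (r := 1)).subset ?_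
    rintro _ ⟨k, rfl⟩
    rw [mem_closedBall_zero_iff]
    simp only [norm_smul, hn, mul_one, Real.norm_eq_abs]
    rw [abs_of_pos (by positivity), div_le_one (by positivity)]
    linarith [(Nat.cast_nonneg k : (0 : ℝ) ≤ k)]
  · intro k l hkl
    simp only [Function.onFun, Set.singleton_add]
    rw [Set.disjoint_left]
    rintro _ ⟨y, hy, rfl⟩ ⟨y', hy', he⟩
    simp only at he
    rcases lt_or_gt_of_ne hkl with hlt | hlt
    · refine hkey y' hy' y hy (1 / ((k : ℝ) + 1) - 1 / ((l : ℝ) + 1)) ?_ ?_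
      · rw [sub_pos]
        have : (k : ℝ) < l := by exact_mod_cast hlt
        gcongr
      · rw [sub_smul, sub_eq_sub_iff_add_eq_add, add_comm y', he]
    · refine hkey y hy y' hy' (1 / ((l : ℝ) + 1) - 1 / ((k : ℝ) + 1)) ?_ ?_
      · rw [sub_pos]
        have : (l : ℝ) < k := by exact_mod_cast hlt
        gcongr
      · rw [sub_smul, sub_eq_sub_iff_add_eq_add, add_comm y, he]

theorem IsSmoothCompactDomain.interior_ae_eq (hΩ : IsSmoothCompactDomain Ω) :
    interior Ω =ᵐ[volume] Ω :=
  interior_ae_eq_of_null_frontier hΩ.volume_frontier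

theorem IsSmoothCompactDomain.restrict_interior (hΩ : IsSmoothCompactDomain Ω) :
    volume.restrict (interior Ω) = volume.restrict Ω :=
  Measure.restrict_congr_set hΩ.interior_ae_eq

/-- Near a boundary point, the interior of a smooth domain lies in one connected piece. -/
theorem IsSmoothCompactDomain.exists_local_connected (hΩ : IsSmoothCompactDomain Ω) {x : Eucl d}
    (hx : x ∈ frontier Ω) : ∃ δ > 0,
      (Ω ∩ Metric.ball x δ ⊆ closure (interior Ω ∩ Metric.ball x δ)) ∧
      ∃ N ⊆ interior Ω, IsPreconnected N ∧ interior Ω ∩ Metric.ball x δ ⊆ N := by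
  obtain ⟨r, hr, hcone⟩ := hΩ.exists_cone hx (ε := 1 / 2) (by norm_num)
  have hn := hΩ.norm_outwardNormal hx
  have hxΩ := hΩ.frontier_subset hx
  set n := outwardNormal Ω x
  have hnn : inner ℝ n n = (1 : ℝ) := by rw [real_inner_self_eq_norm_sq, hn]; norm_num
  have hpush : ∀ y ∈ Ω, ∀ t : ℝ, 0 < t → y ∈ Metric.ball x r → y - t • n ∈ Metric.ball x r →
      y - t • n ∈ interior Ω := by
    intro y hy t ht hyb hyb'
    refine hcone y hyb _ hyb' ?_ hy
    rw [sub_sub_cancel, norm_smul, inner_smul_right, hnn, hn, Real.norm_eq_abs, abs_of_pos ht]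
    linarith
  have hmem : ∀ y : Eucl d, ∀ s t : ℝ, 0 ≤ t → ‖y - x‖ < s → s + t ≤ r →
      y - t • n ∈ Metric.ball x r := by
    intro y s t ht hy hst
    rw [mem_ball_iff_norm, sub_right_comm]
    calc ‖y - x - t • n‖ ≤ ‖y - x‖ + ‖t • n‖ := norm_sub_le _ _
      _ < r := by rw [norm_smul, hn, Real.norm_eq_abs, abs_of_nonneg ht]; linarith
  -- The truncated cone at $x$ is convex and lies in the interior. It is the hub to which all nearby
  -- interior points get connected.
  set C := {y : Eucl d | y ∈ Metric.ball x r ∧ 1 / 2 * ‖x - y‖ < inner ℝ n (x - y)} with hC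
  have hCsub : C ⊆ interior Ω := fun y hy => hcone x (Metric.mem_ball_self hr) y hy.1 hy.2 hxΩ
  have hCconv : Convex ℝ C := by
    have : C = Metric.ball x r ∩ {y | 1 / 2 * ‖x - y‖ - inner ℝ n (x - y) < 0} := by
      ext y; simp [hC]
    rw [this]
    refine (convex_ball x r).inter ?_
    have hconv : ConvexOn ℝ Set.univ (fun y : Eucl d => 1 / 2 * ‖x - y‖ - inner ℝ n (x - y)) := by
      refine ⟨convex_univ, fun y _ z _ a b ha hb hab => ?_⟩
      have e : x - (a • y + b • z) = a • (x - y) + b • (x - z) := by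
        rw [smul_sub, smul_sub]
        nth_rewrite 1 [← one_smul ℝ x, ← hab, add_smul]
        abel
      simp only [smul_eq_mul]
      rw [e, inner_add_right, inner_smul_right, inner_smul_right]
      have := norm_add_le (a • (x - y)) (b • (x - z))
      rw [norm_smul, norm_smul, Real.norm_of_nonneg ha, Real.norm_of_nonneg hb] at this
      linarith
    simpa using hconv.convex_lt 0
  -- Sliding an interior point $y$ by $r/2$ along $-n$ ends in $C$. The radius $r/8$ makes this
  -- work: the displacement from $x$ has norm at most $5r/8$ and normal component at least
  -- $3r/8>\tfrac12\cdot5r/8$.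
  set N := C ∪ ⋃ y ∈ interior Ω ∩ Metric.ball x (r / 8), segment ℝ y (y - (r / 2) • n) with hN
  refine ⟨r / 8, by positivity, fun y hy => ?_, N, ?_, ?_, ?_⟩
  · have hyb : ‖y - x‖ < r / 8 := mem_ball_iff_norm.1 hy.2
    have hc : Tendsto (fun t : ℝ => y - t • n) (𝓝[>] 0) (𝓝 y) := by
      have : ContinuousAt (fun t : ℝ => y - t • n) 0 := by fun_prop
      have h2 := this.tendsto
      simp only [zero_smul, sub_zero] at h2
      exact h2.mono_left nhdsWithin_le_nhds
    refine mem_closure_of_tendsto hc ?_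
    have hev := hc.eventually (Metric.isOpen_ball.mem_nhds hy.2)
    filter_upwards [hev, self_mem_nhdsWithin] with t ht ht0
    exact ⟨hpush y hy.1 t ht0 (Metric.ball_subset_ball (by linarith) hy.2)
      (Metric.ball_subset_ball (by linarith) ht), ht⟩
  · refine Set.union_subset hCsub (Set.iUnion₂_subset fun y hy => ?_)
    rintro z hz
    rw [segment_eq_image'] at hz
    obtain ⟨θ, hθ, rfl⟩ := hz
    have hyb : ‖y - x‖ < r / 8 := mem_ball_iff_norm.1 hy.2
    have e : y + θ • (y - (r / 2) • n - y) = y - (θ * (r / 2)) • n := by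
      rw [sub_sub_cancel_left, smul_neg, smul_smul, sub_eq_add_neg]
    simp only [e]
    rcases hθ.1.eq_or_lt with h0 | h0
    · rw [← h0]; simpa using hy.1
    · refine hpush y (interior_subset hy.1) _ (by positivity)
        (Metric.ball_subset_ball (by linarith) hy.2) (hmem y (r / 8) _ (by positivity) hyb ?_)
      have : θ * (r / 2) ≤ 1 * (r / 2) := by gcongr; exact hθ.2
      linarith
  · have hend : ∀ y ∈ interior Ω ∩ Metric.ball x (r / 8), y - (r / 2) • n ∈ C := by
      intro y hy
      have hyb : ‖y - x‖ < r / 8 := mem_ball_iff_norm.1 hy.2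
      refine ⟨hmem y (r / 8) _ (by positivity) hyb (by linarith), ?_⟩
      have e : x - (y - (r / 2) • n) = (r / 2) • n - (y - x) := by abel
      have h1 : ‖x - (y - (r / 2) • n)‖ ≤ r / 2 + r / 8 := by
        rw [e]
        refine (norm_sub_le _ _).trans ?_
        rw [norm_smul, hn, Real.norm_of_nonneg (by positivity)]
        linarith
      have h2 : inner ℝ n (y - x) ≤ r / 8 := by
        have := real_inner_le_norm n (y - x)
        rw [hn] at this
        linarith
      have h3 : inner ℝ n (x - (y - (r / 2) • n)) = r / 2 - inner ℝ n (y - x) := by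
        rw [e, inner_sub_right, inner_smul_right, hnn, mul_one]
      rw [h3]
      linarith
    have hx' : x - (r / 2) • n ∈ C := by
      refine ⟨hmem x (r / 8) _ (by positivity) (by simpa using by positivity) (by linarith), ?_⟩
      rw [sub_sub_cancel, inner_smul_right, hnn, norm_smul, hn, Real.norm_of_nonneg (by positivity)]
      linarith
    rw [hN]
    -- Attaching a copy of $C$ to each segment makes every member of the union preconnected and
    -- gives all of them the common point $x-(r/2)n$.
    have : C ∪ ⋃ y ∈ interior Ω ∩ Metric.ball x (r / 8), segment ℝ y (y - (r / 2) • n) =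
        C ∪ ⋃ y ∈ interior Ω ∩ Metric.ball x (r / 8), (C ∪ segment ℝ y (y - (r / 2) • n)) := by
      ext z
      simp only [Set.mem_union, Set.mem_iUnion]
      constructor
      · rintro (h | ⟨y, hy, h⟩)
        · exact .inl h
        · exact .inr ⟨y, hy, .inr h⟩
      · rintro (h | ⟨y, hy, h | h⟩)
        · exact .inl h
        · exact .inl h
        · exact .inr ⟨y, hy, h⟩
    rw [this, ← Set.sUnion_image, ← Set.sUnion_insert]
    refine isPreconnected_sUnion (x - (r / 2) • n) _ ?_ ?_
    · rintro s (rfl | ⟨y, hy, rfl⟩)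
      · exact hx'
      · exact .inl hx'
    · rintro s (rfl | ⟨y, hy, rfl⟩)
      · exact hCconv.isPreconnected
      · exact IsPreconnected.union _ (hend y hy) (right_mem_segment ℝ _ _) hCconv.isPreconnected
          (convex_segment _ _).isPreconnected
  · exact fun y hy => .inr (Set.mem_iUnion₂.2 ⟨y, hy, left_mem_segment ℝ _ _⟩)

/-- The interior of a smooth domain is connected. -/
theorem IsSmoothCompactDomain.isPreconnected_interior (hΩ : IsSmoothCompactDomain Ω) :
    IsPreconnected (interior Ω) := by
  rcases (interior Ω).eq_empty_or_nonempty with h | ⟨a, ha⟩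
  · rw [h]; exact isPreconnected_empty
  set A := connectedComponentIn (interior Ω) a with hA
  have hAo : IsOpen A := isOpen_interior.connectedComponentIn
  have hAsub : A ⊆ interior Ω := connectedComponentIn_subset _ _
  have hAc : IsPreconnected A := isPreconnected_connectedComponentIn
  have haA : a ∈ A := mem_connectedComponentIn ha
  have habs : ∀ N ⊆ interior Ω, IsPreconnected N → (N ∩ A).Nonempty → N ⊆ A := by
    rintro N hN hNc ⟨z, hzN, hzA⟩
    have h1 := hNc.subset_connectedComponentIn hzN hN
    rwa [← connectedComponentIn_eq hzA] at h1
  have hnear : ∀ x ∈ closure A ∩ Ω, ∃ δ > 0, Ω ∩ Metric.ball x δ ⊆ closure A ∧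
      interior Ω ∩ Metric.ball x δ ⊆ A := by
    rintro x ⟨hxA, hxΩ⟩
    by_cases hxi : x ∈ interior Ω
    · obtain ⟨δ, hδ, hb⟩ := Metric.isOpen_iff.1 isOpen_interior x hxi
      obtain ⟨z, hz, hzA⟩ := Metric.mem_closure_iff.1 hxA δ hδ
      have := habs _ hb (convex_ball x δ).isPreconnected
        ⟨z, by rwa [Metric.mem_ball, dist_comm], hz⟩
      exact ⟨δ, hδ, fun y hy => subset_closure (this hy.2), fun y hy => this hy.2⟩
    · obtain ⟨δ, hδ, h1, N, hN, hNc, hsub⟩ := hΩ.exists_local_connected (x := x)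
        ⟨subset_closure hxΩ, hxi⟩
      obtain ⟨z, hz, hzA⟩ := Metric.mem_closure_iff.1 hxA δ hδ
      have := habs N hN hNc ⟨z, hsub ⟨hAsub hz, by rwa [Metric.mem_ball, dist_comm]⟩, hz⟩
      exact ⟨δ, hδ, h1.trans (closure_mono (hsub.trans this)), hsub.trans this⟩
  choose! δ hδ hδ1 hδ2 using hnear
  -- $W$ is an open neighbourhood of $\overline A\cap\Omega$ with $\Omega\cap W\subseteq\overline
  -- A$. Hence $\overline A\cap\Omega$ is relatively clopen, and connectedness of $\Omega$ makes it
  -- all of $\Omega$.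
  set W := ⋃ x ∈ closure A ∩ Ω, Metric.ball x (δ x) with hW
  have hWo : IsOpen W := isOpen_biUnion fun x _ => Metric.isOpen_ball
  have hWA : Ω ∩ W ⊆ closure A := by
    rintro y ⟨hy, hyW⟩
    obtain ⟨x, hx, hyx⟩ := Set.mem_iUnion₂.1 hyW
    exact hδ1 x hx ⟨hy, hyx⟩
  have hsub : Ω ⊆ closure A := by
    by_contra hcon
    obtain ⟨y, hy, hyA⟩ := Set.not_subset.1 hcon
    have haΩ := interior_subset ha
    obtain ⟨z, hz, hzW, hzA⟩ := hΩ.isConnected.isPreconnected W (closure A)ᶜ hWo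
      isClosed_closure.isOpen_compl
      (fun z hz => by
        by_cases hzA : z ∈ closure A
        · exact .inl (Set.mem_iUnion₂.2 ⟨z, ⟨hzA, hz⟩, Metric.mem_ball_self (hδ z ⟨hzA, hz⟩)⟩)
        · exact .inr hzA)
      ⟨a, haΩ, Set.mem_iUnion₂.2 ⟨a, ⟨subset_closure haA, haΩ⟩,
        Metric.mem_ball_self (hδ a ⟨subset_closure haA, haΩ⟩)⟩⟩ ⟨y, hy, hyA⟩
    exact hzA (hWA ⟨hz, hzW⟩)
  have : interior Ω = A := by
    refine Set.Subset.antisymm (fun y hy => ?_) hAsub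
    have hyΩ := interior_subset hy
    exact hδ2 y ⟨hsub hyΩ, hyΩ⟩ ⟨hy, Metric.mem_ball_self (hδ y ⟨hsub hyΩ, hyΩ⟩)⟩
  rwa [this]

end Geometry

/-! ### Boundary charts -/

section Charts

open scoped NNReal

variable {m : ℕ}

/-- `Φ` splits off the line spanned by the unit vector `n` isometrically. -/
structure IsSplitting (n : Eucl (m + 1)) (Φ : (Eucl m × ℝ) ≃L[ℝ] Eucl (m + 1)) : Prop where
  measurePreserving : MeasurePreserving Φ volume volume
  norm_sq : ∀ q, ‖Φ q‖ ^ 2 = ‖q.1‖ ^ 2 + q.2 ^ 2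
  inner_eq : ∀ q, inner ℝ n (Φ q) = q.2
  map_one : Φ (0, 1) = n

/-- Take any linear isometry from $\mathbb R^m\times\mathbb R$ with its $L^2$ norm, then reflect in
the hyperplane orthogonal to $v-n$ to carry the image $v$ of the last axis to $n$. Isometries
preserve volume. -/
theorem exists_isSplitting {n : Eucl (m + 1)} (hn : ‖n‖ = 1) : ∃ Φ, IsSplitting n Φ := by
  have hfin : Module.finrank ℝ (WithLp 2 (Eucl m × ℝ)) = m + 1 := by
    rw [(WithLp.linearEquiv 2 ℝ (Eucl m × ℝ)).finrank_eq]
    simp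
  have e₀ : WithLp 2 (Eucl m × ℝ) ≃ₗᵢ[ℝ] Eucl (m + 1) :=
    ((stdOrthonormalBasis ℝ (WithLp 2 (Eucl m × ℝ))).reindex (finCongr hfin)).repr
  set v := e₀ (WithLp.toLp 2 (0, 1)) with hv
  have hvn : ‖v‖ = ‖n‖ := by rw [hv, e₀.norm_map, hn]; simp
  set e : WithLp 2 (Eucl m × ℝ) ≃ₗᵢ[ℝ] Eucl (m + 1) :=
    e₀.trans (Submodule.reflection (ℝ ∙ (v - n))ᗮ) with he
  have hen : e (WithLp.toLp 2 (0, 1)) = n := by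
    simp only [he, LinearIsometryEquiv.trans_apply, ← hv]
    exact Submodule.reflection_sub hvn
  set Φ : (Eucl m × ℝ) ≃L[ℝ] Eucl (m + 1) :=
    (WithLp.prodContinuousLinearEquiv 2 ℝ (Eucl m) ℝ).symm.trans e.toContinuousLinearEquiv with hΦ
  have hΦe : ∀ q, Φ q = e (WithLp.toLp 2 q) := fun q => rfl
  refine ⟨Φ, ?_, fun q => ?_, fun q => ?_, ?_⟩
  · exact e.measurePreserving.comp (WithLp.volume_preserving_toLp (Eucl m) ℝ)
  · rw [hΦe, e.norm_map, WithLp.prod_norm_sq_eq_of_L2]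
    simp
  · rw [hΦe, ← hen, e.inner_map_map, WithLp.prod_inner_apply]
    simp
  · rw [hΦe, hen]

namespace IsSplitting

variable {n : Eucl (m + 1)} {Φ : (Eucl m × ℝ) ≃L[ℝ] Eucl (m + 1)}

theorem norm_fst_le (h : IsSplitting n Φ) (q : Eucl m × ℝ) : ‖q.1‖ ≤ ‖Φ q‖ := by
  refine le_of_sq_le_sq ?_ (norm_nonneg _)
  rw [h.norm_sq]
  nlinarith

theorem abs_snd_le (h : IsSplitting n Φ) (q : Eucl m × ℝ) : |q.2| ≤ ‖Φ q‖ := by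
  refine le_of_sq_le_sq ?_ (norm_nonneg _)
  rw [h.norm_sq, sq_abs]
  nlinarith [sq_nonneg ‖q.1‖]

theorem norm_le (h : IsSplitting n Φ) (q : Eucl m × ℝ) : ‖Φ q‖ ≤ ‖q.1‖ + |q.2| := by
  refine le_of_sq_le_sq ?_ (by positivity)
  rw [h.norm_sq, add_sq, sq_abs]
  nlinarith [mul_nonneg (norm_nonneg q.1) (abs_nonneg q.2)]

theorem lipschitzWith_fst_symm (h : IsSplitting n Φ) :
    LipschitzWith 1 (fun y => (Φ.symm y).1) := by
  refine LipschitzWith.of_dist_le_mul fun y y' => ?_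
  rw [dist_eq_norm, dist_eq_norm, NNReal.coe_one, one_mul]
  have := h.norm_fst_le (Φ.symm (y - y'))
  rwa [Φ.apply_symm_apply, map_sub] at this

end IsSplitting

/-- In the coordinates `Φ`, the set `Ω` is the region below the graph of the Lipschitz function
`γ` over the ball of radius `a` around `z₀`, within height `2 * a` of `t₀`. -/
structure IsGraphChart (Ω : Set (Eucl (m + 1))) (Φ : (Eucl m × ℝ) ≃L[ℝ] Eucl (m + 1))
    (z₀ : Eucl m) (t₀ a : ℝ) (K : ℝ≥0) (γ : Eucl m → ℝ) : Prop where
  abs_sub_le : ∀ z ∈ Metric.ball z₀ a, |γ z - t₀| ≤ a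
  mem_frontier : ∀ z ∈ Metric.ball z₀ a, Φ (z, γ z) ∈ frontier Ω
  mem_interior : ∀ z ∈ Metric.ball z₀ a, ∀ t, t₀ - 2 * a < t → t < γ z → Φ (z, t) ∈ interior Ω
  notMem : ∀ z ∈ Metric.ball z₀ a, ∀ t, γ z < t → t < t₀ + 2 * a → Φ (z, t) ∉ Ω
  lipschitzOnWith : LipschitzOnWith K (fun z => Φ (z, γ z)) (Metric.ball z₀ a)

/-- A closed set with the cone property at a boundary point has a graph chart there. -/
theorem exists_isGraphChart {Ω : Set (Eucl (m + 1))} (hΩ : IsClosed Ω) {n : Eucl (m + 1)}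
    {Φ : (Eucl m × ℝ) ≃L[ℝ] Eucl (m + 1)} (hΦ : IsSplitting n Φ) {z₀ : Eucl m} {t₀ a ε : ℝ}
    (ha : 0 < a) (hε : 0 < ε) (hε' : ε ≤ 1 / 2) (hx : Φ (z₀, t₀) ∈ frontier Ω)
    (hcone : ∀ y ∈ Metric.ball (Φ (z₀, t₀)) (4 * a), ∀ y' ∈ Metric.ball (Φ (z₀, t₀)) (4 * a),
      ε * ‖y - y'‖ < inner ℝ n (y - y') → y ∈ Ω → y' ∈ interior Ω) :
    ∃ γ, IsGraphChart Ω Φ z₀ t₀ a (Real.toNNReal (1 - ε)⁻¹) γ := by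
  have hxΩ : Φ (z₀, t₀) ∈ Ω := hΩ.frontier_subset hx
  have hsub : ∀ z z' t t', Φ (z, t) - Φ (z', t') = Φ (z - z', t - t') := fun z z' t t' => by
    rw [← map_sub]; rfl
  have hball : ∀ z ∈ Metric.ball z₀ a, ∀ t, |t - t₀| < 2 * a →
      Φ (z, t) ∈ Metric.ball (Φ (z₀, t₀)) (4 * a) := by
    intro z hz t ht
    rw [mem_ball_iff_norm] at hz ⊢
    rw [hsub]
    have := hΦ.norm_le (z - z₀, t - t₀)
    simp only at this
    linarith
  have hx' : Φ (z₀, t₀) ∈ Metric.ball (Φ (z₀, t₀)) (4 * a) :=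
    Metric.mem_ball_self (by positivity)
  have hdown : ∀ z ∈ Metric.ball z₀ a, ∀ s t, |s - t₀| < 2 * a → |t - t₀| < 2 * a → s < t →
      Φ (z, t) ∈ Ω → Φ (z, s) ∈ interior Ω := by
    intro z hz s t hs ht hst hmem
    refine hcone _ (hball z hz t ht) _ (hball z hz s hs) ?_ hmem
    rw [hsub, hΦ.inner_eq]
    have := hΦ.norm_le (z - z, t - s)
    simp only [sub_self, norm_zero, zero_add, abs_of_pos (sub_pos.2 hst)] at this
    rw [sub_self]
    nlinarith [norm_nonneg (Φ (0, t - s))]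
  -- Comparison with the boundary point itself: since $\|z-z_0\|<a$ and $\varepsilon\le1/2$, the
  -- point at height $t_0-a$ lies in its downward cone. Symmetrically, in `htop`, a point of
  -- $\Omega$ at height at least $t_0+a$ would make the boundary point interior.
  have hbot : ∀ z ∈ Metric.ball z₀ a, Φ (z, t₀ - a) ∈ Ω := by
    intro z hz
    refine interior_subset (hcone _ hx' _ (hball z hz _ ?_) ?_ hxΩ)
    · rw [sub_sub_cancel_left, abs_neg, abs_of_pos ha]; linarith
    · rw [hsub, hΦ.inner_eq]
      have := hΦ.norm_le (z₀ - z, t₀ - (t₀ - a))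
      simp only [sub_sub_cancel, abs_of_pos ha] at this
      rw [mem_ball_iff_norm, norm_sub_rev] at hz
      simp only [sub_sub_cancel]
      nlinarith [norm_nonneg (Φ (z₀ - z, a))]
  have htop : ∀ z ∈ Metric.ball z₀ a, ∀ t, t₀ + a ≤ t → t < t₀ + 2 * a → Φ (z, t) ∉ Ω := by
    intro z hz t ht1 ht2 hmem
    refine hx.2 (hcone _ (hball z hz t (by rw [abs_of_pos] <;> linarith)) _ hx' ?_ hmem)
    rw [hsub, hΦ.inner_eq]
    have := hΦ.norm_le (z - z₀, t - t₀)
    simp only [abs_of_pos (show 0 < t - t₀ by linarith)] at this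
    rw [mem_ball_iff_norm] at hz
    simp only
    nlinarith [norm_nonneg (Φ (z - z₀, t - t₀))]
  -- The graph function is the largest height at which the vertical line meets $\Omega$ in the
  -- compact window $[t_0-a,t_0+a]$.
  have hγ : ∀ z ∈ Metric.ball z₀ a, ∃ s : ℝ, |s - t₀| ≤ a ∧ Φ (z, s) ∈ Ω ∧
      ∀ t, s < t → t < t₀ + 2 * a → Φ (z, t) ∉ Ω := by
    intro z hz
    set S := Set.Icc (t₀ - a) (t₀ + a) ∩ (fun t => Φ (z, t)) ⁻¹' Ω with hS
    have hSc : IsCompact S := isCompact_Icc.inter_right (hΩ.preimage (by fun_prop))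
    have hSne : S.Nonempty := ⟨t₀ - a, ⟨le_rfl, by linarith⟩, hbot z hz⟩
    obtain ⟨s, hsS, hs⟩ := hSc.exists_isGreatest hSne
    refine ⟨s, abs_le.2 ⟨by linarith [hsS.1.1], by linarith [hsS.1.2]⟩, hsS.2,
      fun t hst ht hmem => ?_⟩
    rcases le_or_gt (t₀ + a) t with h | h
    · exact htop z hz t h ht hmem
    · exact hst.not_ge (hs ⟨⟨by linarith [hsS.1.1], h.le⟩, hmem⟩)
  choose! γ hγ1 hγ2 hγ3 using hγ
  have hγlt : ∀ z ∈ Metric.ball z₀ a, |γ z - t₀| < 2 * a := fun z hz => by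
    linarith [hγ1 z hz]
  have hfr : ∀ z ∈ Metric.ball z₀ a, Φ (z, γ z) ∈ frontier Ω := by
    intro z hz
    refine ⟨subset_closure (hγ2 z hz), fun hInt => ?_⟩
    have hc : ContinuousAt (fun t => Φ (z, t)) (γ z) := by fun_prop
    have h1 : ∀ᶠ t in 𝓝[>] (γ z), Φ (z, t) ∈ Ω :=
      ((hc.eventually_mem (isOpen_interior.mem_nhds hInt)).filter_mono nhdsWithin_le_nhds).mono
        fun t ht => interior_subset ht
    have h2 : ∀ᶠ t in 𝓝[>] (γ z), t < t₀ + 2 * a :=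
      (gt_mem_nhds (by linarith [(abs_lt.1 (hγlt z hz)).2])).filter_mono nhdsWithin_le_nhds
    obtain ⟨t, ht1, ht2, ht3⟩ := (h1.and (h2.and self_mem_nhdsWithin)).exists
    exact hγ3 z hz t ht3 ht2 ht1
  refine ⟨γ, hγ1, hfr, fun z hz t ht1 ht2 => ?_, hγ3, ?_⟩
  · have h1 := hγ1 z hz
    rw [abs_le] at h1
    exact hdown z hz t (γ z) (abs_lt.2 ⟨by linarith, by linarith⟩) (hγlt z hz) ht2 (hγ2 z hz)
  · have hε1 : (0 : ℝ) < 1 - ε := by linarith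
    refine LipschitzOnWith.of_dist_le_mul fun z hz z' hz' => ?_
    rw [dist_eq_norm, dist_eq_norm, Real.coe_toNNReal _ (inv_nonneg.2 hε1.le), hsub]
    -- Two boundary points cannot lie in each other's cones, so $|\gamma z-\gamma z'|\le\varepsilon
    -- D$ with $D$ their distance. Combined with $D\le\|z-z'\|+|\gamma z-\gamma z'|$ this gives the
    -- constant $(1-\varepsilon)^{-1}$, which tends to 1 with $\varepsilon\to0$.
    have hone : ∀ z ∈ Metric.ball z₀ a, ∀ z' ∈ Metric.ball z₀ a,
        γ z - γ z' ≤ ε * ‖Φ (z - z', γ z - γ z')‖ := by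
      intro z hz z' hz'
      by_contra! hcon
      refine (hfr z' hz').2 (hcone _ (hball z hz _ (hγlt z hz)) _ (hball z' hz' _ (hγlt z' hz')) ?_
        (hγ2 z hz))
      rwa [hsub, hΦ.inner_eq]
    have h1 := hone z hz z' hz'
    have h2 := hone z' hz' z hz
    rw [← neg_sub z z', ← neg_sub (γ z) (γ z'), ← Prod.neg_mk, map_neg, norm_neg] at h2
    have h3 : |γ z - γ z'| ≤ ε * ‖Φ (z - z', γ z - γ z')‖ := abs_le.2 ⟨by linarith, h1⟩
    have h4 := hΦ.norm_le (z - z', γ z - γ z')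
    simp only at h4
    rw [inv_mul_eq_div, le_div_iff₀ hε1]
    linarith

end Charts

/-! ### Volume and surface integrals in a graph chart -/

section ChartIntegrals

open scoped NNReal MeasureTheory Measure

variable {m : ℕ} {Ω : Set (Eucl (m + 1))} {n : Eucl (m + 1)}
  {Φ : (Eucl m × ℝ) ≃L[ℝ] Eucl (m + 1)} {z₀ : Eucl m} {t₀ a : ℝ} {K : ℝ≥0} {γ : Eucl m → ℝ}

/-- The fundamental theorem of calculus along a vertical line: inside the support of $w$ the slice
of $\Omega$ ends at height $\gamma z$, and the lower endpoint contributes nothing because $w$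
vanishes there. -/
theorem IsGraphChart.integral_slice (hΩ : IsClosed Ω) (hΦ : IsSplitting n Φ)
    (hγ : IsGraphChart Ω Φ z₀ t₀ a K γ) (ha : 0 < a) {w : Eucl (m + 1) → ℝ} (hw : ContDiff ℝ ∞ w)
    (hs : tsupport w ⊆ Metric.ball (Φ (z₀, t₀)) a) {z : Eucl m} (hz : z ∈ Metric.ball z₀ a) :
    ∫ t, Ω.indicator (fun y => fderiv ℝ w y n) (Φ (z, t)) = w (Φ (z, γ z)) := by
  have hout : ∀ t, a ≤ |t - t₀| → Φ (z, t) ∉ tsupport w := by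
    intro t ht hmem
    have h1 := hs hmem
    rw [mem_ball_iff_norm, ← map_sub] at h1
    have := hΦ.abs_snd_le ((z, t) - (z₀, t₀))
    simp only [Prod.snd_sub] at this
    linarith
  have hzero : ∀ t, a ≤ |t - t₀| → fderiv ℝ w (Φ (z, t)) n = 0 := fun t ht =>
    image_eq_zero_of_notMem_tsupport (f := fun x => fderiv ℝ w x n) fun h' =>
      hout t ht (tsupport_fderiv_apply_subset ℝ n h')
  have hγ1 := abs_le.1 (hγ.abs_sub_le z hz)
  have hEq : (fun t => Ω.indicator (fun y => fderiv ℝ w y n) (Φ (z, t))) =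
      (Set.Ioc (t₀ - 2 * a) (γ z)).indicator (fun t => fderiv ℝ w (Φ (z, t)) n) := by
    ext t
    by_cases h1 : t ≤ t₀ - 2 * a
    · rw [Set.indicator_of_notMem (fun h : t ∈ Set.Ioc (t₀ - 2 * a) (γ z) => h.1.not_ge h1)]
      refine Set.indicator_apply_eq_zero.2 fun _ => hzero t ?_
      rw [abs_sub_comm, abs_of_nonneg] <;> linarith
    rw [not_le] at h1
    rcases lt_trichotomy t (γ z) with h2 | h2 | h2
    · rw [Set.indicator_of_mem (interior_subset (hγ.mem_interior z hz t h1 h2)),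
        Set.indicator_of_mem (show t ∈ Set.Ioc (t₀ - 2 * a) (γ z) from ⟨h1, h2.le⟩)]
    · rw [Set.indicator_of_mem (show t ∈ Set.Ioc (t₀ - 2 * a) (γ z) from ⟨h1, h2.le⟩),
        Set.indicator_of_mem]
      rw [h2]
      exact hΩ.frontier_subset (hγ.mem_frontier z hz)
    · rw [Set.indicator_of_notMem (fun h : t ∈ Set.Ioc (t₀ - 2 * a) (γ z) => h.2.not_gt h2)]
      by_cases h3 : t < t₀ + 2 * a
      · rw [Set.indicator_of_notMem (hγ.notMem z hz t h2 h3)]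
      · refine Set.indicator_apply_eq_zero.2 fun _ => hzero t ?_
        rw [abs_of_nonneg] <;> linarith
  have hline : ∀ t, HasDerivAt (fun t => w (Φ (z, t))) (fderiv ℝ w (Φ (z, t)) n) t := by
    intro t
    have h1 : HasDerivAt (fun t : ℝ => Φ (z, t)) n t := by
      have h2 : HasDerivAt (fun t : ℝ => (z, t)) ((0 : Eucl m), (1 : ℝ)) t :=
        (hasDerivAt_const t z).prodMk (hasDerivAt_id t)
      have := Φ.hasFDerivAt.comp_hasDerivAt t h2
      rw [← hΦ.map_one]
      exact this
    exact ((hw.differentiable (by simp)).differentiableAt.hasFDerivAt).comp_hasDerivAt t h1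
  rw [hEq, integral_indicator measurableSet_Ioc, ← intervalIntegral.integral_of_le (by linarith),
    intervalIntegral.integral_eq_sub_of_hasDerivAt (fun t _ => hline t)]
  · rw [image_eq_zero_of_notMem_tsupport (hout (t₀ - 2 * a) _), sub_zero]
    rw [sub_sub_cancel_left, abs_neg, abs_of_pos] <;> linarith
  · refine Continuous.intervalIntegrable ?_ _ _
    exact (continuous_fderiv_apply_of_contDiff hw n).comp (by fun_prop)

/-- The integral of the normal derivative over `Ω`, in a graph chart. -/
theorem IsGraphChart.integral_fderiv (hΩ : IsClosed Ω) (hΦ : IsSplitting n Φ)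
    (hγ : IsGraphChart Ω Φ z₀ t₀ a K γ) (ha : 0 < a) {w : Eucl (m + 1) → ℝ} (hw : ContDiff ℝ ∞ w)
    (hs : tsupport w ⊆ Metric.ball (Φ (z₀, t₀)) a) :
    ∫ y in Ω, fderiv ℝ w y n = ∫ z in Metric.ball z₀ a, w (Φ (z, γ z)) := by
  have hc : HasCompactSupport w := (isCompact_closedBall (Φ (z₀, t₀)) a).of_isClosed_subset
    (isClosed_tsupport _) (hs.trans Metric.ball_subset_closedBall)
  have hi : Integrable (Ω.indicator (fun y => fderiv ℝ w y n)) volume :=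
    ((continuous_fderiv_apply_of_contDiff hw n).integrable_of_hasCompactSupport
      (hc.fderiv_apply ℝ n)).indicator hΩ.measurableSet
  have hme : MeasurableEmbedding Φ := Φ.toHomeomorph.measurableEmbedding
  rw [← integral_indicator hΩ.measurableSet, ← hΦ.measurePreserving.integral_comp hme,
    Measure.volume_eq_prod, integral_prod, ← integral_indicator Metric.isOpen_ball.measurableSet]
  · refine integral_congr_ae (.of_forall fun z => ?_)
    by_cases hz : z ∈ Metric.ball z₀ a
    · simp only [Set.indicator_of_mem hz]
      exact hγ.integral_slice hΩ hΦ ha hw hs hz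
    · simp only [Set.indicator_of_notMem hz]
      refine integral_eq_zero_of_ae (.of_forall fun t => ?_)
      refine Set.indicator_apply_eq_zero.2 fun _ => ?_
      refine image_eq_zero_of_notMem_tsupport (f := fun x => fderiv ℝ w x n) fun h' => hz ?_
      have h1 := hs (tsupport_fderiv_apply_subset ℝ n h')
      rw [mem_ball_iff_norm, ← map_sub] at h1
      have := hΦ.norm_fst_le ((z, t) - (z₀, t₀))
      rw [mem_ball_iff_norm]
      simp only [Prod.fst_sub] at this
      linarith
  · rw [← Measure.volume_eq_prod]
    exact hΦ.measurePreserving.integrable_comp_of_integrable hi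

/-- The part of the boundary seen by a graph chart. -/
theorem IsGraphChart.image_eq (hΩ : IsClosed Ω) (hγ : IsGraphChart Ω Φ z₀ t₀ a K γ) (ha : 0 < a) :
    (fun z => Φ (z, γ z)) '' Metric.ball z₀ a = frontier Ω ∩ {y | (Φ.symm y).1 ∈ Metric.ball z₀ a ∧
      |(Φ.symm y).2 - t₀| < 2 * a} := by
  ext y
  constructor
  · rintro ⟨z, hz, rfl⟩
    refine ⟨hγ.mem_frontier z hz, ?_⟩
    simp only [Set.mem_ofPred_eq, Φ.symm_apply_apply]
    exact ⟨hz, (hγ.abs_sub_le z hz).trans_lt (by linarith)⟩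
  · rintro ⟨hy, hy1, hy2⟩
    refine ⟨(Φ.symm y).1, hy1, ?_⟩
    have hΦy : Φ ((Φ.symm y).1, (Φ.symm y).2) = y := Φ.apply_symm_apply y
    rw [abs_lt] at hy2
    rcases lt_trichotomy (Φ.symm y).2 (γ (Φ.symm y).1) with h | h | h
    · have := hγ.mem_interior _ hy1 _ (by linarith) h
      rw [hΦy] at this
      exact absurd this hy.2
    · simp only [← h, hΦy]
    · have := hγ.notMem _ hy1 _ h (by linarith)
      rw [hΦy] at this
      exact absurd (hΩ.frontier_subset hy) this

theorem IsGraphChart.frontier_inter_ball_subset (hΩ : IsClosed Ω) (hΦ : IsSplitting n Φ)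
    (hγ : IsGraphChart Ω Φ z₀ t₀ a K γ) (ha : 0 < a) :
    frontier Ω ∩ Metric.ball (Φ (z₀, t₀)) a ⊆ (fun z => Φ (z, γ z)) '' Metric.ball z₀ a := by
  rw [hγ.image_eq hΩ ha]
  rintro y ⟨hy, hyb⟩
  rw [mem_ball_iff_norm] at hyb
  have e : Φ (Φ.symm y - (z₀, t₀)) = y - Φ (z₀, t₀) := by rw [map_sub, Φ.apply_symm_apply]
  have h1 := hΦ.norm_fst_le (Φ.symm y - (z₀, t₀))
  have h2 := hΦ.abs_snd_le (Φ.symm y - (z₀, t₀))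
  rw [e] at h1 h2
  refine ⟨hy, ?_, ?_⟩
  · rw [mem_ball_iff_norm]
    exact h1.trans_lt hyb
  · exact h2.trans_lt (by linarith)

theorem IsGraphChart.hausdorffMeasure_image_le (hγ : IsGraphChart Ω Φ z₀ t₀ a K γ)
    {A : Set (Eucl m)} (hA : A ⊆ Metric.ball z₀ a) :
    μH[m] ((fun z => Φ (z, γ z)) '' A) ≤ (K : ℝ≥0∞) ^ m * μH[m] A := by
  simpa using (hγ.lipschitzOnWith.mono hA).hausdorffMeasure_image_le (d := m) (by positivity)

/-- Projection to the base is 1-Lipschitz and inverts the graph map, so it cannot increase Hausdorff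
measure. -/
theorem IsGraphChart.le_hausdorffMeasure_image (hΦ : IsSplitting n Φ) (A : Set (Eucl m)) :
    μH[m] A ≤ μH[m] ((fun z => Φ (z, γ z)) '' A) := by
  have := hΦ.lipschitzWith_fst_symm.hausdorffMeasure_image_le (d := m) (by positivity)
    ((fun z => Φ (z, γ z)) '' A)
  rw [Set.image_image] at this
  simpa using this

/-- Surface integrals in a graph chart are comparable with integrals over the base. -/
theorem IsGraphChart.lintegral_bounds (hΩ : IsClosed Ω) (hΦ : IsSplitting n Φ)
    (hγ : IsGraphChart Ω Φ z₀ t₀ a K γ) (ha : 0 < a) {f : Eucl (m + 1) → ℝ≥0∞}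
    (hf : Continuous f) (hs : ∀ y ∉ Metric.ball (Φ (z₀, t₀)) a, f y = 0) :
    (∫⁻ z in Metric.ball z₀ a, f (Φ (z, γ z)) ∂μH[m] ≤ ∫⁻ y in frontier Ω, f y ∂μH[m]) ∧
    ∫⁻ y in frontier Ω, f y ∂μH[m] ≤
      (K : ℝ≥0∞) ^ m * ∫⁻ z in Metric.ball z₀ a, f (Φ (z, γ z)) ∂μH[m] := by
  set Γ : Eucl m → Eucl (m + 1) := fun z => Φ (z, γ z) with hΓ
  set p : Eucl (m + 1) → Eucl m := fun y => (Φ.symm y).1 with hp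
  have hpc : Continuous p := by fun_prop
  set D := Metric.ball z₀ a with hD
  have hDm : MeasurableSet D := Metric.isOpen_ball.measurableSet
  have hpΓ : ∀ z, p (Γ z) = z := fun z => by simp [hp, hΓ]
  -- The image of the graph map is measurable because it is cut out of the closed frontier by open
  -- conditions.
  have hΓD : MeasurableSet (Γ '' D) := by
    rw [hΓ, hγ.image_eq hΩ ha]
    refine isClosed_frontier.measurableSet.inter (IsOpen.measurableSet ?_)
    refine (Metric.isOpen_ball.preimage hpc).inter ?_
    have hc : Continuous fun y => |(Φ.symm y).2 - t₀| := by fun_prop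
    exact isOpen_lt hc continuous_const
  -- Projecting the surface measure to the base yields $\nu$, squeezed between the base Hausdorff
  -- measure on $D$ and $K^m$ times it; both bounds on integrals follow from this.
  set ν : Measure (Eucl m) := (μH[m].restrict (Γ '' D)).map p with hν
  have hνA : ∀ A, MeasurableSet A → ν A = μH[m] (Γ '' (D ∩ A)) := by
    intro A hA
    rw [hν, Measure.map_apply hpc.measurable hA,
      Measure.restrict_apply (hpc.measurable hA)]
    congr 1
    ext y
    constructor
    · rintro ⟨h1, z, hz, rfl⟩
      exact ⟨z, ⟨hz, by simpa [hpΓ] using h1⟩, rfl⟩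
    · rintro ⟨z, hz, rfl⟩
      exact ⟨by simpa [hpΓ] using hz.2, z, hz.1, rfl⟩
  have hle1 : μH[m].restrict D ≤ ν := by
    refine Measure.le_iff.2 fun A hA => ?_
    rw [hνA A hA, Measure.restrict_apply hA, Set.inter_comm]
    exact IsGraphChart.le_hausdorffMeasure_image hΦ _
  have hle2 : ν ≤ (K : ℝ≥0∞) ^ m • μH[m].restrict D := by
    refine Measure.le_iff.2 fun A hA => ?_
    rw [hνA A hA, Measure.smul_apply, Measure.restrict_apply hA, Set.inter_comm A D, smul_eq_mul]
    exact hγ.hausdorffMeasure_image_le Set.inter_subset_left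
  have hfΓ : AEMeasurable (fun z => f (Γ z)) ν := by
    have h1 : AEMeasurable (fun z => f (Γ z)) (μH[m].restrict D) :=
      (hf.comp_continuousOn hγ.lipschitzOnWith.continuousOn).aemeasurable hDm
    exact h1.mono_ac ((Measure.absolutelyContinuous_of_le hle2).trans
      (Measure.smul_absolutelyContinuous))
  have hkey : ∫⁻ y in frontier Ω, f y ∂μH[m] = ∫⁻ z, f (Γ z) ∂ν := by
    rw [hν, lintegral_map' hfΓ hpc.aemeasurable]
    have h1 : ∫⁻ y in Γ '' D, f (Γ (p y)) ∂μH[m] = ∫⁻ y in Γ '' D, f y ∂μH[m] := by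
      refine setLIntegral_congr_fun hΓD ?_
      rintro _ ⟨z, hz, rfl⟩
      simp only [hpΓ]
    rw [h1]
    have hsub : Γ '' D ⊆ frontier Ω := by
      rintro _ ⟨z, hz, rfl⟩
      exact hγ.mem_frontier z hz
    rw [← lintegral_indicator hΓD, ← lintegral_indicator isClosed_frontier.measurableSet]
    refine lintegral_congr fun y => ?_
    by_cases hy : y ∈ Γ '' D
    · rw [Set.indicator_of_mem hy, Set.indicator_of_mem (hsub hy)]
    · rw [Set.indicator_of_notMem hy]
      refine Set.indicator_apply_eq_zero.2 fun hyf => hs y fun hyb => hy ?_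
      exact hγ.frontier_inter_ball_subset hΩ hΦ ha ⟨hyf, hyb⟩
  rw [hkey]
  refine ⟨lintegral_mono' hle1 le_rfl, ?_⟩
  rw [← smul_eq_mul, ← lintegral_smul_measure]
  exact lintegral_mono' hle2 le_rfl

/-- The ratio between Hausdorff measure and Lebesgue measure in dimension `m`. -/
theorem exists_hausdorffMeasure_eq_smul (m : ℕ) :
    ∃ κ : ℝ≥0, 0 < κ ∧ (μH[m] : Measure (Eucl m)) = κ • volume := by
  have : Measure.IsAddHaarMeasure (μH[m] : Measure (Eucl m)) := by
    simpa using MeasureTheory.isAddHaarMeasure_hausdorffMeasure (E := EuclideanSpace ℝ (Fin m))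
  exact ⟨Measure.addHaarScalarFactor μH[m] volume,
    Measure.addHaarScalarFactor_pos_of_isAddHaarMeasure _ _,
    Measure.isAddLeftInvariant_eq_smul _ _⟩

end ChartIntegrals

/-! ### The divergence theorem -/

section Divergence

open scoped NNReal MeasureTheory Measure Manifold

/-- If small translations in the direction `-v` keep `Ω ∩ tsupport w` inside `Ω`, then the integral
over `Ω` of the derivative of `w ≥ 0` in the direction `v` is nonnegative. -/
theorem setIntegral_fderiv_nonneg {d : ℕ} {Ω : Set (Eucl d)} (hΩ : IsCompact Ω) {w : Eucl d → ℝ}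
    (hw : ContDiff ℝ ∞ w) (hc : HasCompactSupport w) (hw0 : ∀ y, 0 ≤ w y) {v : Eucl d}
    (hpush : ∀ᶠ t : ℝ in 𝓝[>] 0, ∀ y ∈ Ω, y ∈ tsupport w → y - t • v ∈ Ω) :
    0 ≤ ∫ y in Ω, fderiv ℝ w y v := by
  have hfc := continuous_fderiv_apply_of_contDiff hw v
  obtain ⟨M, hM⟩ := hfc.bounded_above_of_compact_support (hc.fderiv_apply ℝ v)
  obtain ⟨M', hM'⟩ := hw.continuous.bounded_above_of_compact_support hc
  have : IsFiniteMeasure (volume.restrict Ω) := ⟨by simpa using hΩ.measure_lt_top⟩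
  have hline : ∀ y (t : ℝ), HasDerivAt (fun t : ℝ => w (y + t • v))
      (fderiv ℝ w (y + t • v) v) t := by
    intro y t
    have h1 : HasDerivAt (fun t : ℝ => y + t • v) v t := by
      simpa using ((hasDerivAt_id t).smul_const v).const_add y
    exact ((hw.differentiable (by simp)).differentiableAt.hasFDerivAt).comp_hasDerivAt t h1
  -- The integral in question is the derivative at $t=0$ of $t\mapsto\int_\Omega w(y+tv)\,dy$, so it
  -- suffices that its right difference quotients are nonnegative.
  have hder := (hasDerivAt_integral_of_dominated_loc_of_deriv_le (μ := volume.restrict Ω)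
    (F := fun (t : ℝ) y => w (y + t • v)) (F' := fun t y => fderiv ℝ w (y + t • v) v) (x₀ := 0)
    (s := Set.univ) (bound := fun _ => M) univ_mem
    (.of_forall fun t => (hw.continuous.comp (by fun_prop)).aestronglyMeasurable)
    (Integrable.of_bound (hw.continuous.comp (by fun_prop)).aestronglyMeasurable M'
      (.of_forall fun y => hM' _))
    (hfc.comp (by fun_prop)).aestronglyMeasurable
    (.of_forall fun y t _ => hM _) (integrable_const _)
    (.of_forall fun y t _ => hline y t)).2
  simp only [zero_smul, add_zero] at hder
  refine ge_of_tendsto hder.tendsto_slope_zero_right ?_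
  filter_upwards [hpush, self_mem_nhdsWithin] with t ht ht0
  have ht0' : (0 : ℝ) < t := ht0
  refine smul_nonneg (inv_nonneg.2 ht0'.le) (sub_nonneg.2 ?_)
  simp only [zero_add, zero_smul, add_zero]
  -- After the shift the integral runs over $\Omega+tv$, which contains
  -- $\Omega\cap\operatorname{supp}w$ by the translation hypothesis; nonnegativity of $w$ gives the
  -- comparison.
  have e : ∫ y in Ω, w (y + t • v) = ∫ y, Ω.indicator (fun _ => w y) (y - t • v) := by
    rw [← integral_indicator hΩ.measurableSet, ← integral_sub_right_eq_self _ (t • v)]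
    refine integral_congr_ae (.of_forall fun y => ?_)
    by_cases h : y - t • v ∈ Ω <;> simp [h]
  rw [e, ← integral_indicator hΩ.measurableSet]
  have hwi := hw.continuous.integrable_of_hasCompactSupport hc (μ := volume)
  refine integral_mono (hwi.indicator hΩ.measurableSet) ?_ fun y => ?_
  · have hm : MeasurableSet {y | y - t • v ∈ Ω} :=
      (hΩ.isClosed.preimage (by fun_prop : Continuous fun y : Eucl d => y - t • v)).measurableSet
    exact hwi.indicator hm
  · by_cases hy : y ∈ Ω
    · rw [Set.indicator_of_mem hy]
      by_cases hy' : y ∈ tsupport w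
      · rw [Set.indicator_of_mem (ht y hy hy')]
      · rw [image_eq_zero_of_notMem_tsupport hy']
        simp
    · rw [Set.indicator_of_notMem hy]
      exact Set.indicator_nonneg (fun _ _ => hw0 y) _

theorem surfaceMeasure_eq {m : ℕ} (Ω : Set (Eucl (m + 1))) :
    surfaceMeasure Ω = μH[m].restrict (frontier Ω) := by
  simp [surfaceMeasure]

variable {m : ℕ} {Ω : Set (Eucl (m + 1))}

theorem aestronglyMeasurable_inner_outwardNormal (hΩ : IsSmoothCompactDomain Ω)
    (e : Eucl (m + 1)) :
    AEStronglyMeasurable (fun y => inner ℝ (outwardNormal Ω y) e) (surfaceMeasure Ω) := by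
  refine ContinuousOn.aestronglyMeasurable ?_ isClosed_frontier.measurableSet
  exact hΩ.continuousOn_outwardNormal.inner continuousOn_const

theorem abs_inner_outwardNormal_le (hΩ : IsSmoothCompactDomain Ω) {e y : Eucl (m + 1)}
    (he : ‖e‖ = 1) (hy : y ∈ frontier Ω) : |inner ℝ (outwardNormal Ω y) e| ≤ (1 : ℝ) := by
  simpa [hΩ.norm_outwardNormal hy, he] using abs_real_inner_le_norm (outwardNormal Ω y) e

theorem ae_surfaceMeasure_mem_frontier (Ω : Set (Eucl (m + 1))) :
    ∀ᵐ y ∂(surfaceMeasure Ω), y ∈ frontier Ω :=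
  ae_restrict_mem isClosed_frontier.measurableSet

/-- In a graph chart, volume and surface integrals of the normal derivative are comparable. -/
theorem IsGraphChart.integral_bounds {n : Eucl (m + 1)}
    {Φ : (Eucl m × ℝ) ≃L[ℝ] Eucl (m + 1)} {z₀ : Eucl m} {t₀ a : ℝ} {K : ℝ≥0} {γ : Eucl m → ℝ}
    (hΩ : IsClosed Ω) (hΦ : IsSplitting n Φ)
    (hγ : IsGraphChart Ω Φ z₀ t₀ a K γ) (ha : 0 < a) {κ : ℝ≥0}
    (hκ : (μH[m] : Measure (Eucl m)) = κ • volume) {w : Eucl (m + 1) → ℝ} (hw : ContDiff ℝ ∞ w)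
    (hw0 : ∀ y, 0 ≤ w y) (hs : tsupport w ⊆ Metric.ball (Φ (z₀, t₀)) a) :
    Integrable w (surfaceMeasure Ω) ∧
    κ * ∫ y in Ω, fderiv ℝ w y n ≤ ∫ y, w y ∂(surfaceMeasure Ω) ∧
    ∫ y, w y ∂(surfaceMeasure Ω) ≤ (K : ℝ) ^ m * (κ * ∫ y in Ω, fderiv ℝ w y n) := by
  have hc : HasCompactSupport w := (isCompact_closedBall (Φ (z₀, t₀)) a).of_isClosed_subset
    (isClosed_tsupport _) (hs.trans Metric.ball_subset_closedBall)
  obtain ⟨M, hM⟩ := hw.continuous.bounded_above_of_compact_support hc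
  have hmeas : AEStronglyMeasurable (fun z => w (Φ (z, γ z)))
      (volume.restrict (Metric.ball z₀ a)) :=
    (hw.continuous.comp_continuousOn hγ.lipschitzOnWith.continuousOn).aestronglyMeasurable
      Metric.isOpen_ball.measurableSet
  have : IsFiniteMeasure (volume.restrict (Metric.ball z₀ a)) :=
    ⟨by simpa using Metric.isBounded_ball.measure_lt_top⟩
  have hi : Integrable (fun z => w (Φ (z, γ z))) (volume.restrict (Metric.ball z₀ a)) :=
    Integrable.of_bound hmeas M (.of_forall fun z => hM _)
  rw [hγ.integral_fderiv hΩ hΦ ha hw hs]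
  set T := ∫ z in Metric.ball z₀ a, w (Φ (z, γ z)) with hT
  have hT0 : 0 ≤ T := integral_nonneg fun z => hw0 _
  have hofT : ENNReal.ofReal T = ∫⁻ z in Metric.ball z₀ a, ENNReal.ofReal (w (Φ (z, γ z))) :=
    ofReal_integral_eq_lintegral_ofReal hi (.of_forall fun z => hw0 _)
  have hb := hγ.lintegral_bounds hΩ hΦ ha (f := fun y => ENNReal.ofReal (w y))
    (ENNReal.continuous_ofReal.comp hw.continuous) (fun y hy => by
      simp [image_eq_zero_of_notMem_tsupport fun h => hy (hs h)])
  rw [hκ, ← surfaceMeasure_eq, Measure.restrict_smul, lintegral_smul_measure, ← hofT] at hb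
  have hκT : κ • ENNReal.ofReal T = ENNReal.ofReal (κ * T) := by
    rw [ENNReal.smul_def, smul_eq_mul, ENNReal.ofReal_mul κ.coe_nonneg, ENNReal.ofReal_coe_nnreal]
  rw [hκT] at hb
  have hKT : (K : ℝ≥0∞) ^ m * ENNReal.ofReal (κ * T) = ENNReal.ofReal ((K : ℝ) ^ m * (κ * T)) := by
    rw [ENNReal.ofReal_mul (p := (K : ℝ) ^ m) (by positivity), ENNReal.ofReal_pow K.coe_nonneg,
      ENNReal.ofReal_coe_nnreal]
  rw [hKT] at hb
  have hwi : Integrable w (surfaceMeasure Ω) := by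
    refine ⟨hw.continuous.aestronglyMeasurable, ?_⟩
    rw [hasFiniteIntegral_iff_ofReal (.of_forall hw0)]
    exact hb.2.trans_lt ENNReal.ofReal_lt_top
  have hofI := ofReal_integral_eq_lintegral_ofReal hwi (.of_forall hw0)
  rw [← hofI] at hb
  exact ⟨hwi, (ENNReal.ofReal_le_ofReal_iff (integral_nonneg hw0)).1 hb.1,
    (ENNReal.ofReal_le_ofReal_iff (by positivity)).1 hb.2⟩

theorem setIntegral_fderiv_linear {w : Eucl (m + 1) → ℝ} (hΩ : IsCompact Ω) (hw : ContDiff ℝ ∞ w)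
    (s t : ℝ) (u v : Eucl (m + 1)) : ∫ y in Ω, fderiv ℝ w y (s • u + t • v) =
      s * (∫ y in Ω, fderiv ℝ w y u) + t * ∫ y in Ω, fderiv ℝ w y v := by
  have hi : ∀ v, IntegrableOn (fun y => fderiv ℝ w y v) Ω volume := fun v =>
    (continuous_fderiv_apply_of_contDiff hw v).continuousOn.integrableOn_compact hΩ
  simp only [map_add, map_smul, smul_eq_mul]
  rw [integral_add ((hi u).const_mul s) ((hi v).const_mul t), integral_const_mul,
    integral_const_mul]

/-- Error bookkeeping with $T$ the normal derivative integral, $T_q$ the tangential one, $I=\int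
w\,dS$, $J$ the flux and $c=\langle n,e\rangle$. The tangential part costs $2\varepsilon I$, the
area distortion $(k-1)I$, and the variation of the normal $\varepsilon I$. -/
theorem abs_flux_sub_le {κ T Tq I J c ε k η : ℝ} (hκ : 0 ≤ κ) (hI : 0 ≤ I)
    (hε : 0 ≤ ε) (hlow : κ * T ≤ I) (hup : I ≤ k * (κ * T)) (hk : 1 ≤ k) (hTq : |Tq| ≤ 2 * ε * T)
    (hc : |c| ≤ 1) (hJ : |c * I - J| ≤ ε * I) (hη : k - 1 + 3 * ε ≤ η) :
    |κ * (c * T + Tq) - J| ≤ η * I := by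
  have d1 : |κ * T - I| ≤ (k - 1) * I := by
    rw [abs_sub_comm, abs_of_nonneg (by linarith)]
    have := mul_le_mul_of_nonneg_left hlow (sub_nonneg.2 hk)
    linarith
  have d2 : |κ * Tq| ≤ 2 * ε * I := by
    rw [abs_mul, abs_of_nonneg hκ]
    have h1 := mul_le_mul_of_nonneg_left hTq hκ
    have h2 := mul_le_mul_of_nonneg_left hlow (mul_nonneg zero_le_two hε)
    linarith
  have d3 : |c * (κ * T - I)| ≤ (k - 1) * I := by
    rw [abs_mul]
    exact (mul_le_of_le_one_left (abs_nonneg _) hc).trans d1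
  have e1 : κ * (c * T + Tq) - J = κ * Tq + c * (κ * T - I) + (c * I - J) := by ring
  rw [e1]
  refine (abs_add_three _ _ _).trans ?_
  have := mul_le_mul_of_nonneg_right hη hI
  linarith

/-- The divergence theorem holds near a boundary point up to an arbitrarily small relative
error. -/
theorem exists_local_flux_estimate (hΩ : IsSmoothCompactDomain Ω) {κ : ℝ≥0}
    (hκ : (μH[m] : Measure (Eucl m)) = κ • volume) {e : Eucl (m + 1)} (he : ‖e‖ = 1)
    {x : Eucl (m + 1)} (hx : x ∈ frontier Ω) {η : ℝ} (hη : 0 < η) :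
    ∃ r > 0, surfaceMeasure Ω (Metric.ball x r) < ⊤ ∧ ∀ w : Eucl (m + 1) → ℝ, ContDiff ℝ ∞ w →
      (∀ y, 0 ≤ w y) → tsupport w ⊆ Metric.ball x r →
      |κ * (∫ y in Ω, fderiv ℝ w y e) -
        ∫ y, w y * inner ℝ (outwardNormal Ω y) e ∂(surfaceMeasure Ω)| ≤
        η * ∫ y, w y ∂(surfaceMeasure Ω) := by
  have hlim : Tendsto (fun ε : ℝ => ((1 - ε)⁻¹) ^ m - 1 + 3 * ε) (𝓝[>] 0) (𝓝 0) := by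
    have : ContinuousAt (fun ε : ℝ => ((1 - ε)⁻¹) ^ m - 1 + 3 * ε) 0 := by
      refine ContinuousAt.add
        (ContinuousAt.sub (ContinuousAt.pow (ContinuousAt.inv₀ ?_ ?_) _) ?_) ?_
      · fun_prop
      · norm_num
      · fun_prop
      · fun_prop
    have h2 := this.tendsto
    simp only [sub_zero, inv_one, one_pow, sub_self, mul_zero, add_zero] at h2
    exact h2.mono_left nhdsWithin_le_nhds
  -- The total relative error will be $K^m-1+3\varepsilon$ with $K=(1-\varepsilon)^{-1}$; it tends
  -- to 0 with $\varepsilon$.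
  obtain ⟨ε, hεη, hε', hε⟩ : ∃ ε : ℝ, ((1 - ε)⁻¹) ^ m - 1 + 3 * ε < η ∧ ε < 1 / 2 ∧ 0 < ε :=
    ((hlim.eventually (gt_mem_nhds hη)).and
      (((gt_mem_nhds (by norm_num : (0 : ℝ) < 1 / 2)).filter_mono
      nhdsWithin_le_nhds).and self_mem_nhdsWithin)).exists
  obtain ⟨r₀, hr₀, hcone⟩ := hΩ.exists_cone hx hε
  obtain ⟨δ, hδ, hnear⟩ := Metric.continuousWithinAt_iff.1 (hΩ.continuousOn_outwardNormal x hx) ε hε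
  have hn := hΩ.norm_outwardNormal hx
  set n := outwardNormal Ω x with hndef
  have hnn : inner ℝ n n = (1 : ℝ) := by rw [real_inner_self_eq_norm_sq, hn]; norm_num
  obtain ⟨Φ, hΦ⟩ := exists_isSplitting hn
  obtain ⟨⟨z₀, t₀⟩, hzt⟩ := Φ.surjective x
  -- The chart uses the cone property on the ball of radius $4a\le r_0$, and on the support of $w$
  -- the normal varies by at most $\varepsilon$ because $a\le\delta$.
  set a := min r₀ δ / 4 with ha'
  have ha : 0 < a := by positivity
  have har : 4 * a ≤ r₀ := by rw [ha']; linarith [min_le_left r₀ δ]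
  have haδ : a ≤ δ := by rw [ha']; linarith [min_le_right r₀ δ]
  have hcone' : ∀ y ∈ Metric.ball x (4 * a), ∀ y' ∈ Metric.ball x (4 * a),
      ε * ‖y - y'‖ < inner ℝ n (y - y') → y ∈ Ω → y' ∈ interior Ω := fun y hy y' hy' =>
    hcone y (Metric.ball_subset_ball har hy) y' (Metric.ball_subset_ball har hy')
  have hcl := hΩ.isCompact.isClosed
  obtain ⟨γ, hγ⟩ := exists_isGraphChart hcl hΦ ha hε hε'.le (hzt ▸ hx) (hzt ▸ hcone')
  have hε1 : (0 : ℝ) < 1 - ε := by linarith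
  set K : ℝ≥0 := Real.toNNReal (1 - ε)⁻¹ with hK
  have hKc : (K : ℝ) = (1 - ε)⁻¹ := Real.coe_toNNReal _ (inv_nonneg.2 hε1.le)
  refine ⟨a, ha, ?_, fun w hw hw0 hs => ?_⟩
  · rw [surfaceMeasure_eq, Measure.restrict_apply Metric.isOpen_ball.measurableSet]
    have h1 := hγ.frontier_inter_ball_subset hcl hΦ ha
    rw [hzt, Set.inter_comm] at h1
    refine ((measure_mono h1).trans (hγ.hausdorffMeasure_image_le subset_rfl)).trans_lt ?_
    rw [hκ, Measure.smul_apply, ENNReal.smul_def, smul_eq_mul]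
    exact ENNReal.mul_lt_top (ENNReal.pow_lt_top ENNReal.coe_lt_top)
      (ENNReal.mul_lt_top ENNReal.coe_lt_top Metric.isBounded_ball.measure_lt_top)
  have hc : HasCompactSupport w := (isCompact_closedBall x a).of_isClosed_subset
    (isClosed_tsupport _) (hs.trans Metric.ball_subset_closedBall)
  obtain ⟨hwi, hlow, hup⟩ := hγ.integral_bounds hcl hΦ ha hκ hw hw0 (hzt ▸ hs)
  set T := ∫ y in Ω, fderiv ℝ w y n with hT
  set I := ∫ y, w y ∂(surfaceMeasure Ω) with hI
  have hκ0 : (0 : ℝ) ≤ κ := κ.coe_nonneg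
  have hI0 : 0 ≤ I := integral_nonneg hw0
  have hpos : ∀ v : Eucl (m + 1), ε * ‖v‖ < inner ℝ n v → 0 ≤ ∫ y in Ω, fderiv ℝ w y v := by
    intro v hv
    refine setIntegral_fderiv_nonneg hΩ.isCompact hw hc hw0 ?_
    have hcont : Tendsto (fun t : ℝ => t * ‖v‖) (𝓝[>] 0) (𝓝 0) := by
      have : ContinuousAt (fun t : ℝ => t * ‖v‖) 0 := by fun_prop
      have h2 := this.tendsto
      rw [zero_mul] at h2
      exact h2.mono_left nhdsWithin_le_nhds
    filter_upwards [hcont.eventually (gt_mem_nhds ha), self_mem_nhdsWithin] with t ht ht0 y hy hyw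
    have ht0' : (0 : ℝ) < t := ht0
    have hyb : ‖y - x‖ < a := mem_ball_iff_norm.1 (hs hyw)
    refine interior_subset (hcone' y (mem_ball_iff_norm.2 (by linarith)) _ ?_ ?_ hy)
    · rw [mem_ball_iff_norm, sub_right_comm]
      refine (norm_sub_le _ _).trans_lt ?_
      rw [norm_smul, Real.norm_of_nonneg ht0'.le]
      linarith
    · rw [sub_sub_cancel, norm_smul, inner_smul_right, Real.norm_of_nonneg ht0'.le]
      nlinarith
  set c : ℝ := inner ℝ n e with hcdef
  have hc1 : |c| ≤ 1 := by simpa [hn, he] using abs_real_inner_le_norm n e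
  set q := e - c • n with hq
  have hnq : inner ℝ n q = (0 : ℝ) := by rw [hq, inner_sub_right, inner_smul_right, hnn]; ring
  have hqn : ‖q‖ ≤ 1 := by
    have h1 : ‖q‖ ^ 2 ≤ 1 ^ 2 := by
      rw [hq, norm_sub_sq_real, norm_smul, hn, he, inner_smul_right, real_inner_comm, ← hcdef,
        Real.norm_eq_abs, mul_one, sq_abs]
      nlinarith
    exact le_of_sq_le_sq h1 zero_le_one
  set Tq := ∫ y in Ω, fderiv ℝ w y q with hTq
  -- Both $2\varepsilon n\pm q$ lie in the cone, as $\varepsilon(2\varepsilon+1)<2\varepsilon$ for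
  -- $\varepsilon<1/2$. Nonnegativity in these two directions bounds the tangential integral by
  -- $2\varepsilon T$.
  have hbound : ∀ s : ℝ, |s| = 1 → 0 ≤ 2 * ε * T + s * Tq := by
    intro s hs1
    rw [← setIntegral_fderiv_linear hΩ.isCompact hw]
    refine hpos _ ?_
    have h1 : ‖(2 * ε) • n + s • q‖ ≤ 2 * ε + 1 := by
      refine (norm_add_le _ _).trans ?_
      rw [norm_smul, norm_smul, hn, Real.norm_of_nonneg (by positivity), Real.norm_eq_abs, hs1]
      linarith
    rw [inner_add_right, inner_smul_right, inner_smul_right, hnn, hnq]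
    nlinarith
  have hTqb : |Tq| ≤ 2 * ε * T := by
    have h1 := hbound 1 (by simp)
    have h2 := hbound (-1) (by simp)
    exact abs_le.2 ⟨by linarith, by linarith⟩
  have hTe : ∫ y in Ω, fderiv ℝ w y e = c * T + Tq := by
    have h1 : e = c • n + (1 : ℝ) • q := by rw [hq]; simp
    rw [h1, setIntegral_fderiv_linear hΩ.isCompact hw, one_mul]
  set J := ∫ y, w y * inner ℝ (outwardNormal Ω y) e ∂(surfaceMeasure Ω) with hJ
  have hJi : Integrable (fun y => w y * inner ℝ (outwardNormal Ω y) e) (surfaceMeasure Ω) := by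
    refine hwi.mono' (hwi.aestronglyMeasurable.mul
      (aestronglyMeasurable_inner_outwardNormal hΩ e)) ?_
    filter_upwards [ae_surfaceMeasure_mem_frontier Ω] with y hy
    rw [Real.norm_eq_abs, abs_mul, abs_of_nonneg (hw0 y)]
    exact mul_le_of_le_one_right (hw0 y) (abs_inner_outwardNormal_le hΩ he hy)
  have hJI : |c * I - J| ≤ ε * I := by
    rw [← Real.norm_eq_abs, hI, hJ, ← integral_const_mul, ← integral_const_mul,
      ← integral_sub (hwi.const_mul c) hJi]
    refine norm_integral_le_of_norm_le (hwi.const_mul ε) ?_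
    filter_upwards [ae_surfaceMeasure_mem_frontier Ω] with y hy
    by_cases hyb : y ∈ Metric.ball x a
    · have h1 : ‖n - outwardNormal Ω y‖ ≤ ε := by
        have := hnear hy (lt_of_lt_of_le hyb haδ)
        rw [dist_eq_norm, norm_sub_rev] at this
        exact this.le
      have h2 : c * w y - w y * inner ℝ (outwardNormal Ω y) e =
          w y * inner ℝ (n - outwardNormal Ω y) e := by
        rw [inner_sub_left, ← hcdef]; ring
      rw [h2, Real.norm_eq_abs, abs_mul, abs_of_nonneg (hw0 y), mul_comm ε]
      refine mul_le_mul_of_nonneg_left ?_ (hw0 y)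
      have := abs_real_inner_le_norm (n - outwardNormal Ω y) e
      rw [he, mul_one] at this
      exact this.trans h1
    · have : w y = 0 := image_eq_zero_of_notMem_tsupport fun h => hyb (hs h)
      simp [this]
  rw [hTe]
  have hK1 : 1 ≤ (K : ℝ) ^ m := by
    rw [hKc]
    refine one_le_pow₀ ((one_le_inv₀ hε1).2 (by linarith))
  rw [hKc] at hK1 hup
  exact abs_flux_sub_le hκ0 hI0 hε.le hlow hup hK1 hTqb hc1 hJI hεη.le

end Divergence

/-! ### From local flux estimates to the global divergence theorem -/

section DivergenceGlobal

open scoped NNReal MeasureTheory Measure Manifold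

variable {m : ℕ} {Ω : Set (Eucl (m + 1))}

/-- Compactness of the frontier and the local finiteness contained in the flux estimate; the
direction and the tolerance chosen there play no role. -/
theorem IsSmoothCompactDomain.isFiniteMeasure_surfaceMeasure (hΩ : IsSmoothCompactDomain Ω) :
    IsFiniteMeasure (surfaceMeasure Ω) := by
  obtain ⟨κ, -, hκ⟩ := exists_hausdorffMeasure_eq_smul m
  have hcompact : IsCompact (frontier Ω) :=
    hΩ.isCompact.of_isClosed_subset isClosed_frontier hΩ.frontier_subset
  have hlt : surfaceMeasure Ω (frontier Ω) < ⊤ := by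
    refine hcompact.measure_lt_top_of_nhdsWithin fun x hx => ?_
    obtain ⟨r, hr, hfin, -⟩ := exists_local_flux_estimate hΩ hκ
      (e := EuclideanSpace.single 0 1) (by simp) hx zero_lt_one
    exact ⟨_, mem_nhdsWithin_of_mem_nhds (Metric.ball_mem_nhds x hr), hfin⟩
  refine ⟨?_⟩
  rw [surfaceMeasure, Measure.restrict_apply_self] at hlt
  rwa [surfaceMeasure, Measure.restrict_apply_univ]

/-- The defect in the divergence theorem for the vector field `w • e`. -/
def fluxDefect (Ω : Set (Eucl (m + 1))) (κ : ℝ) (e : Eucl (m + 1)) (w : Eucl (m + 1) → ℝ) : ℝ :=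
  κ * (∫ y in Ω, fderiv ℝ w y e) -
    ∫ y, w y * inner ℝ (outwardNormal Ω y) e ∂(surfaceMeasure Ω)

theorem integrable_surfaceMeasure (hΩ : IsSmoothCompactDomain Ω) {w : Eucl (m + 1) → ℝ}
    (hw : Continuous w) : Integrable w (surfaceMeasure Ω) := by
  have := hΩ.isFiniteMeasure_surfaceMeasure
  obtain ⟨M, hM⟩ := hΩ.isCompact.exists_bound_of_continuousOn hw.continuousOn
  refine Integrable.of_bound hw.aestronglyMeasurable M ?_
  filter_upwards [ae_surfaceMeasure_mem_frontier Ω] with y hy using hM y (hΩ.frontier_subset hy)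

theorem integrable_mul_inner_outwardNormal (hΩ : IsSmoothCompactDomain Ω) {e : Eucl (m + 1)}
    (he : ‖e‖ = 1) {w : Eucl (m + 1) → ℝ} (hw : Integrable w (surfaceMeasure Ω)) :
    Integrable (fun y => w y * inner ℝ (outwardNormal Ω y) e) (surfaceMeasure Ω) := by
  refine hw.norm.mono' (hw.aestronglyMeasurable.mul
    (aestronglyMeasurable_inner_outwardNormal hΩ e)) ?_
  filter_upwards [ae_surfaceMeasure_mem_frontier Ω] with y hy
  rw [norm_mul]
  exact mul_le_of_le_one_right (norm_nonneg _) (abs_inner_outwardNormal_le hΩ he hy)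

theorem fluxDefect_sum (hΩ : IsSmoothCompactDomain Ω) {κ : ℝ} {e : Eucl (m + 1)} (he : ‖e‖ = 1)
    {ι : Type*} (s : Finset ι) {w : ι → Eucl (m + 1) → ℝ} (hw : ∀ i, ContDiff ℝ ∞ (w i)) :
    fluxDefect Ω κ e (fun y => ∑ i ∈ s, w i y) = ∑ i ∈ s, fluxDefect Ω κ e (w i) := by
  have hd : ∀ y, fderiv ℝ (fun y => ∑ i ∈ s, w i y) y e = ∑ i ∈ s, fderiv ℝ (w i) y e := by
    intro y
    rw [fderiv_fun_sum fun i _ => ((hw i).differentiable (by simp)).differentiableAt]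
    simp
  simp only [fluxDefect, hd, Finset.sum_mul, Finset.sum_sub_distrib]
  rw [integral_finsetSum _ fun i _ =>
      (continuous_fderiv_apply_of_contDiff (hw i) e).continuousOn.integrableOn_compact hΩ.isCompact,
    integral_finsetSum _ fun i _ => integrable_mul_inner_outwardNormal hΩ he
      (integrable_surfaceMeasure hΩ (hw i).continuous), Finset.mul_sum]

theorem fluxDefect_eq_zero_of_disjoint_frontier (hΩ : IsSmoothCompactDomain Ω) {κ : ℝ}
    {e : Eucl (m + 1)} {w : Eucl (m + 1) → ℝ} (hw : ContDiff ℝ ∞ w) (hc : HasCompactSupport w)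
    (hs : tsupport w ⊆ interior Ω ∨ tsupport w ⊆ Ωᶜ) : fluxDefect Ω κ e w = 0 := by
  have h1 : ∫ y in Ω, fderiv ℝ w y e = 0 := by
    rcases hs with hs | hs
    · rw [setIntegral_eq_of_tsupport_subset hs fun x hx => image_eq_zero_of_notMem_tsupport
        (f := fun x => fderiv ℝ w x e) fun h' => hx (tsupport_fderiv_apply_subset ℝ e h')]
      have hfi : Integrable (fun x => fderiv ℝ w x e) volume :=
        (continuous_fderiv_apply_of_contDiff hw e).integrable_of_hasCompactSupport
          (hc.fderiv_apply ℝ e)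
      have hwi : Integrable w volume := hw.continuous.integrable_of_hasCompactSupport hc
      -- Integration by parts against the constant 1.
      simpa using integral_mul_fderiv_eq_neg_fderiv_mul_of_integrable (μ := volume)
        (f := fun _ : Eucl (m + 1) => (1 : ℝ)) (g := w) (v := e) (by simp) (by simpa using hfi)
        (by simpa using hwi) (fun x _ => differentiableAt_const _)
        (fun x _ => (hw.differentiable (by simp)).differentiableAt)
    · refine setIntegral_eq_zero_of_forall_eq_zero fun x hx => image_eq_zero_of_notMem_tsupport
        (f := fun x => fderiv ℝ w x e) fun h' => hs (tsupport_fderiv_apply_subset ℝ e h') hx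
  have h2 : ∫ y, w y * inner ℝ (outwardNormal Ω y) e ∂(surfaceMeasure Ω) = 0 := by
    refine integral_eq_zero_of_ae ?_
    filter_upwards [ae_surfaceMeasure_mem_frontier Ω] with y hy
    have : w y = 0 := image_eq_zero_of_notMem_tsupport fun h => by
      rcases hs with hs | hs
      · exact hy.2 (hs h)
      · exact hs h (hΩ.frontier_subset hy)
    simp [this]
  rw [fluxDefect, h1, h2]
  ring

/-- Cut $w$ by a partition of unity subordinate to neighbourhoods where the relative error is at
most $\eta$. The pieces are nonnegative and their surface integrals sum to $\int w\,dS$, so the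
total defect is at most $\eta\int w\,dS$ however many pieces there are; then $\eta\to0$. -/
theorem fluxDefect_eq_zero_of_nonneg (hΩ : IsSmoothCompactDomain Ω) {κ : ℝ≥0}
    (hκ : (μH[m] : Measure (Eucl m)) = κ • volume) {e : Eucl (m + 1)} (he : ‖e‖ = 1)
    {w : Eucl (m + 1) → ℝ} (hw : ContDiff ℝ ∞ w) (hc : HasCompactSupport w) (hw0 : ∀ y, 0 ≤ w y) :
    fluxDefect Ω κ e w = 0 := by
  set I := ∫ y, w y ∂(surfaceMeasure Ω) with hI
  have hI0 : 0 ≤ I := integral_nonneg hw0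
  have key : ∀ η : ℝ, 0 < η → |fluxDefect Ω κ e w| ≤ η * I := by
    intro η hη
    have hU : ∀ x : Eucl (m + 1), ∃ U : Set (Eucl (m + 1)), IsOpen U ∧ x ∈ U ∧
        ∀ v : Eucl (m + 1) → ℝ, ContDiff ℝ ∞ v → HasCompactSupport v → (∀ y, 0 ≤ v y) →
        tsupport v ⊆ U → |fluxDefect Ω κ e v| ≤ η * ∫ y, v y ∂(surfaceMeasure Ω) := by
      intro x
      have htriv : ∀ v : Eucl (m + 1) → ℝ, (∀ y, 0 ≤ v y) → fluxDefect Ω κ e v = 0 →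
          |fluxDefect Ω κ e v| ≤ η * ∫ y, v y ∂(surfaceMeasure Ω) := by
        intro v hv0 hv
        rw [hv, abs_zero]
        exact mul_nonneg hη.le (integral_nonneg hv0)
      by_cases hxi : x ∈ interior Ω
      · exact ⟨interior Ω, isOpen_interior, hxi, fun v hv hvc hv0 hvs => htriv v hv0
          (fluxDefect_eq_zero_of_disjoint_frontier hΩ hv hvc (.inl hvs))⟩
      by_cases hxΩ : x ∈ Ω
      · obtain ⟨r, hr, -, hest⟩ := exists_local_flux_estimate hΩ hκ he
          (x := x) ⟨subset_closure hxΩ, hxi⟩ hη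
        exact ⟨_, Metric.isOpen_ball, Metric.mem_ball_self hr,
          fun v hv _ hv0 hvs => hest v hv hv0 hvs⟩
      · exact ⟨Ωᶜ, hΩ.isCompact.isClosed.isOpen_compl, hxΩ, fun v hv hvc hv0 hvs => htriv v hv0
          (fluxDefect_eq_zero_of_disjoint_frontier hΩ hv hvc (.inr hvs))⟩
    choose U hUo hxU hest using hU
    obtain ⟨t, ht⟩ := hc.isCompact.elim_finite_subcover U hUo
      (fun x _ => Set.mem_iUnion.2 ⟨x, hxU x⟩)
    obtain ⟨f, hf⟩ := SmoothPartitionOfUnity.exists_isSubordinate 𝓘(ℝ, Eucl (m + 1))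
      (isClosed_tsupport w) (fun i : t => U i) (fun i => hUo i) (by
        intro x hx
        obtain ⟨i, hi, hxi⟩ := Set.mem_iUnion₂.1 (ht hx)
        exact Set.mem_iUnion.2 ⟨⟨i, hi⟩, hxi⟩)
    have hsum : w = fun y => ∑ i : t, f i y * w y := by
      ext y
      rw [← Finset.sum_mul]
      by_cases hy : y ∈ tsupport w
      · have := f.sum_eq_one hy
        rw [finsum_eq_sum_of_fintype] at this
        rw [this, one_mul]
      · rw [image_eq_zero_of_notMem_tsupport hy, mul_zero]
    have hsm : ∀ i : t, ContDiff ℝ ∞ (fun y => f i y * w y) := fun i =>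
      (f i).contMDiff.contDiff.mul hw
    have h1 : fluxDefect Ω κ e w = ∑ i : t, fluxDefect Ω κ e (fun y => f i y * w y) := by
      rw [← fluxDefect_sum hΩ he _ hsm, ← hsum]
    have h2 : I = ∑ i : t, ∫ y, f i y * w y ∂(surfaceMeasure Ω) := by
      rw [← integral_finsetSum _ fun i _ => integrable_surfaceMeasure hΩ (hsm i).continuous,
        ← hsum]
    rw [h1, h2, Finset.mul_sum]
    refine (Finset.abs_sum_le_sum_abs _ _).trans (Finset.sum_le_sum fun i _ => ?_)
    exact hest i _ (hsm i) hc.mul_left (fun y => mul_nonneg (f.nonneg i y) (hw0 y))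
      (tsupport_mul_subset_left.trans (hf i))
  have hlim : Tendsto (fun η : ℝ => η * I) (𝓝[>] 0) (𝓝 0) := by
    have : ContinuousAt (fun η : ℝ => η * I) 0 := by fun_prop
    have h2 := this.tendsto
    rw [zero_mul] at h2
    exact h2.mono_left nhdsWithin_le_nhds
  refine abs_nonpos_iff.1 (ge_of_tendsto hlim ?_)
  filter_upwards [self_mem_nhdsWithin] with η hη using key η hη

/-- The divergence theorem on a smooth domain, for vector fields with a constant direction. -/
theorem fluxDefect_eq_zero (hΩ : IsSmoothCompactDomain Ω) {κ : ℝ≥0}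
    (hκ : (μH[m] : Measure (Eucl m)) = κ • volume) {e : Eucl (m + 1)} (he : ‖e‖ = 1)
    {w : Eucl (m + 1) → ℝ} (hw : ContDiff ℝ ∞ w) : fluxDefect Ω κ e w = 0 := by
  obtain ⟨χ, hχ, hχc, -, hχ1, hχ01⟩ := exists_smooth_cutoff hΩ.isCompact isOpen_univ
    (Set.subset_univ Ω)
  have hχw : ContDiff ℝ ∞ fun y => χ y * w y := hχ.mul hw
  have hχwc : HasCompactSupport fun y => χ y * w y := hχc.mul_right
  -- To remove the sign condition, write $\chi w=M\psi-(M\psi-\chi w)$ with $\psi=1$ on the support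
  -- of $\chi$ and $M\ge|\chi w|$: both terms are smooth, compactly supported and nonnegative.
  obtain ⟨ψ, hψ, hψc, -, hψ1, hψ01⟩ := exists_smooth_cutoff hχc.isCompact isOpen_univ
    (Set.subset_univ _)
  obtain ⟨M, hM⟩ := hχw.continuous.bounded_above_of_compact_support hχwc
  have hM0 : 0 ≤ M := (norm_nonneg _).trans (hM 0)
  have hs1 : ContDiff ℝ ∞ fun y => M * ψ y := contDiff_const.mul hψ
  have z1 : fluxDefect Ω κ e (fun y => M * ψ y) = 0 :=
    fluxDefect_eq_zero_of_nonneg hΩ hκ he hs1 hψc.mul_left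
      fun y => mul_nonneg hM0 (hψ01 y).1
  have hs2 : ContDiff ℝ ∞ fun y => M * ψ y - χ y * w y := hs1.sub hχw
  have z2 : fluxDefect Ω κ e (fun y => M * ψ y - χ y * w y) = 0 := by
    refine fluxDefect_eq_zero_of_nonneg hΩ hκ he hs2 (hψc.mul_left.sub hχwc) fun y => ?_
    by_cases hy : y ∈ tsupport χ
    · have h1 : ψ y = 1 := (eventually_nhdsSet_iff_forall.1 hψ1 y hy).self_of_nhds
      rw [h1, mul_one, sub_nonneg]
      exact (le_abs_self _).trans (hM y)
    · rw [image_eq_zero_of_notMem_tsupport hy, zero_mul, sub_zero]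
      exact mul_nonneg hM0 (hψ01 y).1
  have hsum := fluxDefect_sum hΩ (κ := κ) he (Finset.univ : Finset (Fin 2))
    (w := ![fun y => M * ψ y - χ y * w y, fun y => χ y * w y])
    (by intro i; fin_cases i; exacts [hs2, hχw])
  simp only [Fin.sum_univ_two, Matrix.cons_val_zero, Matrix.cons_val_one, sub_add_cancel, z1, z2,
    zero_add] at hsum
  have hloc : ∀ y ∈ Ω, (fun y => χ y * w y) =ᶠ[𝓝 y] w := fun y hy => by
    filter_upwards [eventually_nhdsSet_iff_forall.1 hχ1 y hy] with z hz
    rw [hz, one_mul]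
  have e1 : ∫ y in Ω, fderiv ℝ w y e = ∫ y in Ω, fderiv ℝ (fun y => χ y * w y) y e :=
    setIntegral_congr_fun hΩ.isCompact.measurableSet fun y hy => by
      simp only [(hloc y hy).fderiv_eq]
  have e2 : ∫ y, w y * inner ℝ (outwardNormal Ω y) e ∂(surfaceMeasure Ω) =
      ∫ y, χ y * w y * inner ℝ (outwardNormal Ω y) e ∂(surfaceMeasure Ω) := by
    refine integral_congr_ae ?_
    filter_upwards [ae_surfaceMeasure_mem_frontier Ω] with y hy
    have := (hloc y (hΩ.frontier_subset hy)).self_of_nhds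
    simp only at this
    rw [this]
  rw [fluxDefect, e1, e2]
  exact hsum.symm

end DivergenceGlobal

/-! ### Integration by parts for traces -/

section Trace

open scoped NNReal MeasureTheory Measure

theorem integral_mul_eq_inner_toLp {α : Type*} [MeasurableSpace α] {μ : Measure α} {f g : α → ℝ}
    (hf : MemLp f 2 μ) (hg : MemLp g 2 μ) :
    ∫ x, f x * g x ∂μ = inner ℝ (hf.toLp f) (hg.toLp g) := by
  rw [L2.inner_def]
  refine integral_congr_ae ?_
  filter_upwards [hf.coeFn_toLp, hg.coeFn_toLp] with x h1 h2
  simp [h1, h2, mul_comm]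

/-- The integral of a product is the $L^2$ inner product, which is jointly continuous. -/
theorem tendsto_integral_mul_of_tendsto_eLpNorm {α : Type*} [MeasurableSpace α] {μ : Measure α}
    {f g : α → ℝ} {fn gn : ℕ → α → ℝ} (hf : MemLp f 2 μ) (hg : MemLp g 2 μ)
    (hfn : ∀ n, MemLp (fn n) 2 μ) (hgn : ∀ n, MemLp (gn n) 2 μ)
    (hfl : Tendsto (fun n => eLpNorm (fun x => fn n x - f x) 2 μ) atTop (𝓝 0))
    (hgl : Tendsto (fun n => eLpNorm (fun x => gn n x - g x) 2 μ) atTop (𝓝 0)) :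
    Tendsto (fun n => ∫ x, fn n x * gn n x ∂μ) atTop (𝓝 (∫ x, f x * g x ∂μ)) := by
  have h1 : Tendsto (fun n => (hfn n).toLp (fn n)) atTop (𝓝 (hf.toLp f)) :=
    (Lp.tendsto_Lp_iff_tendsto_eLpNorm'' fn hfn f hf).2 hfl
  have h2 : Tendsto (fun n => (hgn n).toLp (gn n)) atTop (𝓝 (hg.toLp g)) :=
    (Lp.tendsto_Lp_iff_tendsto_eLpNorm'' gn hgn g hg).2 hgl
  rw [integral_mul_eq_inner_toLp hf hg]
  simp only [fun n => integral_mul_eq_inner_toLp (hfn n) (hgn n)]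
  exact h1.inner h2

theorem memLp_of_continuous_of_isCompact {d : ℕ} {Ω : Set (Eucl d)} (hΩ : IsCompact Ω)
    {f : Eucl d → ℝ} (hf : Continuous f) (μ : Measure (Eucl d)) [IsFiniteMeasure μ]
    (hμ : ∀ᵐ x ∂μ, x ∈ Ω) : MemLp f 2 μ := by
  obtain ⟨M, hM⟩ := hΩ.exists_bound_of_continuousOn hf.continuousOn
  exact MemLp.of_bound hf.aestronglyMeasurable M (hμ.mono fun x hx => hM x hx)

theorem memLp_apply {d : ℕ} {μ : Measure (Eucl d)} {G : Eucl d → Eucl d} (hG : MemLp G 2 μ)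
    (j : Fin d) : MemLp (fun x => G x j) 2 μ :=
  hG.mono ((by fun_prop : Continuous fun y : Eucl d => y j).comp_aestronglyMeasurable
    hG.aestronglyMeasurable) (.of_forall fun x => PiLp.norm_apply_le (G x) j)

theorem gradient_apply {d : ℕ} (w : Eucl d → ℝ) (x : Eucl d) (j : Fin d) :
    gradient w x j = fderiv ℝ w x (EuclideanSpace.single j 1) := by
  have : inner ℝ (gradient w x) (EuclideanSpace.single j 1) =
      fderiv ℝ w x (EuclideanSpace.single j 1) := by simp [gradient]
  rw [← this, EuclideanSpace.inner_single_right]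
  simp

theorem ae_abs_outwardNormal_apply_le {m : ℕ} {Ω : Set (Eucl (m + 1))}
    (hΩ : IsSmoothCompactDomain Ω) (j : Fin (m + 1)) :
    ∀ᵐ x ∂(surfaceMeasure Ω), |outwardNormal Ω x j| ≤ 1 := by
  filter_upwards [ae_surfaceMeasure_mem_frontier Ω] with x hx
  exact (PiLp.norm_apply_le (outwardNormal Ω x) j).trans (hΩ.norm_outwardNormal hx).le

theorem memLp_mul_outwardNormal {m : ℕ} {Ω : Set (Eucl (m + 1))} (hΩ : IsSmoothCompactDomain Ω)
    {f : Eucl (m + 1) → ℝ} (hf : MemLp f 2 (surfaceMeasure Ω)) (j : Fin (m + 1)) :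
    MemLp (fun x => f x * outwardNormal Ω x j) 2 (surfaceMeasure Ω) := by
  have hnm : AEStronglyMeasurable (fun x => outwardNormal Ω x j) (surfaceMeasure Ω) := by
    simpa [EuclideanSpace.inner_single_right] using
      aestronglyMeasurable_inner_outwardNormal hΩ (EuclideanSpace.single j 1)
  refine hf.mono (hf.aestronglyMeasurable.mul hnm) ?_
  filter_upwards [ae_abs_outwardNormal_apply_le hΩ j] with x hx
  rw [norm_mul]
  exact mul_le_of_le_one_right (norm_nonneg _) hx

/-- Integration by parts for functions with boundary traces. -/
theorem integral_mul_of_isTrace {m : ℕ} {Ω : Set (Eucl (m + 1))} (hΩ : IsSmoothCompactDomain Ω)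
    {κ : ℝ≥0} (hκ : (μH[m] : Measure (Eucl m)) = κ • volume) {u v tu tv : Eucl (m + 1) → ℝ}
    (hu : MemH1 Ω u) (hv : MemH1 Ω v) (htu : IsTrace Ω u tu) (htv : IsTrace Ω v tv)
    (j : Fin (m + 1)) :
    κ * (∫ x in Ω, (weakGrad Ω u x j * v x + u x * weakGrad Ω v x j)) =
      ∫ x, tu x * (tv x * outwardNormal Ω x j) ∂(surfaceMeasure Ω) := by
  obtain ⟨htu2, a, ha, hau, hagu, hat⟩ := htu
  obtain ⟨htv2, b, hb, hbv, hbgv, hbt⟩ := htv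
  have hfinσ := hΩ.isFiniteMeasure_surfaceMeasure
  have hfinΩ : IsFiniteMeasure (volume.restrict Ω) := ⟨by simpa using hΩ.isCompact.measure_lt_top⟩
  set e : Eucl (m + 1) := EuclideanSpace.single j 1 with he
  have hen : ‖e‖ = 1 := by simp [he]
  have hne : ∀ x, inner ℝ (outwardNormal Ω x) e = outwardNormal Ω x j := fun x => by
    simp [he, EuclideanSpace.inner_single_right]
  have hΩae : ∀ᵐ x ∂(volume.restrict Ω), x ∈ Ω := ae_restrict_mem hΩ.isCompact.measurableSet
  have hσae : ∀ᵐ x ∂(surfaceMeasure Ω), x ∈ Ω :=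
    (ae_surfaceMeasure_mem_frontier Ω).mono fun x hx => hΩ.frontier_subset hx
  have hcomp : ∀ {w : ℕ → Eucl (m + 1) → ℝ} {G : Eucl (m + 1) → Eucl (m + 1)},
      Tendsto (fun n => eLpNorm (fun x => gradient (w n) x - G x) 2 (volume.restrict Ω)) atTop
        (𝓝 0) →
      Tendsto (fun n => eLpNorm (fun x => fderiv ℝ (w n) x e - G x j) 2 (volume.restrict Ω)) atTop
        (𝓝 0) := by
    intro w G h
    refine tendsto_of_tendsto_of_tendsto_of_le_of_le tendsto_const_nhds h (fun _ => zero_le)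
      fun n => eLpNorm_mono fun x => ?_
    rw [he, ← gradient_apply, ← PiLp.sub_apply]
    exact PiLp.norm_apply_le _ j
  have hcΩ : ∀ {f : Eucl (m + 1) → ℝ}, Continuous f → MemLp f 2 (volume.restrict Ω) := fun hf =>
    memLp_of_continuous_of_isCompact hΩ.isCompact hf _ hΩae
  have hcσ : ∀ {f : Eucl (m + 1) → ℝ}, Continuous f → MemLp f 2 (surfaceMeasure Ω) := fun hf =>
    memLp_of_continuous_of_isCompact hΩ.isCompact hf _ hσae
  have hda := fun n => continuous_fderiv_apply_of_contDiff (ha n) e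
  have hdb := fun n => continuous_fderiv_apply_of_contDiff (hb n) e
  have l1 := tendsto_integral_mul_of_tendsto_eLpNorm (memLp_apply hu.2.2 j) hv.1
    (fun n => hcΩ (hda n)) (fun n => hcΩ (hb n).continuous) (hcomp hagu) hbv
  have l2 := tendsto_integral_mul_of_tendsto_eLpNorm hu.1 (memLp_apply hv.2.2 j)
    (fun n => hcΩ (ha n).continuous) (fun n => hcΩ (hdb n)) hau (hcomp hbgv)
  have l3 := tendsto_integral_mul_of_tendsto_eLpNorm htu2 (memLp_mul_outwardNormal hΩ htv2 j)
    (fun n => hcσ (ha n).continuous)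
    (fun n => memLp_mul_outwardNormal hΩ (hcσ (hb n).continuous) j) hat
    (tendsto_of_tendsto_of_tendsto_of_le_of_le tendsto_const_nhds hbt (fun _ => zero_le)
      fun n => eLpNorm_mono_ae (by
        filter_upwards [ae_abs_outwardNormal_apply_le hΩ j] with x hx
        rw [← sub_mul, norm_mul]
        exact mul_le_of_le_one_right (norm_nonneg _) hx))
  -- The smooth divergence theorem for the product of the two approximating sequences; every term is
  -- an $L^2$ pairing of convergent sequences, so the identity survives in the limit.
  have hsum : ∀ n, κ * ((∫ x in Ω, fderiv ℝ (a n) x e * b n x) +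
      ∫ x in Ω, a n x * fderiv ℝ (b n) x e) =
      ∫ x, a n x * (b n x * outwardNormal Ω x j) ∂(surfaceMeasure Ω) := by
    intro n
    have h0 := fluxDefect_eq_zero hΩ hκ hen ((ha n).mul (hb n))
    rw [fluxDefect, sub_eq_zero] at h0
    have e1 : ∫ x in Ω, fderiv ℝ (fun y => a n y * b n y) x e =
        (∫ x in Ω, fderiv ℝ (a n) x e * b n x) + ∫ x in Ω, a n x * fderiv ℝ (b n) x e := by
      rw [← integral_add]
      · refine integral_congr_ae (.of_forall fun x => ?_)
        simp only [fderiv_mul_apply' (ha n) (hb n)]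
        ring
      · exact (hcΩ ((hda n).mul (hb n).continuous)).integrable (by norm_num)
      · exact (hcΩ ((ha n).continuous.mul (hdb n))).integrable (by norm_num)
    rw [← e1, h0]
    simp only [hne, mul_assoc]
  have l4 := (l1.add l2).const_mul (κ : ℝ)
  simp only [hsum] at l4
  rw [tendsto_nhds_unique l3 l4, integral_add]
  · exact (memLp_apply hu.2.2 j).integrable_mul hv.1
  · exact hu.1.integrable_mul (memLp_apply hv.2.2 j)

/-- Vector fields in the Stein class of `μ` satisfy `∫ div (μ φ) = 0`. -/
theorem MemSteinClass.sum_integral_eq_zero {d : ℕ} {Ω : Set (Eucl d)}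
    (hΩ : IsSmoothCompactDomain Ω) {μ : Measure (Eucl d)} (hμ : MemH1 Ω (density μ))
    {φ : Eucl d → Eucl d} (hφ : MemSteinClass Ω μ φ) :
    ∑ j, ∫ x in Ω, (weakGrad Ω (density μ) x j * φ x j +
      density μ x * weakGrad Ω (fun y => φ y j) x j) = 0 := by
  cases d with
  -- In dimension zero the sum is empty; the surface calculus is set up only in dimension $m+1$.
  | zero => simp
  | succ m =>
    obtain ⟨κ, hκ0, hκ⟩ := exists_hausdorffMeasure_eq_smul m
    obtain ⟨hφ1, tμ, tφ, htμ, htφ, hInt⟩ := hφ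
    -- The normalization of Hausdorff measure enters only as a nonzero factor, and the flux is zero,
    -- so it cancels.
    have hκ0' : (κ : ℝ) ≠ 0 := by exact_mod_cast hκ0.ne'
    refine (mul_eq_zero.1 ?_ : (κ : ℝ) = 0 ∨ _).resolve_left hκ0'
    rw [Finset.mul_sum, ← hInt]
    simp only [fun j => integral_mul_of_isTrace hΩ hκ hμ (hφ1 j) htμ (htφ j) j]
    have hi : ∀ j, Integrable (fun x => tμ x * (tφ x j * outwardNormal Ω x j))
        (surfaceMeasure Ω) := fun j =>
      htμ.1.integrable_mul (memLp_mul_outwardNormal hΩ (htφ j).1 j)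
    rw [← integral_finsetSum _ fun j _ => hi j]
    refine integral_congr_ae (.of_forall fun x => ?_)
    simp [PiLp.inner_apply, Finset.mul_sum, mul_comm]

end Trace

/-! ### Weak derivatives of functions in the reproducing kernel Hilbert space -/

/-- A functional that is bounded with respect to a linear map into a Hilbert space is represented
by a vector of that Hilbert space. -/
theorem exists_inner_eq_of_abs_le {V H : Type*} [AddCommGroup V] [Module ℝ V]
    [NormedAddCommGroup H] [InnerProductSpace ℝ H] [CompleteSpace H] (J : V →ₗ[ℝ] H)
    (l : V →ₗ[ℝ] ℝ) {C : ℝ} (hC : 0 ≤ C) (h : ∀ v, |l v| ≤ C * ‖J v‖) :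
    ∃ g : H, ‖g‖ ≤ C ∧ ∀ v, l v = inner ℝ g (J v) := by
  have hker : LinearMap.ker J ≤ LinearMap.ker l := fun v hv => by
    have := h v
    rw [LinearMap.mem_ker.1 hv, norm_zero, mul_zero] at this
    exact abs_nonpos_iff.1 this
  -- The bound lets $l$ descend to the range of $J$, which need not be closed; Hahn–Banach extends
  -- it to $H$ with the same norm before Riesz is applied.
  set l' : LinearMap.range J →ₗ[ℝ] ℝ :=
    (Submodule.liftQ (LinearMap.ker J) l hker) ∘ₗ J.quotKerEquivRange.symm.toLinearMap with hl'
  have hl'J : ∀ v, l' ⟨J v, LinearMap.mem_range_self J v⟩ = l v := by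
    intro v
    have : J.quotKerEquivRange.symm ⟨J v, LinearMap.mem_range_self J v⟩ =
        (LinearMap.ker J).mkQ v := LinearMap.quotKerEquivRange_symm_apply_image J v _
    simp only [hl', LinearMap.comp_apply, LinearEquiv.coe_coe, this]
    simp
  set L : LinearMap.range J →L[ℝ] ℝ := l'.mkContinuous C (by
    rintro ⟨_, v, rfl⟩
    rw [hl'J]
    exact h v)
  obtain ⟨g, hg, hgn⟩ := exists_extension_norm_eq (LinearMap.range J) L
  refine ⟨(InnerProductSpace.toDual ℝ H).symm g, ?_, fun v => ?_⟩
  · rw [LinearIsometryEquiv.norm_map, hgn]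
    exact LinearMap.mkContinuous_norm_le _ hC _
  · rw [InnerProductSpace.toDual_symm_apply, hg ⟨J v, LinearMap.mem_range_self J v⟩]
    exact (hl'J v).symm

section RKHSWeakDeriv

variable {d : ℕ} {Ω : Set (Eucl d)} {k : Eucl d → Eucl d → ℝ} {H₀ : Type*}
  [NormedAddCommGroup H₀] [InnerProductSpace ℝ H₀] [RKHS ℝ H₀ Ω ℝ]

/-- The function on `ℝ^d` given by an element of the scalar space, extended by `0`. -/
def toFun₀ (f : H₀) : Eucl d → ℝ := Function.extend Subtype.val (f : Ω → ℝ) 0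

theorem toField_apply (f : ProductRKHS d H₀) (x : Eucl d) (i : Fin d) :
    toField f x i = toFun₀ (f i) x := rfl

theorem toFun₀_of_mem (f : H₀) {x : Eucl d} (hx : x ∈ Ω) : toFun₀ f x = f ⟨x, hx⟩ :=
  Subtype.val_injective.extend_apply (f : Ω → ℝ) 0 ⟨x, hx⟩

theorem toFun₀_of_notMem (f : H₀) {x : Eucl d} (hx : x ∉ Ω) : toFun₀ f x = 0 := by
  rw [toFun₀, Function.extend_apply']
  · rfl
  · rintro ⟨y, rfl⟩
    exact hx y.2

theorem toFun₀_add (f g : H₀) (x : Eucl d) : toFun₀ (f + g) x = toFun₀ f x + toFun₀ g x := by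
  by_cases hx : x ∈ Ω
  · simp [toFun₀_of_mem _ hx]
  · simp [toFun₀_of_notMem _ hx]

theorem toFun₀_smul (c : ℝ) (f : H₀) (x : Eucl d) : toFun₀ (c • f) x = c * toFun₀ f x := by
  by_cases hx : x ∈ Ω
  · simp [toFun₀_of_mem _ hx]
  · simp [toFun₀_of_notMem _ hx]

variable [CompleteSpace H₀]

variable (Ω H₀) in
open Classical in
/-- The kernel sections as elements of the Hilbert space, extended by `0` to `ℝ^d`. -/
def kerVec (x : Eucl d) : H₀ := if h : x ∈ Ω then RKHS.kerFun H₀ (⟨x, h⟩ : Ω) (1 : ℝ) else 0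

theorem inner_kerVec (f : H₀) (x : Eucl d) : inner ℝ f (kerVec Ω H₀ x) = toFun₀ f x := by
  by_cases hx : x ∈ Ω
  · rw [kerVec, dif_pos hx, toFun₀_of_mem _ hx, RKHS.inner_kerFun]
    simp
  · rw [kerVec, dif_neg hx, toFun₀_of_notMem _ hx, inner_zero_right]

theorem toFun₀_kerVec (hH₀ : ∀ x y : Ω, RKHS.kernel H₀ x y 1 = k x y) {x y : Eucl d} (hx : x ∈ Ω)
    (hy : y ∈ Ω) : toFun₀ (kerVec Ω H₀ y) x = k x y := by
  rw [toFun₀_of_mem _ hx, kerVec, dif_pos hy, RKHS.kerFun_apply, hH₀]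

theorem inner_kerVec_kerVec (hH₀ : ∀ x y : Ω, RKHS.kernel H₀ x y 1 = k x y) {x y : Eucl d}
    (hx : x ∈ Ω) (hy : y ∈ Ω) : inner ℝ (kerVec Ω H₀ x) (kerVec Ω H₀ y) = k y x := by
  rw [inner_kerVec, toFun₀_kerVec hH₀ hy hx]

/-- The reproducing property gives $\|k_y-k_x\|^2=k(y,y)-2k(x,y)+k(x,x)$, which is continuous in $y$
and zero at $y=x$. -/
theorem continuousOn_kerVec (hH₀ : ∀ x y : Ω, RKHS.kernel H₀ x y 1 = k x y)
    (hk : ContinuousOn (Function.uncurry k) (Ω ×ˢ Ω)) : ContinuousOn (kerVec Ω H₀) Ω := by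
  intro x hx
  have hsq : ∀ y ∈ Ω, ‖kerVec Ω H₀ y - kerVec Ω H₀ x‖ = √(k y y - 2 * k x y + k x x) := by
    intro y hy
    rw [← inner_kerVec_kerVec hH₀ hy hy, ← inner_kerVec_kerVec hH₀ hy hx,
      ← inner_kerVec_kerVec hH₀ hx hx, real_inner_self_eq_norm_sq, real_inner_self_eq_norm_sq,
      ← norm_sub_sq_real, Real.sqrt_sq (norm_nonneg _)]
  rw [ContinuousWithinAt, tendsto_iff_norm_sub_tendsto_zero]
  have h1 : ContinuousOn (fun y => k y y) Ω :=
    hk.comp (f := fun y => (y, y)) (by fun_prop) fun y hy => ⟨hy, hy⟩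
  have h2 : ContinuousOn (fun y => k x y) Ω :=
    hk.comp (f := fun y => (x, y)) (by fun_prop) fun y hy => ⟨hx, hy⟩
  have h3 : ContinuousOn (fun y => √(k y y - 2 * k x y + k x x)) Ω :=
    Real.continuous_sqrt.comp_continuousOn
      ((h1.sub (continuousOn_const.mul h2)).add continuousOn_const)
  have h4 := (h3 x hx).tendsto
  have h5 : √(k x x - 2 * k x x + k x x) = 0 := by
    rw [show k x x - 2 * k x x + k x x = 0 by ring, Real.sqrt_zero]
  rw [h5] at h4
  refine h4.congr' ?_
  filter_upwards [self_mem_nhdsWithin] with y hy using (hsq y hy).symm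

/-- Cauchy–Schwarz for $f(x)=\langle f,k_x\rangle$, with $\|k_x\|$ bounded on the compact set
$\Omega$. -/
theorem exists_norm_kerVec_le (hΩ : IsCompact Ω)
    (hH₀ : ∀ x y : Ω, RKHS.kernel H₀ x y 1 = k x y)
    (hk : ContinuousOn (Function.uncurry k) (Ω ×ˢ Ω)) :
    ∃ B, 0 ≤ B ∧ ∀ (f : H₀) (x : Eucl d), |toFun₀ f x| ≤ B * ‖f‖ := by
  obtain ⟨B, hB⟩ := hΩ.exists_bound_of_continuousOn (continuousOn_kerVec (H₀ := H₀) hH₀ hk)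
  refine ⟨max B 0, le_max_right _ _, fun f x => ?_⟩
  by_cases hx : x ∈ Ω
  · rw [← inner_kerVec, mul_comm]
    refine (abs_real_inner_le_norm _ _).trans ?_
    gcongr
    exact (hB x hx).trans (le_max_left _ _)
  · rw [toFun₀_of_notMem _ hx, abs_zero]
    positivity

theorem continuousOn_toFun₀ (hH₀ : ∀ x y : Ω, RKHS.kernel H₀ x y 1 = k x y)
    (hk : ContinuousOn (Function.uncurry k) (Ω ×ˢ Ω)) (f : H₀) : ContinuousOn (toFun₀ f) Ω := by
  have : toFun₀ f = fun x => inner ℝ f (kerVec Ω H₀ x) := by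
    ext x; rw [inner_kerVec]
  rw [this]
  exact continuousOn_const.inner (continuousOn_kerVec hH₀ hk)

/-- Test the mixed derivative with $\varphi\otimes\varphi$, whose $L^2$ norm is $\|\varphi\|^2$, and
apply Cauchy–Schwarz on the product space. -/
theorem integral_kernel_fderiv_le (hΩ : IsCompact Ω) {i : Fin d} {mm : Eucl d × Eucl d → ℝ}
    (hm : MemLp mm 2 ((volume.restrict Ω).prod (volume.restrict Ω)))
    (hmk : IsWeakMixedDeriv Ω k i i mm) {φ : Eucl d → ℝ} (hφ : ContDiff ℝ ∞ φ)
    (hc : HasCompactSupport φ) (hs : tsupport φ ⊆ interior Ω)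
    (hφ2 : MemLp φ 2 (volume.restrict Ω)) :
    ∫ p, k p.1 p.2 * (fderiv ℝ φ p.1 (EuclideanSpace.single i 1) *
      fderiv ℝ φ p.2 (EuclideanSpace.single i 1))
        ∂((volume.restrict Ω).prod (volume.restrict Ω)) ≤ ‖hm.toLp mm‖ * ‖hφ2.toLp φ‖ ^ 2 := by
  have hfin : IsFiniteMeasure (volume.restrict Ω) := ⟨by simpa using hΩ.measure_lt_top⟩
  set e : Eucl d := EuclideanSpace.single i 1
  set ψ : Eucl d × Eucl d → ℝ := fun p => φ p.1 * φ p.2 with hψ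
  have hψs : ContDiff ℝ ∞ ψ := (hφ.comp contDiff_fst).mul (hφ.comp contDiff_snd)
  have hts : tsupport ψ ⊆ tsupport φ ×ˢ tsupport φ := by
    refine closure_minimal (fun p hp => ?_) ((isClosed_tsupport φ).prod (isClosed_tsupport φ))
    exact ⟨subset_tsupport _ (left_ne_zero_of_mul hp), subset_tsupport _ (right_ne_zero_of_mul hp)⟩
  have hψc : HasCompactSupport ψ := (hc.isCompact.prod hc.isCompact).of_isClosed_subset
    (isClosed_tsupport _) hts
  have hd1 : ∀ q : Eucl d × Eucl d, fderiv ℝ ψ q (0, e) = φ q.1 * fderiv ℝ φ q.2 e := by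
    intro q
    have h1 : HasFDerivAt (fun p : Eucl d × Eucl d => φ p.1) _ q :=
      ((hφ.differentiable (by simp)).differentiableAt.hasFDerivAt).comp q hasFDerivAt_fst
    have h2 : HasFDerivAt (fun p : Eucl d × Eucl d => φ p.2) _ q :=
      ((hφ.differentiable (by simp)).differentiableAt.hasFDerivAt).comp q hasFDerivAt_snd
    have h3 : HasFDerivAt ψ _ q := h1.mul h2
    rw [h3.fderiv]
    simp
  have hd2 : ∀ p : Eucl d × Eucl d, fderiv ℝ (fun q => fderiv ℝ ψ q (0, e)) p (e, 0) =
      fderiv ℝ φ p.1 e * fderiv ℝ φ p.2 e := by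
    intro p
    simp only [hd1]
    have h1 : HasFDerivAt (fun p : Eucl d × Eucl d => φ p.1) _ p :=
      ((hφ.differentiable (by simp)).differentiableAt.hasFDerivAt).comp p hasFDerivAt_fst
    have hφ' : ContDiff ℝ ∞ fun x => fderiv ℝ φ x e :=
      (hφ.fderiv_right (m := ∞) (by simp)).clm_apply contDiff_const
    have h2 : HasFDerivAt (fun p : Eucl d × Eucl d => fderiv ℝ φ p.2 e) _ p :=
      HasFDerivAt.comp p (g := fun x => fderiv ℝ φ x e)
        ((hφ'.differentiable (by simp)).differentiableAt.hasFDerivAt) hasFDerivAt_snd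
    have h3 : HasFDerivAt (fun q : Eucl d × Eucl d => φ q.1 * fderiv ℝ φ q.2 e) _ p := h1.mul h2
    rw [h3.fderiv]
    simp [mul_comm]
  have key : ∫ p, k p.1 p.2 * fderiv ℝ (fun q => fderiv ℝ ψ q (0, e)) p (e, 0)
      ∂((volume.restrict Ω).prod (volume.restrict Ω)) =
        ∫ p, mm p * ψ p ∂((volume.restrict Ω).prod (volume.restrict Ω)) :=
    hmk ψ hψs hψc (hts.trans (Set.prod_mono hs hs))
  simp only [hd2] at key
  have hψ2 : MemLp ψ 2 ((volume.restrict Ω).prod (volume.restrict Ω)) := by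
    obtain ⟨M, hM⟩ := hψs.continuous.bounded_above_of_compact_support hψc
    exact MemLp.of_bound hψs.continuous.aestronglyMeasurable M (.of_forall hM)
  rw [key, integral_mul_eq_inner_toLp hm hψ2]
  have hnorm : ‖hψ2.toLp ψ‖ = ‖hφ2.toLp φ‖ ^ 2 := by
    rw [← sq_eq_sq₀ (norm_nonneg _) (by positivity), ← real_inner_self_eq_norm_sq,
      ← real_inner_self_eq_norm_sq, ← integral_mul_eq_inner_toLp hψ2 hψ2,
      ← integral_mul_eq_inner_toLp hφ2 hφ2, sq, ← integral_prod_mul]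
    refine integral_congr_ae (.of_forall fun p => ?_)
    simp only [hψ]
    ring
  rw [← hnorm]
  exact real_inner_le_norm _ _

/-- The integral equals $\langle f,S\rangle$ for the $\mathcal H_0$-valued integral
$S=\int\partial_i\varphi(x)\,k_x\,dx$, and $\|S\|^2$ is the double integral of the preceding bound.
-/
theorem abs_integral_toFun₀_mul_fderiv_le (hΩ : IsCompact Ω)
    (hH₀ : ∀ x y : Ω, RKHS.kernel H₀ x y 1 = k x y)
    (hk : ContinuousOn (Function.uncurry k) (Ω ×ˢ Ω)) {i : Fin d} {mm : Eucl d × Eucl d → ℝ}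
    (hm : MemLp mm 2 ((volume.restrict Ω).prod (volume.restrict Ω)))
    (hmk : IsWeakMixedDeriv Ω k i i mm) (f : H₀) {φ : Eucl d → ℝ} (hφ : ContDiff ℝ ∞ φ)
    (hc : HasCompactSupport φ) (hs : tsupport φ ⊆ interior Ω)
    (hφ2 : MemLp φ 2 (volume.restrict Ω)) :
    |∫ x in Ω, toFun₀ f x * fderiv ℝ φ x (EuclideanSpace.single i 1)| ≤
      (√‖hm.toLp mm‖ * ‖f‖) * ‖hφ2.toLp φ‖ := by
  have hfin : IsFiniteMeasure (volume.restrict Ω) := ⟨by simpa using hΩ.measure_lt_top⟩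
  set g : Eucl d → ℝ := fun x => fderiv ℝ φ x (EuclideanSpace.single i 1) with hg
  have hgc : Continuous g := continuous_fderiv_apply_of_contDiff hφ _
  have hkv := continuousOn_kerVec (H₀ := H₀) hH₀ hk
  have hvi : IntegrableOn (fun x => g x • kerVec Ω H₀ x) Ω volume :=
    (hgc.continuousOn.smul hkv).integrableOn_compact hΩ
  set S : H₀ := ∫ x in Ω, g x • kerVec Ω H₀ x with hS
  have hinner : ∀ h : H₀, inner ℝ h S = ∫ x in Ω, g x * toFun₀ h x := by
    intro h
    rw [hS, ← integral_inner hvi]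
    refine integral_congr_ae (.of_forall fun x => ?_)
    simp only [inner_smul_right, inner_kerVec]
  have hSS : ‖S‖ ^ 2 ≤ ‖hm.toLp mm‖ * ‖hφ2.toLp φ‖ ^ 2 := by
    refine le_trans (le_of_eq ?_) (integral_kernel_fderiv_le hΩ hm hmk hφ hc hs hφ2)
    have hcont : ContinuousOn (fun p : Eucl d × Eucl d => k p.1 p.2 * (g p.1 * g p.2)) (Ω ×ˢ Ω) :=
      ContinuousOn.mul hk (by fun_prop)
    have hInt : Integrable (fun p : Eucl d × Eucl d => k p.1 p.2 * (g p.1 * g p.2))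
        ((volume.restrict Ω).prod (volume.restrict Ω)) := by
      rw [Measure.prod_restrict]
      exact hcont.integrableOn_compact (hΩ.prod hΩ)
    rw [← real_inner_self_eq_norm_sq, hinner, integral_prod _ hInt]
    refine setIntegral_congr_fun hΩ.measurableSet fun x hx => ?_
    simp only
    rw [← inner_kerVec, real_inner_comm, hinner, ← integral_const_mul]
    refine setIntegral_congr_fun hΩ.measurableSet fun y hy => ?_
    rw [toFun₀_kerVec hH₀ hy hx, ← inner_kerVec_kerVec hH₀ hx hy, real_inner_comm,
      inner_kerVec_kerVec hH₀ hy hx]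
    ring
  have hSn : ‖S‖ ≤ √‖hm.toLp mm‖ * ‖hφ2.toLp φ‖ := by
    refine le_of_sq_le_sq (hSS.trans_eq ?_) (by positivity)
    rw [mul_pow, Real.sq_sqrt (norm_nonneg _)]
  have e1 : ∫ x in Ω, toFun₀ f x * g x = inner ℝ f S := by
    rw [hinner]
    simp only [mul_comm]
  rw [e1]
  refine (abs_real_inner_le_norm _ _).trans ?_
  calc ‖f‖ * ‖S‖ ≤ ‖f‖ * (√‖hm.toLp mm‖ * ‖hφ2.toLp φ‖) := by gcongr
    _ = _ := by ring

end RKHSWeakDeriv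

/-! ### Square-integrable weak gradients in the reproducing kernel space -/

section RKHSWeakGrad

variable {d : ℕ} {Ω : Set (Eucl d)} {k : Eucl d → Eucl d → ℝ} {H₀ : Type*}
  [NormedAddCommGroup H₀] [InnerProductSpace ℝ H₀] [RKHS ℝ H₀ Ω ℝ]

variable (Ω) in
/-- Smooth functions with compact support in the interior of `Ω`. -/
def testFunctions : Submodule ℝ (Eucl d → ℝ) where
  carrier := {φ | ContDiff ℝ ∞ φ ∧ HasCompactSupport φ ∧ tsupport φ ⊆ interior Ω}
  add_mem' := fun {φ ψ} h h' => ⟨h.1.add h'.1, h.2.1.add h'.2.1,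
    (tsupport_add φ ψ).trans (Set.union_subset h.2.2 h'.2.2)⟩
  zero_mem' := ⟨contDiff_const, HasCompactSupport.zero, by simp [tsupport]⟩
  smul_mem' := fun c φ h => ⟨contDiff_const.smul h.1, h.2.1.smul_left (f := fun _ => c),
    (closure_mono (Function.support_const_smul_subset c φ)).trans h.2.2⟩

theorem memLp_of_mem_testFunctions (hΩ : IsCompact Ω) {φ : Eucl d → ℝ}
    (hφ : φ ∈ testFunctions Ω) : MemLp φ 2 (volume.restrict Ω) := by
  have hfin : IsFiniteMeasure (volume.restrict Ω) := ⟨by simpa using hΩ.measure_lt_top⟩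
  exact memLp_of_continuous_of_isCompact hΩ hφ.1.continuous _ (ae_restrict_mem hΩ.measurableSet)

variable [CompleteSpace H₀]

/-- The distributional derivative of $f$ is a functional on test functions bounded in the $L^2$
norm, hence represented by an $L^2$ function of norm at most $\sqrt{\|m\|}\,\|f\|$. -/
theorem exists_hasWeakDeriv_toFun₀ (hΩ : IsCompact Ω)
    (hH₀ : ∀ x y : Ω, RKHS.kernel H₀ x y 1 = k x y)
    (hk : ContinuousOn (Function.uncurry k) (Ω ×ˢ Ω)) {i : Fin d} {mm : Eucl d × Eucl d → ℝ}
    (hm : MemLp mm 2 ((volume.restrict Ω).prod (volume.restrict Ω)))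
    (hmk : IsWeakMixedDeriv Ω k i i mm) (f : H₀) :
    ∃ (g : Eucl d → ℝ) (hg : MemLp g 2 (volume.restrict Ω)),
      ‖hg.toLp g‖ ≤ √‖hm.toLp mm‖ * ‖f‖ ∧
      HasWeakDeriv (interior Ω) (toFun₀ f) (EuclideanSpace.single i 1) g := by
  have hfin : IsFiniteMeasure (volume.restrict Ω) := ⟨by simpa using hΩ.measure_lt_top⟩
  have hfc : ContinuousOn (toFun₀ f) Ω := continuousOn_toFun₀ hH₀ hk f
  set e : Eucl d := EuclideanSpace.single i 1
  have hInt : ∀ φ ∈ testFunctions Ω, IntegrableOn (fun x => toFun₀ f x * fderiv ℝ φ x e) Ω :=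
    fun φ hφ => ContinuousOn.integrableOn_compact hΩ
      (hfc.mul (continuous_fderiv_apply_of_contDiff hφ.1 e).continuousOn)
  let J : testFunctions Ω →ₗ[ℝ] Lp ℝ 2 (volume.restrict Ω) :=
    { toFun := fun φ => (memLp_of_mem_testFunctions hΩ φ.2).toLp φ
      map_add' := fun φ ψ => MemLp.toLp_add (memLp_of_mem_testFunctions hΩ φ.2)
        (memLp_of_mem_testFunctions hΩ ψ.2)
      map_smul' := fun c φ => MemLp.toLp_const_smul c (memLp_of_mem_testFunctions hΩ φ.2) }
  let l : testFunctions Ω →ₗ[ℝ] ℝ :=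
    { toFun := fun φ => - ∫ x in Ω, toFun₀ f x * fderiv ℝ φ.1 x e
      map_add' := fun φ ψ => by
        rw [← neg_add, ← integral_add (hInt _ φ.2) (hInt _ ψ.2)]
        congr 1
        refine integral_congr_ae (.of_forall fun x => ?_)
        have : fderiv ℝ (φ + ψ).1 x = fderiv ℝ φ.1 x + fderiv ℝ ψ.1 x :=
          fderiv_add (φ.2.1.differentiable (by simp)).differentiableAt
            (ψ.2.1.differentiable (by simp)).differentiableAt
        simp only [this, add_apply]
        ring
      map_smul' := fun c φ => by
        rw [RingHom.id_apply, smul_eq_mul, mul_neg, ← integral_const_mul]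
        congr 1
        refine integral_congr_ae (.of_forall fun x => ?_)
        have : fderiv ℝ (c • φ).1 x = c • fderiv ℝ φ.1 x :=
          fderiv_const_smul (φ.2.1.differentiable (by simp)).differentiableAt c
        simp only [this, smul_apply, smul_eq_mul]
        ring }
  obtain ⟨G, hGn, hG⟩ := exists_inner_eq_of_abs_le J l
    (C := √‖hm.toLp mm‖ * ‖f‖) (by positivity) fun φ => by
      have := abs_integral_toFun₀_mul_fderiv_le hΩ hH₀ hk hm hmk f φ.2.1 φ.2.2.1 φ.2.2.2
        (memLp_of_mem_testFunctions hΩ φ.2)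
      change |- _| ≤ _
      rw [abs_neg]
      exact this
  refine ⟨G, Lp.memLp G, by rwa [Lp.toLp_coeFn], ?_, ?_, fun φ hφ hc hs => ?_⟩
  · exact (hfc.mono interior_subset).locallyIntegrableOn isOpen_interior.measurableSet
  · have h1 : IntegrableOn (fun x => G x) Ω := (Lp.memLp G).integrable (by norm_num)
    exact (h1.mono_set interior_subset).locallyIntegrableOn
  · have hφ' : φ ∈ testFunctions Ω := ⟨hφ, hc, hs⟩
    have h1 : - ∫ x in Ω, toFun₀ f x * fderiv ℝ φ x e = inner ℝ G (J ⟨φ, hφ'⟩) := hG ⟨φ, hφ'⟩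
    have h2 : inner ℝ G (J ⟨φ, hφ'⟩) = ∫ x in Ω, φ x * G x := by
      rw [real_inner_comm]
      conv_lhs => rw [← Lp.toLp_coeFn G (Lp.memLp G)]
      exact (integral_mul_eq_inner_toLp (memLp_of_mem_testFunctions hΩ hφ') (Lp.memLp G)).symm
    rw [h2, setIntegral_eq_of_tsupport_subset hs fun x hx => ?_,
      setIntegral_eq_of_tsupport_subset hs fun x hx => ?_] at h1
    · rw [← h1, neg_neg]
    · simp [image_eq_zero_of_notMem_tsupport hx]
    · have : fderiv ℝ φ x e = 0 := image_eq_zero_of_notMem_tsupport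
        (f := fun x => fderiv ℝ φ x e) fun h' => hx (tsupport_fderiv_apply_subset ℝ e h')
      simp [this]

/-- Functions in the reproducing kernel Hilbert space belong to `H¹(Ω)`, with a bound on the
partial derivatives. -/
theorem exists_weakGrad_toFun₀_le {μ π : Measure (Eucl d)} (hΩ : IsSmoothCompactDomain Ω)
    (hH₀ : ∀ x y : Ω, RKHS.kernel H₀ x y 1 = k x y) (hk : IsSteinKernel Ω μ π k) :
    ∃ C : Fin d → ℝ, ∀ f : H₀, WeaklyDifferentiable Ω (toFun₀ (Ω := Ω) f) ∧
      ∀ i, ∃ h : MemLp (fun x => weakGrad Ω (toFun₀ (Ω := Ω) f) x i) 2 (volume.restrict Ω),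
        ‖h.toLp _‖ ≤ C i * ‖f‖ := by
  choose m hm hmk using fun i => hk.mixedDeriv i i
  refine ⟨fun i => √‖(hm i).toLp (m i)‖, fun f => ?_⟩
  choose g hg hgn hgw using fun i =>
    exists_hasWeakDeriv_toFun₀ hΩ.isCompact hH₀ hk.continuousOn (hm i) (hmk i) f
  have hfin : IsFiniteMeasure (volume.restrict Ω) :=
    ⟨by simpa using hΩ.isCompact.measure_lt_top⟩
  have hG : IsWeakGrad Ω (toFun₀ f) (fun x => WithLp.toLp 2 fun i => g i x) := by
    refine isWeakGrad_of_hasWeakDeriv ?_ ?_ hgw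
    · exact ((continuousOn_toFun₀ hH₀ hk.continuousOn f).mono interior_subset).locallyIntegrableOn
        isOpen_interior.measurableSet
    · have h1 : IntegrableOn (fun x => (WithLp.toLp 2 fun i => g i x : Eucl d)) Ω := by
        have : Integrable (fun x i => g i x) (volume.restrict Ω) :=
          Integrable.of_eval fun i => (hg i).integrable (by norm_num)
        exact (PiLp.continuousLinearEquiv 2 ℝ
          (fun _ : Fin d => ℝ)).symm.toContinuousLinearMap.integrable_comp this
      exact (h1.mono_set interior_subset).locallyIntegrableOn
  refine ⟨⟨_, hG⟩, fun i => ?_⟩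
  have hae : (fun x => weakGrad Ω (toFun₀ f) x i) =ᵐ[volume.restrict Ω] g i := by
    have := (WeaklyDifferentiable.isWeakGrad ⟨_, hG⟩).unique hG
    rw [hΩ.restrict_interior] at this
    filter_upwards [this] with x hx
    rw [hx]
  have h := (memLp_congr_ae hae).2 (hg i)
  refine ⟨h, ?_⟩
  rw [MemLp.toLp_congr h (hg i) hae]
  exact hgn i

end RKHSWeakGrad

/-! ### The expectation of the Stein operator as a continuous functional -/

section SteinFunctional

variable {d : ℕ} {Ω : Set (Eucl d)} {μ π : Measure (Eucl d)} {k : Eucl d → Eucl d → ℝ}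

theorem MemP2.restrict_eq (hμ : MemP2 Ω μ) : μ.restrict Ω = μ :=
  Measure.restrict_eq_self_of_ae_mem (mem_ae_iff.2 hμ.measure_compl)

theorem MemP2.integrable_of_density_mul (hμ : MemP2 Ω μ) (hΩ : MeasurableSet Ω)
    {F : Eucl d → ℝ} (hF : IntegrableOn (fun x => density μ x * F x) Ω) : Integrable F μ := by
  have := hμ.isProbabilityMeasure
  have h1 : Integrable (fun x => (μ.rnDeriv volume x).toReal • Ω.indicator F x) volume := by
    refine ((integrable_indicator_iff hΩ).2 hF).congr (.of_forall fun x => ?_)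
    by_cases hx : x ∈ Ω <;> simp [hx, density]
  rw [integrable_rnDeriv_smul_iff hμ.absolutelyContinuous, integrable_indicator_iff hΩ,
    IntegrableOn, hμ.restrict_eq] at h1
  exact h1

theorem MemP2.integral_eq (hμ : MemP2 Ω μ) (hΩ : MeasurableSet Ω) (F : Eucl d → ℝ) :
    ∫ x, F x ∂μ = ∫ x in Ω, density μ x * F x := by
  have := hμ.isProbabilityMeasure
  conv_lhs => rw [← hμ.restrict_eq]
  exact (setIntegral_rnDeriv_smul hμ.absolutelyContinuous hΩ).symm

variable {H₀ : Type*} [NormedAddCommGroup H₀] [InnerProductSpace ℝ H₀] [RKHS ℝ H₀ Ω ℝ]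

variable (Ω μ π) in
/-- The density times the Stein operator applied to the vector field with the single component
`f` in the direction `i`. -/
def steinIntegrand (i : Fin d) (f : Eucl d → ℝ) (x : Eucl d) : ℝ :=
  density μ x * score Ω π x i * f x + density μ x * weakGrad Ω f x i

theorem density_mul_steinOp (f : ProductRKHS d H₀) (x : Eucl d) :
    density μ x * steinOp Ω π (toField f) x =
      ∑ i, steinIntegrand Ω μ π i (toFun₀ (Ω := Ω) (f i)) x := by
  simp only [steinOp, steinIntegrand, PiLp.inner_apply, toField_apply, ← Finset.sum_add_distrib,
    Finset.mul_sum]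
  refine Finset.sum_congr rfl fun i _ => ?_
  simp
  ring

theorem HasSquareIntegrableScore.memLp_apply (h : HasSquareIntegrableScore Ω μ π) (i : Fin d) :
    MemLp (fun x => density μ x * score Ω π x i) 2 (volume.restrict Ω) := by
  simpa using SteinKSD.memLp_apply h.2 i

/-- Cauchy–Schwarz and its equality case. For $a=0$ the maximizer $\|a\|^{-1}a$ is still admissible,
because $0^{-1}=0$. -/
theorem isGreatest_steinValues {a : ProductRKHS d H₀}
    (ha : ∀ f : ProductRKHS d H₀, ∫ x, steinOp Ω π (toField f) x ∂μ = inner ℝ a f) :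
    IsGreatest (steinValues Ω H₀ μ π) ‖a‖ := by
  refine ⟨⟨‖a‖⁻¹ • a, ?_, ?_⟩, ?_⟩
  · rw [norm_smul, norm_inv, norm_norm]
    exact inv_mul_le_one
  · rw [ha, inner_smul_right, real_inner_self_eq_norm_sq]
    rcases eq_or_ne ‖a‖ 0 with h | h
    · simp [h]
    · field_simp
  · rintro r ⟨f, hf, rfl⟩
    rw [ha]
    exact (real_inner_le_norm a f).trans (mul_le_of_le_one_right (norm_nonneg _) hf)

variable [CompleteSpace H₀]

theorem memLp_toFun₀ (hΩ : IsCompact Ω) (hH₀ : ∀ x y : Ω, RKHS.kernel H₀ x y 1 = k x y)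
    (hk : ContinuousOn (Function.uncurry k) (Ω ×ˢ Ω)) (f : H₀) :
    MemLp (toFun₀ (Ω := Ω) f) 2 (volume.restrict Ω) := by
  have hfin : IsFiniteMeasure (volume.restrict Ω) := ⟨by simpa using hΩ.measure_lt_top⟩
  obtain ⟨B, -, hB⟩ := exists_norm_kerVec_le hΩ hH₀ hk
  exact MemLp.of_bound ((continuousOn_toFun₀ hH₀ hk f).aestronglyMeasurable hΩ.measurableSet)
    (B * ‖f‖) (.of_forall fun x => hB f x)

theorem exists_inner_eq_integral_steinIntegrand (hΩ : IsSmoothCompactDomain Ω) (hμ : MemP2 Ω μ)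
    (hscore : HasSquareIntegrableScore Ω μ π) (hk : IsSteinKernel Ω μ π k)
    (hH₀ : ∀ x y : Ω, RKHS.kernel H₀ x y 1 = k x y) (i : Fin d) :
    (∀ f : H₀, IntegrableOn (steinIntegrand Ω μ π i (toFun₀ (Ω := Ω) f)) Ω) ∧
    ∃ a : H₀, ∀ f : H₀,
      ∫ x in Ω, steinIntegrand Ω μ π i (toFun₀ (Ω := Ω) f) x = inner ℝ a f := by
  obtain ⟨C, hC⟩ := exists_weakGrad_toFun₀_le hΩ hH₀ hk
  obtain ⟨B, hB0, hB⟩ := exists_norm_kerVec_le (H₀ := H₀) hΩ.isCompact hH₀ hk.continuousOn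
  have hfin : IsFiniteMeasure (volume.restrict Ω) :=
    ⟨by simpa using hΩ.isCompact.measure_lt_top⟩
  have hs := hscore.memLp_apply i
  have hd := hμ.memH1_density.1
  have hf := memLp_toFun₀ (H₀ := H₀) hΩ.isCompact hH₀ hk.continuousOn
  have hg : ∀ f : H₀, MemLp (fun x => weakGrad Ω (toFun₀ (Ω := Ω) f) x i) 2 (volume.restrict Ω) :=
    fun f => ((hC f).2 i).1
  have i1 : ∀ f : H₀, Integrable (fun x => density μ x * score Ω π x i * toFun₀ (Ω := Ω) f x)
      (volume.restrict Ω) := fun f => hs.integrable_mul (hf f)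
  have i2 : ∀ f : H₀, Integrable (fun x => density μ x * weakGrad Ω (toFun₀ (Ω := Ω) f) x i)
      (volume.restrict Ω) := fun f => hd.integrable_mul (hg f)
  -- `weakGrad` is a chosen representative, so it is additive and homogeneous only up to null sets,
  -- by uniqueness of weak gradients.
  have hadd : ∀ f g : H₀, weakGrad Ω (toFun₀ (Ω := Ω) (f + g)) =ᵐ[volume.restrict Ω]
      fun x => weakGrad Ω (toFun₀ (Ω := Ω) f) x + weakGrad Ω (toFun₀ (Ω := Ω) g) x := by
    intro f g
    have h1 := (hC f).1.isWeakGrad.add (hC g).1.isWeakGrad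
    have h2 : (fun x => toFun₀ (Ω := Ω) f x + toFun₀ (Ω := Ω) g x) = toFun₀ (Ω := Ω) (f + g) :=
      funext fun x => (toFun₀_add f g x).symm
    rw [h2] at h1
    have := (hC (f + g)).1.isWeakGrad.unique h1
    rwa [hΩ.restrict_interior] at this
  have hsmul : ∀ (c : ℝ) (f : H₀), weakGrad Ω (toFun₀ (Ω := Ω) (c • f)) =ᵐ[volume.restrict Ω]
      fun x => c • weakGrad Ω (toFun₀ (Ω := Ω) f) x := by
    intro c f
    have h1 := (hC f).1.isWeakGrad.const_mul c
    have h2 : (fun x => c * toFun₀ (Ω := Ω) f x) = toFun₀ (Ω := Ω) (c • f) :=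
      funext fun x => (toFun₀_smul c f x).symm
    rw [h2] at h1
    have := (hC (c • f)).1.isWeakGrad.unique h1
    rwa [hΩ.restrict_interior] at this
  have hInt : ∀ f : H₀, IntegrableOn (steinIntegrand Ω μ π i (toFun₀ (Ω := Ω) f)) Ω :=
    fun f => (i1 f).add (i2 f)
  refine ⟨hInt, ?_⟩
  let l : H₀ →ₗ[ℝ] ℝ :=
    { toFun := fun f => ∫ x in Ω, steinIntegrand Ω μ π i (toFun₀ (Ω := Ω) f) x
      map_add' := fun f g => by
        rw [← integral_add (hInt f) (hInt g)]
        refine integral_congr_ae ?_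
        filter_upwards [hadd f g] with x hx
        simp only [steinIntegrand, hx, toFun₀_add, PiLp.add_apply]
        ring
      map_smul' := fun c f => by
        rw [RingHom.id_apply, smul_eq_mul, ← integral_const_mul]
        refine integral_congr_ae ?_
        filter_upwards [hsmul c f] with x hx
        simp only [steinIntegrand, hx, toFun₀_smul, PiLp.smul_apply, smul_eq_mul]
        ring }
  -- The first summand bounds the score term through the sup bound $B\|f\|$, the second the
  -- derivative term through an $L^2$ pairing. The absolute value makes nonnegativity of the
  -- constant immediate.
  set K : ℝ := (∫ x in Ω, |density μ x * score Ω π x i|) * B + ‖hd.toLp _‖ * |C i|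
  have hK : 0 ≤ K := by positivity
  obtain ⟨a, -, ha⟩ := exists_inner_eq_of_abs_le (LinearMap.id : H₀ →ₗ[ℝ] H₀) l hK fun f => by
    have e : l f = (∫ x in Ω, density μ x * score Ω π x i * toFun₀ (Ω := Ω) f x) +
        ∫ x in Ω, density μ x * weakGrad Ω (toFun₀ (Ω := Ω) f) x i := integral_add (i1 f) (i2 f)
    rw [e]
    refine (abs_add_le _ _).trans ?_
    have h1 : |∫ x in Ω, density μ x * score Ω π x i * toFun₀ (Ω := Ω) f x| ≤
        (∫ x in Ω, |density μ x * score Ω π x i|) * (B * ‖f‖) := by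
      rw [← integral_mul_const]
      refine (abs_integral_le_integral_abs).trans (integral_mono (i1 f).abs
        ((hs.integrable (by norm_num)).abs.mul_const _) fun x => ?_)
      simp only [abs_mul (density μ x * score Ω π x i)]
      exact mul_le_mul_of_nonneg_left (hB f x) (abs_nonneg _)
    have h2 : |∫ x in Ω, density μ x * weakGrad Ω (toFun₀ (Ω := Ω) f) x i| ≤
        ‖hd.toLp _‖ * (|C i| * ‖f‖) := by
      obtain ⟨h, hle⟩ := (hC f).2 i
      rw [integral_mul_eq_inner_toLp hd h]
      refine (abs_real_inner_le_norm _ _).trans ?_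
      gcongr
      exact hle.trans (by gcongr; exact le_abs_self _)
    simp only [LinearMap.id_apply]
    linarith
  exact ⟨a, ha⟩

theorem exists_inner_eq_integral_steinOp (hΩ : IsSmoothCompactDomain Ω) (hμ : MemP2 Ω μ)
    (hscore : HasSquareIntegrableScore Ω μ π) (hk : IsSteinKernel Ω μ π k)
    (hH₀ : ∀ x y : Ω, RKHS.kernel H₀ x y 1 = k x y) :
    ∃ a : ProductRKHS d H₀,
      (∀ i (f : H₀), ∫ x in Ω, steinIntegrand Ω μ π i (toFun₀ (Ω := Ω) f) x = inner ℝ (a i) f) ∧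
      ∀ f : ProductRKHS d H₀, Integrable (steinOp Ω π (toField f)) μ ∧
        ∫ x, steinOp Ω π (toField f) x ∂μ = inner ℝ a f := by
  have key := exists_inner_eq_integral_steinIntegrand (H₀ := H₀) hΩ hμ hscore hk hH₀
  choose a ha using fun i => (key i).2
  refine ⟨WithLp.toLp 2 a, ha, fun f => ?_⟩
  have hm := hΩ.isCompact.measurableSet
  have hi : ∀ i ∈ Finset.univ, Integrable (steinIntegrand Ω μ π i (toFun₀ (Ω := Ω) (f i)))
      (volume.restrict Ω) := fun i _ => (key i).1 (f i)
  refine ⟨hμ.integrable_of_density_mul hm ?_, ?_⟩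
  · simp only [density_mul_steinOp]
    exact integrable_finsetSum _ hi
  · rw [hμ.integral_eq hm]
    simp only [density_mul_steinOp]
    rw [integral_finsetSum _ hi, PiLp.inner_apply]
    exact Finset.sum_congr rfl fun i _ => ha i (f i)

end SteinFunctional

/-! ### Separation -/

section Separation

variable {d : ℕ} {Ω : Set (Eucl d)} {μ π : Measure (Eucl d)} {k : Eucl d → Eucl d → ℝ}

/-- Weak gradients are determined a.e. on the interior only; since the boundary is Lebesgue null,
this is the same as a.e. on $\Omega$. -/
theorem weakGrad_congr_ae (hΩ : IsSmoothCompactDomain Ω) {u v : Eucl d → ℝ}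
    (hu : WeaklyDifferentiable Ω u) (huv : u =ᵐ[volume.restrict Ω] v) :
    weakGrad Ω u =ᵐ[volume.restrict Ω] weakGrad Ω v := by
  have h1 := hu.isWeakGrad.congr_ae (v := v) (by rwa [hΩ.restrict_interior])
  have h2 := h1.unique (WeaklyDifferentiable.isWeakGrad ⟨_, h1⟩)
  rwa [hΩ.restrict_interior] at h2

theorem weakGrad_zero (hΩ : IsSmoothCompactDomain Ω) :
    weakGrad Ω (fun _ => (0 : ℝ)) =ᵐ[volume.restrict Ω] 0 := by
  have h1 : IsWeakGrad Ω (fun _ => (0 : ℝ)) 0 :=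
    ⟨(locallyIntegrable_const 0).locallyIntegrableOn _,
      (locallyIntegrable_const (0 : Eucl d)).locallyIntegrableOn _, by simp⟩
  have h2 := (WeaklyDifferentiable.isWeakGrad ⟨_, h1⟩).unique h1
  rwa [hΩ.restrict_interior] at h2

/-- For the field $u\,e_i$ only the $i$-th term of $\int\operatorname{div}(\mu\,\phi)=0$ survives,
and it trades $\mu\,\partial_iu$ for $-u\,\partial_i\mu$. -/
theorem integral_steinIntegrand_eq (hΩ : IsSmoothCompactDomain Ω) (hμ : MemP2 Ω μ)
    (hscore : HasSquareIntegrableScore Ω μ π) {u : Eucl d → ℝ} {i : Fin d}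
    (hu : MemSteinClass Ω μ (fun y => u y • EuclideanSpace.single i (1 : ℝ))) :
    ∫ y in Ω, steinIntegrand Ω μ π i u y =
      ∫ y in Ω, (density μ y * score Ω π y i - weakGrad Ω (density μ) y i) * u y := by
  have hui : (fun y => (u y • EuclideanSpace.single i (1 : ℝ) : Eucl d) i) = u := by
    ext y; simp
  have huH : MemH1 Ω u := by simpa only [hui] using hu.1 i
  have hsum := hu.sum_integral_eq_zero hΩ hμ.memH1_density
  rw [Finset.sum_eq_single i] at hsum
  · rw [hui] at hsum
    simp only [PiLp.smul_apply, PiLp.single_apply, if_true, smul_eq_mul, mul_one] at hsum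
    have hs := hscore.memLp_apply i
    have hd := hμ.memH1_density.1
    have hd' := memLp_apply hμ.memH1_density.2.2 i
    have hu' := memLp_apply huH.2.2 i
    have i1 : Integrable (fun y => density μ y * score Ω π y i * u y) (volume.restrict Ω) :=
      hs.integrable_mul huH.1
    have i2 : Integrable (fun y => density μ y * weakGrad Ω u y i) (volume.restrict Ω) :=
      hd.integrable_mul hu'
    have i3 : Integrable (fun y => weakGrad Ω (density μ) y i * u y) (volume.restrict Ω) :=
      hd'.integrable_mul huH.1
    rw [integral_add i3 i2] at hsum
    simp only [steinIntegrand, sub_mul]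
    rw [integral_add i1 i2, integral_sub i1 i3]
    linarith
  · intro j _ hj
    have h0 : (fun y => (u y • EuclideanSpace.single i (1 : ℝ) : Eucl d) j) = fun _ => 0 := by
      ext y; simp [hj]
    rw [h0]
    refine integral_eq_zero_of_ae ?_
    filter_upwards [weakGrad_zero hΩ] with y hy
    rw [hy]
    simp [hj]
  · simp

/-- Integrating the hypothesis against $g(x)$ makes the quadratic form of $k$ vanish at $g$, which
positive definiteness excludes for $g\ne0$. -/
theorem ae_eq_zero_of_integral_mul_kernel_eq_zero (hΩ : MeasurableSet Ω)
    (hk : IntegrallyPosDef Ω k) (hs : ∀ x ∈ Ω, ∀ y ∈ Ω, k x y = k y x) {g : Eucl d → ℝ}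
    (hg : MemLp g 2 (volume.restrict Ω)) (h : ∀ x ∈ Ω, ∫ y in Ω, g y * k y x = 0) :
    g =ᵐ[volume.restrict Ω] 0 := by
  by_contra hne
  refine (hk g hg hne).ne' ?_
  rw [setIntegral_congr_fun (g := fun _ => (0 : ℝ)) hΩ fun x hx => ?_, integral_zero]
  calc ∫ y in Ω, g x * k x y * g y = ∫ y in Ω, g x * (g y * k y x) :=
        setIntegral_congr_fun hΩ fun y hy => by simp only [hs x hx y hy]; ring
    _ = 0 := by rw [integral_const_mul, h x hx, mul_zero]

theorem density_pos (hμ : MemP2 Ω μ) : ∀ᵐ x ∂(volume.restrict Ω), 0 < density μ x := by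
  filter_upwards [hμ.density_ne_zero] with x hx
  exact lt_of_le_of_ne ENNReal.toReal_nonneg hx.symm

/-- The logarithmic derivative of a density. -/
theorem weakGrad_density_eq (hΩ : IsSmoothCompactDomain Ω) (hπ : MemP2 Ω π)
    (hlog : WeaklyDifferentiable Ω (fun x => Real.log (density π x))) (i : Fin d) :
    ∀ᵐ x ∂(volume.restrict Ω), weakGrad Ω (density π) x i = density π x * score Ω π x i := by
  have hpos := density_pos hπ
  -- Neither `log` nor `exp` has a bounded derivative, so the gradient of $\arctan\pi$ is computed
  -- in two ways: directly, and as $(\arctan\circ\exp)(\log\pi)$. Both outer functions have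
  -- derivative bounded by 1, and the common factor $1/(1+\pi^2)$ cancels.
  have h1 := (hπ.memH1_density.2.1.isWeakGrad.hasWeakDeriv_single i).comp isOpen_interior
    (F := Real.arctan) (F' := fun s => 1 / (1 + s ^ 2)) (C := 1) Real.hasDerivAt_arctan
    (by fun_prop (disch := intros; positivity)) fun s => by
      rw [abs_of_nonneg (by positivity), div_le_one (by positivity)]
      nlinarith [sq_nonneg s]
  have h2 := (hlog.isWeakGrad.hasWeakDeriv_single i).comp isOpen_interior
    (F := fun s => Real.arctan (Real.exp s)) (F' := fun s => 1 / (1 + Real.exp s ^ 2) * Real.exp s)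
    (C := 1) (fun s => (Real.hasDerivAt_exp s).arctan)
    (by fun_prop (disch := intros; positivity)) fun s => by
      rw [abs_of_nonneg (by positivity), one_div_mul_eq_div, div_le_one (by positivity)]
      nlinarith [sq_nonneg (Real.exp s - 1), Real.exp_pos s]
  have hcongr : (fun x => Real.arctan (Real.exp (Real.log (density π x))))
      =ᵐ[volume.restrict (interior Ω)] fun x => Real.arctan (density π x) := by
    rw [hΩ.restrict_interior]
    filter_upwards [hpos] with x hx
    rw [Real.exp_log hx]
  have h3 := h1.unique isOpen_interior (h2.congr_ae isOpen_interior hcongr (.refl _ _))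
  rw [hΩ.restrict_interior] at h3
  filter_upwards [h3, hpos] with x hx hp
  rw [Real.exp_log hp] at hx
  have : (1 + density π x ^ 2) ≠ 0 := by positivity
  change _ = _ * weakGrad Ω (fun x => Real.log (density π x)) x i
  field_simp at hx
  exact hx

theorem MemP2.eq_of_density_ae_eq (hΩ : MeasurableSet Ω) (hμ : MemP2 Ω μ) (hπ : MemP2 Ω π)
    {c : ℝ} (h : ∀ᵐ x ∂(volume.restrict Ω), density μ x = c * density π x) : μ = π := by
  have := hμ.isProbabilityMeasure
  have := hπ.isProbabilityMeasure
  have key : ∀ {ν : Measure (Eucl d)}, MemP2 Ω ν → ∀ s : Set (Eucl d), MeasurableSet s →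
      ν.real s = ∫ x in Ω, density ν x * s.indicator 1 x := by
    intro ν hν s hs
    rw [← hν.integral_eq hΩ, integral_indicator_one hs]
  have hreal : ∀ s : Set (Eucl d), MeasurableSet s → μ.real s = c * π.real s := by
    intro s hs
    rw [key hμ s hs, key hπ s hs, ← integral_const_mul]
    refine integral_congr_ae ?_
    filter_upwards [h] with x hx
    rw [hx]
    ring
  have hc : c = 1 := by
    have := hreal Set.univ MeasurableSet.univ
    simpa using this.symm
  refine Measure.ext fun s hs => ?_
  have := hreal s hs
  rw [hc, one_mul] at this
  exact (measureReal_eq_measureReal_iff).1 this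

theorem abs_div_sq_add_sq_le {δ : ℝ} (hδ : 0 < δ) (s : ℝ) : |s / (s ^ 2 + δ ^ 2)| ≤ 1 / δ := by
  have : 0 < s ^ 2 + δ ^ 2 := by positivity
  rw [abs_div, abs_of_pos this, div_le_div_iff₀ this hδ, one_mul]
  nlinarith [sq_nonneg (|s| - δ), sq_abs s, abs_nonneg s]

/-- This regularized logarithm is admissible in the chain rule, its derivative being bounded by
$1/\delta$, and it tends to $\log s$ for $s>0$ as $\delta\to0$. -/
theorem hasDerivAt_half_log_sq_add_sq {δ : ℝ} (hδ : 0 < δ) (s : ℝ) :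
    HasDerivAt (fun s => 1 / 2 * Real.log (s ^ 2 + δ ^ 2)) (s / (s ^ 2 + δ ^ 2)) s := by
  have hp : s ^ 2 + δ ^ 2 ≠ 0 := by positivity
  have h1 : HasDerivAt (fun s : ℝ => s ^ 2 + δ ^ 2) (2 * s) s := by
    simpa using (hasDerivAt_pow 2 s).add_const (δ ^ 2)
  exact ((h1.log hp).const_mul (1 / 2)).congr_deriv (by ring)

/-- Two densities with the same logarithmic derivative agree. -/
theorem eq_of_weakGrad_density_eq (hΩ : IsSmoothCompactDomain Ω) (hμ : MemP2 Ω μ)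
    (hπ : MemP2 Ω π) (hlog : WeaklyDifferentiable Ω (fun x => Real.log (density π x)))
    (h : ∀ i, ∀ᵐ x ∂(volume.restrict Ω),
      weakGrad Ω (density μ) x i = density μ x * score Ω π x i) : μ = π := by
  have hpos := density_pos hμ
  have hposπ := density_pos hπ
  set L : Eucl d → ℝ := fun x => Real.log (density π x)
  set S : Eucl d → Eucl d := score Ω π
  have hS : IsWeakGrad Ω L S := hlog.isWeakGrad
  -- Taking `arctan` of $\log\mu-\log\pi$ keeps everything bounded, so local integrability of
  -- $\log\mu$ never has to be established.
  set u : Eucl d → ℝ := fun x => Real.arctan (Real.log (density μ x) - L x)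
  have hderiv : ∀ a, HasWeakDeriv (interior Ω) u a 0 := by
    intro a
    have hgrad : ∀ᵐ x ∂(volume.restrict Ω),
        weakGrad Ω (density μ) x = density μ x • S x := by
      filter_upwards [ae_all_iff.2 h] with x hx
      ext i
      simpa using hx i
    set δ : ℕ → ℝ := fun n => 1 / ((n : ℝ) + 1) with hδdef
    have hδ : ∀ n, 0 < δ n := fun n => by positivity
    have hδl : Tendsto δ atTop (𝓝 0) := tendsto_one_div_add_atTop_nhds_zero_nat
    set w : ℕ → Eucl d → ℝ := fun n x => 1 / 2 * Real.log (density μ x ^ 2 + δ n ^ 2) - L x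
    set σ : Eucl d → ℝ := fun x => inner ℝ (S x) a
    -- With $\nabla\mu=\mu S$ the regularized log-ratio has gradient
    -- $\bigl(\mu^2/(\mu^2+\delta^2)-1\bigr)S=-\delta^2/(\mu^2+\delta^2)\,S$, dominated by $|S|$ and
    -- tending to 0 where $\mu>0$.
    have hw : ∀ n, HasWeakDeriv (interior Ω) (w n) a
        (fun x => - (δ n ^ 2 / (density μ x ^ 2 + δ n ^ 2)) * σ x) := by
      intro n
      have h1 := ((hμ.memH1_density.2.1.isWeakGrad.hasWeakDeriv a).comp isOpen_interior
        (hasDerivAt_half_log_sq_add_sq (hδ n))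
        (by
          have : ∀ s : ℝ, s ^ 2 + δ n ^ 2 ≠ 0 := fun s => by have := hδ n; positivity
          fun_prop (disch := assumption))
        (abs_div_sq_add_sq_le (hδ n))).sub (hS.hasWeakDeriv a)
      refine h1.congr_ae isOpen_interior (.refl _ _) ?_
      rw [hΩ.restrict_interior]
      filter_upwards [hgrad] with x hx
      have : density μ x ^ 2 + δ n ^ 2 ≠ 0 := by have := hδ n; positivity
      simp only [hx, real_inner_smul_left, σ]
      field_simp
      ring
    have hat : ∀ n, HasWeakDeriv (interior Ω) (fun x => Real.arctan (w n x)) a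
        (fun x => 1 / (1 + w n x ^ 2) * (- (δ n ^ 2 / (density μ x ^ 2 + δ n ^ 2)) * σ x)) :=
      fun n => (hw n).comp isOpen_interior (F := Real.arctan) (F' := fun s => 1 / (1 + s ^ 2))
        (C := 1) Real.hasDerivAt_arctan (by fun_prop (disch := intros; positivity)) fun s => by
          rw [abs_of_nonneg (by positivity), div_le_one (by positivity)]
          nlinarith [sq_nonneg s]
    refine HasWeakDeriv.of_tendsto isOpen_interior hat (b := fun _ => Real.pi / 2)
      (G := fun x => |σ x|) ((locallyIntegrable_const _).locallyIntegrableOn _)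
      (hS.hasWeakDeriv a).locallyIntegrableOn_deriv.norm (fun n x => ?_) (fun n => ?_) ?_ ?_
    · exact abs_le.2 ⟨(Real.neg_pi_div_two_lt_arctan _).le, (Real.arctan_lt_pi_div_two _).le⟩
    · refine .of_forall fun x => ?_
      rw [← mul_assoc, abs_mul]
      refine mul_le_of_le_one_left (abs_nonneg _) ?_
      rw [abs_mul, abs_neg, abs_of_nonneg (by positivity), abs_of_nonneg (by positivity)]
      refine mul_le_one₀ ?_ (by positivity) ?_
      · rw [div_le_one (by positivity)]
        nlinarith [sq_nonneg (w n x)]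
      · have := hδ n
        rw [div_le_one (by positivity)]
        nlinarith [sq_nonneg (density μ x)]
    · rw [hΩ.restrict_interior]
      filter_upwards [hpos] with x hx
      refine (Real.continuous_arctan.tendsto _).comp (Tendsto.sub_const ?_ _)
      have h1 : Tendsto (fun n => density μ x ^ 2 + δ n ^ 2) atTop (𝓝 (density μ x ^ 2)) := by
        simpa using (hδl.pow 2).const_add (density μ x ^ 2)
      have h2 := ((Real.continuousAt_log (by positivity)).tendsto.comp h1).const_mul (1 / 2)
      have h3 : 1 / 2 * Real.log (density μ x ^ 2) = Real.log (density μ x) := by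
        rw [Real.log_pow]
        push_cast
        ring
      rw [h3] at h2
      exact h2
    · rw [hΩ.restrict_interior]
      filter_upwards [hpos] with x hx
      have h1 : Tendsto (fun n => δ n ^ 2 / (density μ x ^ 2 + δ n ^ 2)) atTop (𝓝 0) := by
        have := (hδl.pow 2).div ((hδl.pow 2).const_add (density μ x ^ 2)) (by simp; positivity)
        rw [zero_pow two_ne_zero, zero_div] at this
        exact this
      have h2 : Tendsto (fun n => δ n ^ 2 / (density μ x ^ 2 + δ n ^ 2) * |σ x|) atTop (𝓝 0) := by
        simpa using h1.mul_const |σ x|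
      refine squeeze_zero_norm (fun n => ?_) h2
      have := hδ n
      rw [Real.norm_eq_abs, abs_mul, abs_mul, abs_neg, abs_of_nonneg (by positivity),
        abs_of_nonneg (by positivity)]
      refine mul_le_of_le_one_left (by positivity) ?_
      rw [div_le_one (by positivity)]
      nlinarith [sq_nonneg (w n x)]
  obtain ⟨c, hc⟩ := exists_ae_eq_const_of_hasWeakDeriv_zero isOpen_interior
    hΩ.isPreconnected_interior hderiv
  rw [hΩ.restrict_interior] at hc
  -- Undoing `arctan` and `log` in $\arctan(\log\mu-\log\pi)=c$ gives $\mu=e^{\tan c}\,\pi$.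
  refine hμ.eq_of_density_ae_eq (c := Real.exp (Real.tan c)) hΩ.isCompact.measurableSet hπ ?_
  filter_upwards [hc, hpos, hposπ] with x hx h1 h2
  rw [← hx, Real.tan_arctan, Real.exp_sub, Real.exp_log h1, Real.exp_log h2]
  field_simp

end Separation

end

end SteinKSD

/-! ### Existence of the maximum and separation of measures -/

theorem mainTheorem3 {d : ℕ} (Ω : Set (SteinKSD.Eucl d)) (hΩ : SteinKSD.IsSmoothCompactDomain Ω)
    (μ π : MeasureTheory.Measure (SteinKSD.Eucl d))
    (hμ : SteinKSD.MemP2 Ω μ) (hπ : SteinKSD.MemP2 Ω π)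
    (hscore : SteinKSD.HasSquareIntegrableScore Ω μ π)
    (k : SteinKSD.Eucl d → SteinKSD.Eucl d → ℝ) (hk : SteinKSD.IsSteinKernel Ω μ π k)
    (H₀ : Type*) [NormedAddCommGroup H₀] [InnerProductSpace ℝ H₀] [CompleteSpace H₀]
    [RKHS ℝ H₀ Ω ℝ] (hH₀ : ∀ x y : Ω, RKHS.kernel H₀ x y 1 = k x y) :
    -- `E_{x ∼ μ}[A_π f(x)]` is well defined for every `f` in the product RKHS,
    (∀ f : SteinKSD.ProductRKHS d H₀,
      (∀ i, SteinKSD.WeaklyDifferentiable Ω (fun x => SteinKSD.toField f x i)) ∧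
      MeasureTheory.Integrable (SteinKSD.steinOp Ω π (SteinKSD.toField f)) μ) ∧
    -- the discrepancy is a maximum,
    IsGreatest (SteinKSD.steinValues Ω H₀ μ π) (SteinKSD.ksd Ω H₀ μ π) ∧
    -- and it separates `μ` and `π`.
    (μ = π ↔ SteinKSD.ksd Ω H₀ μ π = 0) := by
  obtain ⟨C, hC⟩ := SteinKSD.exists_weakGrad_toFun₀_le (H₀ := H₀) hΩ hH₀ hk
  obtain ⟨a, hai, ha⟩ := SteinKSD.exists_inner_eq_integral_steinOp (H₀ := H₀) hΩ hμ hscore hk hH₀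
  have hgr := SteinKSD.isGreatest_steinValues fun f => (ha f).2
  have hksd : SteinKSD.ksd Ω H₀ μ π = ‖a‖ := hgr.csSup_eq
  have hm := hΩ.isCompact.measurableSet
  refine ⟨fun f => ⟨fun i => (hC (f i)).1, (ha f).1⟩, hksd ▸ hgr, ?_⟩
  have hval : ∀ i, ∀ x ∈ Ω, inner ℝ (a i) (SteinKSD.kerVec Ω H₀ x) =
      ∫ y in Ω, (SteinKSD.density μ y * SteinKSD.score Ω π y i -
        SteinKSD.weakGrad Ω (SteinKSD.density μ) y i) * k y x := by
    intro i x hx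
    rw [← hai, ← SteinKSD.integral_steinIntegrand_eq hΩ hμ hscore (hk.memSteinClass_left x hx i)]
    -- The element $k_x$ of $\mathcal H_0$, extended by zero, agrees with $k(\cdot,x)$ only on
    -- $\Omega$; the integrand must be transferred along this a.e. equality, weak gradient included.
    have hae : SteinKSD.toFun₀ (SteinKSD.kerVec Ω H₀ x) =ᵐ[MeasureTheory.volume.restrict Ω]
        fun y => k y x := by
      filter_upwards [MeasureTheory.ae_restrict_mem hm] with y hy
      exact SteinKSD.toFun₀_kerVec hH₀ hy hx
    refine MeasureTheory.integral_congr_ae ?_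
    filter_upwards [hae, SteinKSD.weakGrad_congr_ae hΩ (hC _).1 hae] with y h1 h2
    simp only [SteinKSD.steinIntegrand, h1, h2]
  -- Since $\langle a_i,k_x\rangle=a_i(x)$, kernel sections detect whether the Riesz representative
  -- vanishes.
  have hzero : SteinKSD.ksd Ω H₀ μ π = 0 ↔ ∀ i, ∀ x ∈ Ω,
      inner ℝ (a i) (SteinKSD.kerVec Ω H₀ x) = 0 := by
    rw [hksd, norm_eq_zero]
    refine ⟨fun h i x _ => by simp [h], fun h => ?_⟩
    ext i x
    have := h i x x.2
    rw [SteinKSD.inner_kerVec, SteinKSD.toFun₀_of_mem _ x.2] at this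
    simpa using this
  rw [hzero]
  constructor
  · rintro rfl i x hx
    rw [hval i x hx]
    refine MeasureTheory.integral_eq_zero_of_ae ?_
    filter_upwards [SteinKSD.weakGrad_density_eq hΩ hμ hscore.1 i] with y hy
    simp [hy]
  · intro h
    refine SteinKSD.eq_of_weakGrad_density_eq hΩ hμ hπ hscore.1 fun i => ?_
    -- Applied to $g=\mu\,\partial_i\log\pi-\partial_i\mu$, which is in $L^2(\Omega)$ by the score
    -- hypothesis and $\mu\in H^1(\Omega)$.
    have h0 := SteinKSD.ae_eq_zero_of_integral_mul_kernel_eq_zero hm hk.integrallyPosDef hk.symm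
      ((hscore.memLp_apply i).sub (SteinKSD.memLp_apply hμ.memH1_density.2.2 i))
      fun x hx => (hval i x hx).symm.trans (h i x hx)
    filter_upwards [h0] with y hy
    exact (sub_eq_zero.1 hy).symm
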